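/- For $x\in\mathbb R$ put $\langle x\rangle=(1+x^2)^{1/2}$, let $\mathbb T=\mathbb R/2\pi\mathbb Z$, and let $\widehat u(t,\xi)=\frac1{\sqrt{2\pi}}\int_0^{2\pi}e^{-ix\xi}u(t,x)\,dx$ ($\xi\in\mathbb Z$) denote the Fourier transform in $x$, and $\mathcal Fu(\tau,\xi)=\frac1{\sqrt{2\pi}}\int_{\mathbb R}e^{-it\tau}\widehat u(t,\xi)\,dt$ the space-time Fourier transform (understood in the $L^2$ or distributional sense) on $\mathbb R\times\mathbb T$. Let $$\|u\|_{\mathcal X^{\sigma,b}_{p,q}}=\Big\|\langle\xi\rangle^{\sigma}\big\|\langle\tau+\xi^2\rangle^{b}\mathcal Fu(\tau,\xi)\big\|_{L^q_\tau}\Big\|_{\ell^p_\xi},$$ $$\|u\|_{Y^\sigma}=\|u\|_{\mathcal X^{\sigma,1/2}_{2,2}}+\|u\|_{\mathcal X^{\sigma,0}_{2,1}},\qquad \|u\|_{Z^\sigma}=\|u\|_{\mathcal X^{\sigma,-1/2}_{2,2}}+\|u\|_{\mathcal X^{\sigma,-1}_{2,1}}.$$ Let $\Gamma_4$ be the set of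 $\overline\xi=(\xi_1,\xi_2,\xi_3,\xi_4)\in\mathbb Z^4$ with $\xi_1+\xi_2+\xi_3+\xi_4=0$ and $(\xi_1+\xi_4)(\xi_3+\xi_4)\neq0$, and for $\overline\xi\in\Gamma_4$ let $$M_4(\overline\xi)=\frac{\xi_1\langle\xi_3\rangle^{2s}+\xi_2\langle\xi_4\rangle^{2s}+\xi_3\langle\xi_1\rangle^{2s}+\xi_4\langle\xi_2\rangle^{2s}}{(\xi_1+\xi_4)(\xi_3+\xi_4)}.$$ **Lemma.** Let $1/4<a<s<\min\{1/2,3a/2\}$. There is a constant $C>0$, depending only on $a$ and $s$, such that for all $0<T<1$, all $u_1,u_2,u_3\in Y^a$ and all $u_4\in Z^a$, $$\left|\int_0^T\sum_{\overline\xi\in\Gamma_4}M_4(\overline\xi)\,\widehat{u_1}(t,\xi_1)\,\widehat{\overline{u_2}}(t,\xi_2)\,\widehat{u_3}(t,\xi_3)\,\widehat{\overline{u_4}}(t,\xi_4)\,dt\right|\le C\,\|u_4\|_{Z^a}\prod_{j=1}^3\|u_j\|_{Y^a}.$$ Here, if $u_4\in Z^a\cap L^2(\mathbb R\times\mathbb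 T)$, the sum converges absolutely for almost every $t\in[0,T]$ and is integrable in $t$ over $[0,T]$. For a general (distributional) $u_4\in Z^a$ the integral on the left is understood as the limit, which exists, as $R\to\infty$ of the same integrals with $u_4$ replaced by its truncation to the frequencies $|\tau|\le R$, $|\xi|\le R$. -/

import Mathlib

open MeasureTheory Filter Topology
open scoped ENNReal FourierTransform ComplexConjugate

noncomputable section

/-- The period of the torus `𝕋 = ℝ / 2πℤ` is positive. -/
instance fact_two_pi_pos : Fact (0 < 2 * Real.pi) := ⟨Real.two_pi_pos⟩

namespace DNLS

/-- The torus `𝕋 = ℝ / 2πℤ`; its `volume` has total mass `2π`. -/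
abbrev Torus : Type := AddCircle (2 * Real.pi)

/-- The Japanese bracket `⟨x⟩ = (1 + |x|²)^{1/2}`. -/
def jap (x : ℝ) : ℝ := Real.sqrt (1 + x ^ 2)

/-- The spatial Fourier transform
`F_x u (t, ξ) = (2π)^{-1/2} ∫_0^{2π} e^{-ixξ} u(t, x) dx`, for `ξ ∈ ℤ`. -/
def xFT (u : ℝ → Torus → ℂ) (t : ℝ) (ξ : ℤ) : ℂ :=
  ((1 / Real.sqrt (2 * Real.pi) : ℝ) : ℂ) *
    ∫ x in (0 : ℝ)..(2 * Real.pi), Complex.exp (-(Complex.I * x * ξ)) * u t (x : Torus)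

open Classical in
/-- The temporal Fourier transform of an `L²` function, which for integrable `f` is
`F_t f (τ) = (2π)^{-1/2} ∫ e^{-itτ} f(t) dt`. Mathlib's (Plancherel) transform `𝓕` on `L²(ℝ)` has
the kernel `e^{-2πitτ}`, hence the rescaling. (The value is `0` if `f` is not in `L²`.) -/
def tFT (f : ℝ → ℂ) (τ : ℝ) : ℂ :=
  if h : MemLp f 2 (volume : Measure ℝ) then
    ((1 / Real.sqrt (2 * Real.pi) : ℝ) : ℂ) *
      (𝓕 (h.toLp f) : Lp ℂ 2 (volume : Measure ℝ)) (τ / (2 * Real.pi))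
  else 0

/-- The space-time Fourier transform `F u (τ, ξ) = F_t F_x u (τ, ξ)`, for `u ∈ L²(ℝ × 𝕋)`. -/
def stFT (u : ℝ → Torus → ℂ) (τ : ℝ) (ξ : ℤ) : ℂ := tFT (fun t => xFT u t ξ) τ

/-- The norm `‖ ⟨ξ⟩^s ‖ ⟨τ + ξ²⟩^b U(τ, ξ) ‖_{L^q_τ} ‖_{ℓ^p_ξ}` of the space `𝒳^{s,b}_{p,q}`, in terms
of the space-time Fourier transform `U`. -/
def xNorm (p q : ℝ≥0∞) (s b : ℝ) (U : ℝ → ℤ → ℂ) : ℝ≥0∞ :=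
  eLpNorm (fun ξ : ℤ =>
    ENNReal.ofReal (jap ξ ^ s) *
      eLpNorm (fun τ : ℝ => ((jap (τ + (ξ : ℝ) ^ 2) ^ b : ℝ) : ℂ) * U τ ξ) q volume)
    p Measure.count

/-- The norm of `Y^s`, in terms of the space-time Fourier transform. -/
def yNorm (s : ℝ) (U : ℝ → ℤ → ℂ) : ℝ≥0∞ := xNorm 2 2 s (1 / 2) U + xNorm 2 1 s 0 U

/-- The norm of `Z^s`, in terms of the space-time Fourier transform. -/
def zNorm (s : ℝ) (U : ℝ → ℤ → ℂ) : ℝ≥0∞ := xNorm 2 2 s (-1 / 2) U + xNorm 2 1 s (-1) U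

/-- `u` is a (measurable) square integrable function on `ℝ × 𝕋`. -/
def IsL2 (u : ℝ → Torus → ℂ) : Prop :=
  MemLp (fun p : ℝ × Torus => u p.1 p.2) 2 ((volume : Measure ℝ).prod (volume : Measure Torus))

/-- `u ∈ Y^s`. For `s ≥ 0` the space `Y^s` embeds into `L²(ℝ × 𝕋)`, so that asking for an `L²`
function is no restriction. -/
def MemY (s : ℝ) (u : ℝ → Torus → ℂ) : Prop := IsL2 u ∧ yNorm s (stFT u) < ∞

/-- `u ∈ Z^s ∩ L²(ℝ × 𝕋)`. -/
def MemZL2 (s : ℝ) (u : ℝ → Torus → ℂ) : Prop := IsL2 u ∧ zNorm s (stFT u) < ∞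

/-- `U` is the space-time Fourier transform of an arbitrary element of `Z^s`, i.e. of a
distribution on `ℝ × 𝕋` whose Fourier transform is a measurable function with finite `Z^s` norm. -/
def MemZHat (s : ℝ) (U : ℝ → ℤ → ℂ) : Prop :=
  (∀ ξ : ℤ, AEStronglyMeasurable (fun τ => U τ ξ) volume) ∧ zNorm s U < ∞

/-- The function on `ℝ × 𝕋` whose space-time Fourier transform is `U` restricted to
`|τ| ≤ R, |ξ| ≤ R`, namely
`(1/2π) ∑_{|ξ| ≤ R} ∫_{-R}^R e^{i(tτ + xξ)} U(τ, ξ) dτ`; here `fourier ξ x = e^{ixξ}`. -/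
def truncation (U : ℝ → ℤ → ℂ) (R : ℕ) (t : ℝ) (x : Torus) : ℂ :=
  ((1 / (2 * Real.pi) : ℝ) : ℂ) * ∑ ξ ∈ Finset.Icc (-(R : ℤ)) (R : ℤ),
    (∫ τ in (-(R : ℝ))..(R : ℝ), Complex.exp (Complex.I * t * τ) * U τ ξ) * fourier ξ x

/-- The frequencies `(ξ₁, ξ₂, ξ₃, ξ₄) ∈ Γ₄ ∩ ℤ⁴` with `ξ₁₄ ξ₃₄ ≠ 0`, on which `M₄` is defined.
The entries `ξ 0, ξ 1, ξ 2, ξ 3` are `ξ₁, ξ₂, ξ₃, ξ₄`. -/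
def Gamma4 : Set (Fin 4 → ℤ) :=
  {ξ | ξ 0 + ξ 1 + ξ 2 + ξ 3 = 0 ∧ (ξ 0 + ξ 3) * (ξ 2 + ξ 3) ≠ 0}

/-- The symbol `M₄ = (ξ₁⟨ξ₃⟩^{2s} + ξ₂⟨ξ₄⟩^{2s} + ξ₃⟨ξ₁⟩^{2s} + ξ₄⟨ξ₂⟩^{2s}) / (ξ₁₄ ξ₃₄)`. -/
def M4 (s : ℝ) (ξ : Fin 4 → ℤ) : ℝ :=
  ((ξ 0 : ℝ) * jap (ξ 2) ^ (2 * s) + (ξ 1 : ℝ) * jap (ξ 3) ^ (2 * s)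
    + (ξ 2 : ℝ) * jap (ξ 0) ^ (2 * s) + (ξ 3 : ℝ) * jap (ξ 1) ^ (2 * s))
  / (((ξ 0 : ℝ) + ξ 3) * ((ξ 2 : ℝ) + ξ 3))

/-- The complex conjugate `ū` of a function `u`. -/
def bar (u : ℝ → Torus → ℂ) : ℝ → Torus → ℂ := fun t x => conj (u t x)

/-- The summand `M₄(ξ) F_x u₁(t,ξ₁) F_x ū₂(t,ξ₂) F_x u₃(t,ξ₃) F_x ū₄(t,ξ₄)`. -/
def quadTerm (s : ℝ) (u₁ u₂ u₃ u₄ : ℝ → Torus → ℂ) (t : ℝ) (ξ : Gamma4) : ℂ :=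
  (M4 s ξ.1 : ℂ) * xFT u₁ t (ξ.1 0) * xFT (bar u₂) t (ξ.1 1) * xFT u₃ t (ξ.1 2)
    * xFT (bar u₄) t (ξ.1 3)

/-- The sum of `quadTerm` over `Γ₄`, at time `t`. -/
def quadSum (s : ℝ) (u₁ u₂ u₃ u₄ : ℝ → Torus → ℂ) (t : ℝ) : ℂ :=
  ∑' ξ : Gamma4, quadTerm s u₁ u₂ u₃ u₄ t ξ

/-- The time-integrated quadrilinear form. -/
def quadForm (s T : ℝ) (u₁ u₂ u₃ u₄ : ℝ → Torus → ℂ) : ℂ :=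
  ∫ t in (0 : ℝ)..T, quadSum s u₁ u₂ u₃ u₄ t

end DNLS

end

/-! Put y = -ξ₄, m = ξ₁ + ξ₄, n = ξ₃ + ξ₄. Then ξ₁, ξ₃, -ξ₂, -ξ₄ are the corners y + m, y + n, y + m
+ n, y of a parallelogram, and after conjugation every factor is evaluated at a corner. The
modulations σ = τ + ξ² at the corners satisfy σ₄ = σ₁ - σ₂ + σ₃ + 2mn. The fourth factor is only in
Z^a, so a weight ⟨σ₄⟩^{1/2} must be recovered from the other modulations or from the resonance 2mn.

The symbol. Its numerator consists of first and second differences of ⟨x⟩^{2s}, whence |M₄| ≲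
⟨ξ₁⟩^{2s-1} + ⟨ξ₂⟩^{2s-1} + ⟨ξ₃⟩^{2s-1} (`abs_symb_le`). It also vanishes when opposite corners are
antipodal (`abs_symb_mul_le`). With 1 + 2ε ≤ 4a and 4s + 4ε ≤ 6a these bounds give `symb_sq_le` and
`weight_bound`, the latter being M₄² |mn|^{1+2ε} ≲ ∏ ⟨ξ_j⟩^{2a}.

The multilinear estimate (`exists_multilinear_bound`). If some σ_j with j ≤ 3 dominates, that factor
uses its weight ⟨σ_j⟩^{1/2} in L² while the other two use the L¹_τ part of the Y norm; the frequency
sum is then `exists_fixed_time_bound`. If |mn| dominates, the loss is |mn|^{1/2}. For fixed y and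
fixed modulations the fourth factor is sampled at the points 2mn + const. The divisor bound replaces
the sum over (m, n) by a sum over k = mn, and the samples at spacing 2 are square summable: the time
integral runs over [0, T] with T ≤ 1 < π, so they are Fourier coefficients on an interval of length
π. The spare ε pays for the divisor bound and for small negative powers of ⟨σ_j⟩, without which the
exponent b = 1/2 would just fail to control L¹_σ ℓ²_ξ.

The sharp cutoff. The transform of the indicator of [0, T] decays only like 1/|c|. Its commutator
with ⟨τ + ξ²⟩^{1/2} nevertheless gains ⟨τ + ξ²⟩^{-1/2}, and the remainder is exactly what the L¹
part of the Z norm controls (`enorm_integral_sharpCutoff_le`).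

For a distributional u₄ the estimate is applied to differences of truncations, whose Z norms tend to
0, so the truncated forms are Cauchy. -/

noncomputable section

namespace DNLS

/-! ### The Japanese bracket -/

lemma jap_sq (x : ℝ) : jap x ^ 2 = 1 + x ^ 2 := Real.sq_sqrt (by positivity)

lemma one_le_jap (x : ℝ) : 1 ≤ jap x :=
  Real.one_le_sqrt.2 (by nlinarith [sq_nonneg x])

lemma jap_pos (x : ℝ) : 0 < jap x := lt_of_lt_of_le one_pos (one_le_jap x)

lemma abs_le_jap (x : ℝ) : |x| ≤ jap x :=
  abs_le_of_sq_le_sq (by rw [jap_sq]; linarith) (jap_pos x).le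

lemma jap_neg (x : ℝ) : jap (-x) = jap x := by simp [jap]

lemma jap_le_jap {x y : ℝ} (h : |x| ≤ |y|) : jap x ≤ jap y :=
  Real.sqrt_le_sqrt (by linarith [sq_le_sq.2 h])

lemma jap_sub_le (x y : ℝ) : jap x - jap y ≤ |x - y| := by
  have h1 := jap_sq x
  have h2 := jap_sq y
  have h3 : x ^ 2 - y ^ 2 ≤ |x - y| * (jap x + jap y) := by
    calc x ^ 2 - y ^ 2 = (x - y) * (x + y) := by ring
      _ ≤ |x - y| * |x + y| := by rw [← abs_mul]; exact le_abs_self _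
      _ ≤ |x - y| * (jap x + jap y) := by
        gcongr
        exact (abs_add_le x y).trans (add_le_add (abs_le_jap x) (abs_le_jap y))
  have h4 : 0 < jap x + jap y := add_pos (jap_pos x) (jap_pos y)
  refine le_of_mul_le_mul_right ?_ h4
  nlinarith

lemma jap_add_le (x y : ℝ) : jap (x + y) ≤ jap x + |y| := by
  have := jap_sub_le (x + y) x
  simp only [add_sub_cancel_left] at this
  linarith

lemma jap_add_le_add (x y : ℝ) : jap (x + y) ≤ jap x + jap y :=
  (jap_add_le x y).trans (by linarith [abs_le_jap y])

lemma continuous_jap : Continuous jap := by unfold jap; fun_prop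

lemma continuous_jap_rpow (b : ℝ) : Continuous fun x => jap x ^ b :=
  continuous_jap.rpow_const fun x => Or.inl (jap_pos x).ne'

lemma jap_rpow_pos (x b : ℝ) : 0 < jap x ^ b := Real.rpow_pos_of_pos (jap_pos x) b

/-- Concavity bound for powers: `X ^ β - Y ^ β ≤ X ^ (β - 1) * (X - Y)`. -/
lemma rpow_sub_rpow_le {X Y β : ℝ} (hY : 0 < Y) (hXY : Y ≤ X) (hβ : β ≤ 1) :
    X ^ β - Y ^ β ≤ X ^ (β - 1) * (X - Y) := by
  have hX := hY.trans_le hXY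
  have e1 : X ^ β = X ^ (β - 1) * X := by
    rw [← Real.rpow_add_one hX.ne']; ring_nf
  have e2 : Y ^ β = Y ^ (β - 1) * Y := by
    rw [← Real.rpow_add_one hY.ne']; ring_nf
  have h : X ^ (β - 1) ≤ Y ^ (β - 1) :=
    Real.rpow_le_rpow_of_nonpos hY hXY (by linarith)
  nlinarith

/-- The factor may be taken at either endpoint. If `jap x` is the larger bracket this is
`rpow_sub_rpow_le`; if it is the smaller one, its nonpositive power is only larger. The symbol
estimates use this freedom to choose the corner; the commutator with the time cutoff uses `β = 1 /
2`. -/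
lemma abs_jap_rpow_sub_le {β : ℝ} (h0 : 0 ≤ β) (hβ : β ≤ 1) (x y : ℝ) :
    |jap x ^ β - jap y ^ β| ≤ jap x ^ (β - 1) * |x - y| := by
  rcases le_total (jap y) (jap x) with h | h
  · rw [abs_of_nonneg (sub_nonneg.2 (Real.rpow_le_rpow (jap_pos y).le h h0))]
    exact (rpow_sub_rpow_le (jap_pos y) h hβ).trans
      (mul_le_mul_of_nonneg_left (jap_sub_le x y) (jap_rpow_pos _ _).le)
  · rw [abs_sub_comm, abs_of_nonneg (sub_nonneg.2 (Real.rpow_le_rpow (jap_pos x).le h h0)),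
      abs_sub_comm]
    refine (rpow_sub_rpow_le (jap_pos x) h hβ).trans
      (mul_le_mul ?_ (jap_sub_le y x) (sub_nonneg.2 h) (jap_rpow_pos _ _).le)
    exact Real.rpow_le_rpow_of_nonpos (jap_pos x) h (by linarith)

lemma abs_sub_le_of_hasDerivAt {f f' : ℝ → ℝ} {x y C : ℝ} (hf : ∀ u, HasDerivAt f (f' u) u)
    (hC : ∀ u ∈ Set.uIcc x y, |f' u| ≤ C) : |f y - f x| ≤ C * |y - x| :=
  Convex.norm_image_sub_le_of_norm_hasDerivWithin_le (fun u _ => (hf u).hasDerivWithinAt) hC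
    (convex_uIcc x y) Set.left_mem_uIcc Set.right_mem_uIcc

lemma jap_rpow_two_mul (s x : ℝ) : jap x ^ (2 * s) = (1 + x ^ 2) ^ s := by
  rw [Real.rpow_mul (jap_pos x).le, Real.rpow_two, jap_sq]

lemma hasDerivAt_jap_rpow (s x : ℝ) :
    HasDerivAt (fun x => jap x ^ (2 * s)) (2 * s * (x * (1 + x ^ 2) ^ (s - 1))) x := by
  simp only [jap_rpow_two_mul]
  have h : HasDerivAt (fun x : ℝ => 1 + x ^ 2) (2 * x) x := by
    simpa using (hasDerivAt_pow 2 x).const_add 1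
  convert! h.rpow_const (p := s) (Or.inl (by positivity)) using 1
  ring

lemma hasDerivAt_deriv_jap_rpow (s x : ℝ) :
    HasDerivAt (fun x : ℝ => 2 * s * (x * (1 + x ^ 2) ^ (s - 1)))
      (2 * s * ((1 + x ^ 2) ^ (s - 1) + 2 * (s - 1) * (x ^ 2 * (1 + x ^ 2) ^ (s - 2)))) x := by
  have h : HasDerivAt (fun x : ℝ => 1 + x ^ 2) (2 * x) x := by
    simpa using (hasDerivAt_pow 2 x).const_add 1
  have h2 := h.rpow_const (p := s - 1) (Or.inl (by positivity))
  convert! ((hasDerivAt_id x).mul h2).const_mul (2 * s) using 1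
  simp only [id]
  ring_nf

lemma abs_second_deriv_le {s : ℝ} (h0 : 0 ≤ s) (h1 : s ≤ 1) (x : ℝ) :
    |2 * s * ((1 + x ^ 2) ^ (s - 1) + 2 * (s - 1) * (x ^ 2 * (1 + x ^ 2) ^ (s - 2)))|
      ≤ 2 * (1 + x ^ 2) ^ (s - 1) := by
  have hp : 0 < 1 + x ^ 2 := by positivity
  have e : (1 + x ^ 2) ^ (s - 1) = (1 + x ^ 2) ^ (s - 2) * (1 + x ^ 2) := by
    rw [← Real.rpow_add_one hp.ne']; ring_nf
  have hq : 0 < (1 + x ^ 2) ^ (s - 2) := Real.rpow_pos_of_pos hp _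
  rw [e]
  set q := (1 + x ^ 2) ^ (s - 2)
  have : 2 * s * (q * (1 + x ^ 2) + 2 * (s - 1) * (x ^ 2 * q))
      = 2 * q * (s * (1 + (2 * s - 1) * x ^ 2)) := by ring
  rw [this, abs_mul, abs_of_pos (by positivity : 0 < 2 * q), mul_assoc]
  have : |s * (1 + (2 * s - 1) * x ^ 2)| ≤ 1 + x ^ 2 := by
    rw [abs_mul, abs_of_nonneg h0]
    have : |1 + (2 * s - 1) * x ^ 2| ≤ 1 + x ^ 2 := by
      rw [abs_le]; constructor <;> nlinarith [sq_nonneg x]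
    nlinarith [abs_nonneg (1 + (2 * s - 1) * x ^ 2)]
  nlinarith

/-- Second differences of `⟨x⟩ ^ {2s}`, far from the origin. -/
lemma abs_second_diff_le {s : ℝ} (h0 : 0 ≤ s) (h1 : s ≤ 1) {y m n : ℝ} (hm : 3 * |m| ≤ |y|)
    (hn : 3 * |n| ≤ |y|) :
    |jap (y + m + n) ^ (2 * s) - jap (y + m) ^ (2 * s) - (jap (y + n) ^ (2 * s) - jap y ^ (2 * s))|
      ≤ 18 * jap y ^ (2 * s - 2) * |n| * |m| := by
  -- All points met below lie within |m| + |n| ≤ 2|y|/3 of y, hence at distance at least |y|/3 from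
  -- the origin. There 1 + u² ≥ (1 + y²)/9, and the exponent s - 1 ≥ -1 costs at most a factor 9;
  -- thus 18 = 2 · 9.
  have far : ∀ u : ℝ, |y| ≤ 3 * |u| →
      |2 * s * ((1 + u ^ 2) ^ (s - 1) + 2 * (s - 1) * (u ^ 2 * (1 + u ^ 2) ^ (s - 2)))|
        ≤ 18 * jap y ^ (2 * s - 2) := by
    intro u hu
    refine (abs_second_deriv_le h0 h1 u).trans ?_
    have e : jap y ^ (2 * s - 2) = (1 + y ^ 2) ^ (s - 1) := by
      rw [← jap_rpow_two_mul]; ring_nf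
    have hsq : y ^ 2 ≤ 9 * u ^ 2 := by
      have := sq_le_sq' (by linarith [abs_nonneg y, abs_nonneg u]) hu
      rw [mul_pow, sq_abs, sq_abs] at this; linarith
    have h2 : (1 + u ^ 2) ^ (s - 1) ≤ ((1 + y ^ 2) / 9) ^ (s - 1) :=
      Real.rpow_le_rpow_of_nonpos (by positivity) (by linarith) (by linarith)
    have h3 : ((1 + y ^ 2) / 9) ^ (s - 1) ≤ 9 * (1 + y ^ 2) ^ (s - 1) := by
      rw [Real.div_rpow (by positivity) (by norm_num), div_eq_mul_inv, mul_comm,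
        ← Real.rpow_neg (by norm_num)]
      gcongr
      calc (9 : ℝ) ^ (-(s - 1)) ≤ 9 ^ (1 : ℝ) :=
            Real.rpow_le_rpow_of_exponent_le (by norm_num) (by linarith)
        _ = 9 := Real.rpow_one 9
    rw [e]; linarith
  have key : ∀ t ∈ Set.uIcc 0 m, |2 * s * ((y + t + n) * (1 + (y + t + n) ^ 2) ^ (s - 1))
      - 2 * s * ((y + t) * (1 + (y + t) ^ 2) ^ (s - 1))| ≤ 18 * jap y ^ (2 * s - 2) * |n| := by
    intro t ht
    have ht' : |t| ≤ |m| := by simpa using Set.abs_sub_left_of_mem_uIcc ht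
    have := abs_sub_le_of_hasDerivAt (x := y + t) (y := y + t + n)
      (hasDerivAt_deriv_jap_rpow s) (C := 18 * jap y ^ (2 * s - 2)) (fun u hu => far u ?_)
    · simpa using this
    have hu' : |u - (y + t)| ≤ |n| := by simpa using Set.abs_sub_left_of_mem_uIcc hu
    have : |y| ≤ |u| + |u - (y + t)| + |t| := by
      calc |y| = |u - (u - (y + t)) - t| := by ring_nf
        _ ≤ |u - (u - (y + t))| + |t| := abs_sub _ _
        _ ≤ _ := by gcongr; exact abs_sub _ _
    linarith
  have hg : ∀ t, HasDerivAt (fun t => jap (y + t + n) ^ (2 * s) - jap (y + t) ^ (2 * s))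
      (2 * s * ((y + t + n) * (1 + (y + t + n) ^ 2) ^ (s - 1))
      - 2 * s * ((y + t) * (1 + (y + t) ^ 2) ^ (s - 1))) t := by
    intro t
    have h1 := (hasDerivAt_jap_rpow s (y + t + n)).comp t
      (((hasDerivAt_id t).const_add y).add_const n)
    have h2 := (hasDerivAt_jap_rpow s (y + t)).comp t ((hasDerivAt_id t).const_add y)
    convert! h1.sub h2 using 1
    simp
  have := abs_sub_le_of_hasDerivAt (x := 0) (y := m) hg key
  simpa using this

/-! ### The symbol -/

/-- The symbol in the variables `y = -ξ₄`, `m = ξ₁ + ξ₄`, `n = ξ₃ + ξ₄`. -/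
def symb (s y m n : ℝ) : ℝ :=
  ((y + m) * jap (y + n) ^ (2 * s) + (y + n) * jap (y + m) ^ (2 * s)
    - (y + m + n) * jap y ^ (2 * s) - y * jap (y + m + n) ^ (2 * s)) / (m * n)

/-- Together with `symb_reflect` this generates the symmetries of the parallelogram. As |mn| is
invariant too, any corner can serve as the base point y. -/
lemma symb_swap (s y m n : ℝ) : symb s y n m = symb s y m n := by
  unfold symb
  rw [show y + n + m = y + m + n by ring, mul_comm n m]
  congr 1; ring

lemma symb_reflect (s y m n : ℝ) : symb s (y + m) (-m) n = symb s y m n := by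
  unfold symb
  rw [show y + m + -m = y by ring, show y + m + n = y + n + m by ring,
    show -m * n = -(m * n) by ring, div_neg, ← neg_div]
  congr 1; ring

/-- Division by zero gives 0, so degenerate parallelograms contribute nothing and sums may run over
all integers m, n. -/
lemma symb_zero {s y m n : ℝ} (h : m * n = 0) : symb s y m n = 0 := by simp [symb, h]

/-- With f(x) = ⟨x⟩^{2s} and E the second difference of f, the numerator is m(f(y+n) - f(y)) +
n(f(y+m) - f(y)) - yE. The two first differences have the right size by `abs_jap_rpow_sub_le`. If
|y| < 3|m| or |y| < 3|n|, the factor y is absorbed by that step and E is split into two first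
differences in the other step; otherwise E is of order ⟨y⟩^{2s-2}|mn|. The corner y does not occur
on the right, which is essential when it is by far the smallest. -/
lemma abs_symb_le {s : ℝ} (h0 : 0 < s) (h1 : s < 1 / 2) (y m n : ℝ) :
    |symb s y m n| ≤ 60 * (jap (y + m) ^ (2 * s - 1) + jap (y + n) ^ (2 * s - 1)
      + jap (y + m + n) ^ (2 * s - 1)) := by
  have hA := jap_rpow_pos (y + m) (2 * s - 1)
  have hB := jap_rpow_pos (y + n) (2 * s - 1)
  have hD := jap_rpow_pos (y + m + n) (2 * s - 1)
  by_cases hmn : m * n = 0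
  · rw [symb_zero hmn, abs_zero]; positivity
  have hm : m ≠ 0 := left_ne_zero_of_mul hmn
  have hn : n ≠ 0 := right_ne_zero_of_mul hmn
  have pm : 0 < |m| := abs_pos.2 hm
  have pn : 0 < |n| := abs_pos.2 hn
  have L : ∀ x y, |jap x ^ (2 * s) - jap y ^ (2 * s)| ≤ jap x ^ (2 * s - 1) * |x - y| :=
    abs_jap_rpow_sub_le (by linarith) (by linarith)
  set f : ℝ → ℝ := fun x => jap x ^ (2 * s) with hf
  set E := f (y + m + n) - f (y + m) - (f (y + n) - f y) with hE
  have decomp : symb s y m n = (f (y + n) - f y) / n + (f (y + m) - f y) / m - y * E / (m * n) := by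
    simp only [symb, hE, hf]
    field_simp
    ring
  have b1 : |(f (y + n) - f y) / n| ≤ jap (y + n) ^ (2 * s - 1) := by
    rw [abs_div, div_le_iff₀ pn]; simpa using L (y + n) y
  have b2 : |(f (y + m) - f y) / m| ≤ jap (y + m) ^ (2 * s - 1) := by
    rw [abs_div, div_le_iff₀ pm]; simpa using L (y + m) y
  have b3 : |y * E / (m * n)| ≤ 50 * (jap (y + m) ^ (2 * s - 1) + jap (y + n) ^ (2 * s - 1)
      + jap (y + m + n) ^ (2 * s - 1)) := by
    rw [abs_div, abs_mul, abs_mul, div_le_iff₀ (by positivity)]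
    rcases lt_or_ge |y| (3 * |m|) with h | h
    · have : |E| ≤ jap (y + m + n) ^ (2 * s - 1) * |n| + jap (y + n) ^ (2 * s - 1) * |n| := by
        refine (abs_sub _ _).trans (add_le_add ?_ ?_)
        · simpa using L (y + m + n) (y + m)
        · simpa using L (y + n) y
      calc |y| * |E| ≤ (3 * |m|) *
            (jap (y + m + n) ^ (2 * s - 1) * |n| + jap (y + n) ^ (2 * s - 1) * |n|) := by gcongr
        _ = 3 * (jap (y + m + n) ^ (2 * s - 1) + jap (y + n) ^ (2 * s - 1)) * (|m| * |n|) := by ring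
        _ ≤ _ := by gcongr ?_ * _; linarith
    rcases lt_or_ge |y| (3 * |n|) with h' | h'
    · have : |E| ≤ jap (y + m + n) ^ (2 * s - 1) * |m| + jap (y + m) ^ (2 * s - 1) * |m| := by
        rw [show E = (f (y + m + n) - f (y + n)) - (f (y + m) - f y) by rw [hE]; ring]
        refine (abs_sub _ _).trans (add_le_add ?_ ?_)
        · simpa [show y + m + n - (y + n) = m by ring] using L (y + m + n) (y + n)
        · simpa using L (y + m) y
      calc |y| * |E| ≤ (3 * |n|) *
            (jap (y + m + n) ^ (2 * s - 1) * |m| + jap (y + m) ^ (2 * s - 1) * |m|) := by gcongr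
        _ = 3 * (jap (y + m + n) ^ (2 * s - 1) + jap (y + m) ^ (2 * s - 1)) * (|m| * |n|) := by ring
        _ ≤ _ := by gcongr ?_ * _; linarith
    · have hE' : |E| ≤ 18 * jap y ^ (2 * s - 2) * |n| * |m| :=
        abs_second_diff_le h0.le (by linarith) h h'
      have hy : |y| * jap y ^ (2 * s - 2) ≤ jap y ^ (2 * s - 1) := by
        have : jap y ^ (2 * s - 1) = jap y ^ (2 * s - 2) * jap y := by
          rw [← Real.rpow_add_one (jap_pos y).ne']; ring_nf
        rw [this, mul_comm]
        gcongr
        exacts [(jap_rpow_pos _ _).le, abs_le_jap y]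
      have hcomp : jap y ^ (2 * s - 1) ≤ 2 * jap (y + m) ^ (2 * s - 1) := by
        have h2 : jap (y + m) ≤ 2 * jap y := by
          have := jap_add_le y m
          have := abs_le_jap y
          linarith
        have := Real.rpow_le_rpow_of_nonpos (jap_pos (y + m)) h2 (by linarith : 2 * s - 1 ≤ 0)
        rw [Real.mul_rpow (by norm_num) (jap_pos y).le] at this
        have h4 : (1 : ℝ) / 2 ≤ 2 ^ (2 * s - 1) := by
          calc (1 : ℝ) / 2 = 2 ^ (-1 : ℝ) := by rw [Real.rpow_neg_one]; norm_num
            _ ≤ _ := Real.rpow_le_rpow_of_exponent_le (by norm_num) (by linarith)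
        nlinarith [jap_rpow_pos y (2 * s - 1)]
      calc |y| * |E| ≤ |y| * (18 * jap y ^ (2 * s - 2) * |n| * |m|) := by gcongr
        _ = 18 * (|y| * jap y ^ (2 * s - 2)) * (|m| * |n|) := by ring
        _ ≤ 18 * (2 * jap (y + m) ^ (2 * s - 1)) * (|m| * |n|) := by
          gcongr ?_ * _; linarith
        _ ≤ _ := by gcongr ?_ * _; linarith
  rw [decomp]
  calc _ ≤ |(f (y + n) - f y) / n + (f (y + m) - f y) / m| + |y * E / (m * n)| := abs_sub _ _
    _ ≤ |(f (y + n) - f y) / n| + |(f (y + m) - f y) / m| + |y * E / (m * n)| := by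
      gcongr; exact abs_add_le _ _
    _ ≤ _ := by linarith

/-- Since the bracket is even, the numerator vanishes when 2y + m + n = 0: the corners y + m, y + n
are then antipodal, and so are y, y + m + n. Comparing ⟨y+m⟩ with ⟨-(y+n)⟩ and ⟨y+m+n⟩ with ⟨-y⟩
makes the vanishing quantitative. This beats `abs_symb_le` when y and y + m + n are both much
smaller than the other two corners. -/
lemma abs_symb_mul_le {s : ℝ} (h0 : 0 < s) (h1 : s < 1 / 2) (y m n : ℝ) :
    |symb s y m n| * |m * n| ≤
      2 * |2 * y + m + n| * (jap (y + n) ^ (2 * s) + jap y ^ (2 * s)) := by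
  by_cases hmn : m * n = 0
  · rw [hmn, abs_zero, mul_zero]
    have := jap_rpow_pos (y + n) (2 * s)
    have := jap_rpow_pos y (2 * s)
    positivity
  have L : ∀ x z, |x * (jap z ^ (2 * s) - jap x ^ (2 * s))| ≤ jap x ^ (2 * s) * |x + z| := by
    intro x z
    have h := abs_jap_rpow_sub_le (β := 2 * s) (by linarith) (by linarith) x (-z)
    rw [jap_neg, sub_neg_eq_add, abs_sub_comm] at h
    have e : jap x ^ (2 * s) = jap x * jap x ^ (2 * s - 1) := by
      rw [mul_comm (jap x), ← Real.rpow_add_one (jap_pos x).ne']; ring_nf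
    rw [abs_mul]
    calc _ ≤ jap x * (jap x ^ (2 * s - 1) * |x + z|) := by
          gcongr
          exacts [(jap_pos x).le, abs_le_jap x]
      _ = jap x ^ (2 * s) * |x + z| := by rw [e]; ring
  have e : symb s y m n * (m * n) =
      ((2 * y + m + n) * jap (y + n) ^ (2 * s)
        + (y + n) * (jap (y + m) ^ (2 * s) - jap (y + n) ^ (2 * s)))
      - ((2 * y + m + n) * jap y ^ (2 * s) + y * (jap (y + m + n) ^ (2 * s) - jap y ^ (2 * s))) := by
    rw [symb, div_mul_cancel₀ _ hmn]; ring
  rw [← abs_mul, e]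
  have c1 := L (y + n) (y + m)
  have c2 := L y (y + m + n)
  rw [show y + n + (y + m) = 2 * y + m + n by ring] at c1
  rw [show y + (y + m + n) = 2 * y + m + n by ring] at c2
  have d1 : |(2 * y + m + n) * jap (y + n) ^ (2 * s)| = |2 * y + m + n| * jap (y + n) ^ (2 * s) := by
    rw [abs_mul, abs_of_pos (jap_rpow_pos _ _)]
  have d2 : |(2 * y + m + n) * jap y ^ (2 * s)| = |2 * y + m + n| * jap y ^ (2 * s) := by
    rw [abs_mul, abs_of_pos (jap_rpow_pos _ _)]
  refine (abs_sub _ _).trans ((add_le_add (abs_add_le _ _) (abs_add_le _ _)).trans ?_)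
  rw [d1, d2]
  linarith

/-! ### Pointwise bounds for the symbol against the regularity weights -/

/-- Comparison of monomials in `e ^ x, e ^ y, e ^ z`. -/
lemma rpow_mul_le_of_log {A B D p q r p' q' r' : ℝ} (hA : 1 ≤ A) (hB : 1 ≤ B) (hD : 1 ≤ D)
    (h : p * Real.log A + q * Real.log B + r * Real.log D
      ≤ p' * Real.log A + q' * Real.log B + r' * Real.log D) :
    A ^ p * B ^ q * D ^ r ≤ A ^ p' * B ^ q' * D ^ r' := by
  have e : ∀ {X : ℝ}, 1 ≤ X → ∀ p : ℝ, X ^ p = Real.exp (p * Real.log X) := by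
    intro X hX p
    rw [Real.rpow_def_of_pos (by linarith), mul_comm]
  simp only [e hA, e hB, e hD, ← Real.exp_add]
  exact Real.exp_le_exp.2 h

/-- The case of `weight_bound` in which `A` is the smallest of `A, B, D`. -/
lemma weight_bound_edge {a ε α K c A B D M m n : ℝ} (hε : 0 < ε) (hε' : ε ≤ 1 / 2)
    (h1 : 1 + 2 * ε ≤ 4 * a) (h2 : 2 + 4 * ε ≤ 6 * a + 2 * α) (hα : 0 < α) (hK : 0 ≤ K)
    (hc : 1 ≤ c) (hcA : c ≤ A) (hAB : A ≤ B) (hAD : A ≤ D) (hM0 : 0 ≤ M)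
    (hM : M ≤ K * (A ^ (-α) + B ^ (-α) + D ^ (-α)))
    (hm : |m| ≤ c + A) (hn : |n| ≤ c + B) (hn' : |n| ≤ A + D) :
    M ^ 2 * |m * n| ^ (1 + 2 * ε) ≤ 144 * K ^ 2 * (A ^ (2 * a) * B ^ (2 * a) * D ^ (2 * a)) := by
  have pA : 1 ≤ A := hc.trans hcA
  have pB : 1 ≤ B := pA.trans hAB
  have pD : 1 ≤ D := pA.trans hAD
  have iB : B ^ (-α) ≤ A ^ (-α) := Real.rpow_le_rpow_of_nonpos (by linarith) hAB (by linarith)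
  have iD : D ^ (-α) ≤ A ^ (-α) := Real.rpow_le_rpow_of_nonpos (by linarith) hAD (by linarith)
  have hM' : M ≤ 3 * K * A ^ (-α) := hM.trans (by nlinarith)
  have hMsq : M ^ 2 ≤ 9 * K ^ 2 * A ^ (-2 * α) := by
    calc M ^ 2 ≤ (3 * K * A ^ (-α)) ^ 2 := pow_le_pow_left₀ hM0 hM' 2
      _ = 9 * K ^ 2 * A ^ (-2 * α) := by
        rw [mul_pow, ← Real.rpow_natCast (A ^ (-α)), ← Real.rpow_mul (by linarith)]
        push_cast; ring_nf
  -- |m| ≤ 2A, while |n| is bounded once by 2B and once by 2D, so that the loss is shared equally by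
  -- the two larger brackets.
  have hL : |m * n| ^ 2 ≤ 16 * (A ^ 2 * B * D) := by
    rw [abs_mul, mul_pow]
    have e1 : |m| ^ 2 ≤ 4 * A ^ 2 := by nlinarith [abs_nonneg m]
    have e2 : |n| ^ 2 ≤ (2 * B) * (2 * D) := by
      rw [sq]; exact mul_le_mul (by linarith) (by linarith) (abs_nonneg n) (by linarith)
    calc |m| ^ 2 * |n| ^ 2 ≤ (4 * A ^ 2) * ((2 * B) * (2 * D)) := by gcongr
      _ = _ := by ring
  have hL' : |m * n| ^ (1 + 2 * ε) ≤ 16 * (A ^ (1 + 2 * ε) * B ^ (1 / 2 + ε) * D ^ (1 / 2 + ε)) := by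
    calc |m * n| ^ (1 + 2 * ε) = (|m * n| ^ 2) ^ (1 / 2 + ε) := by
          rw [← Real.rpow_natCast, ← Real.rpow_mul (abs_nonneg _)]; push_cast; ring_nf
      _ ≤ (16 * (A ^ 2 * B * D)) ^ (1 / 2 + ε) :=
          Real.rpow_le_rpow (by positivity) hL (by linarith)
      _ = 16 ^ (1 / 2 + ε) * (A ^ (1 + 2 * ε) * B ^ (1 / 2 + ε) * D ^ (1 / 2 + ε)) := by
          rw [Real.mul_rpow (by norm_num) (by positivity), Real.mul_rpow (by positivity) (by linarith),
            Real.mul_rpow (by positivity) (by linarith), ← Real.rpow_natCast A,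
            ← Real.rpow_mul (by linarith)]
          push_cast; ring_nf
      _ ≤ 16 * (A ^ (1 + 2 * ε) * B ^ (1 / 2 + ε) * D ^ (1 / 2 + ε)) := by
          gcongr
          calc (16 : ℝ) ^ (1 / 2 + ε) ≤ 16 ^ (1 : ℝ) :=
                Real.rpow_le_rpow_of_exponent_le (by norm_num) (by linarith)
            _ = 16 := Real.rpow_one _
  have lA := Real.log_nonneg pA
  have lB := Real.log_le_log (by linarith) hAB
  have lD := Real.log_le_log (by linarith) hAD
  -- Since 2a ≥ 1/2 + ε, the surplus powers of B and D may be lowered to A; what remains to compare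
  -- is 2 + 4ε - 2α ≤ 6a.
  have fin : A ^ (1 + 2 * ε - 2 * α) * B ^ (1 / 2 + ε) * D ^ (1 / 2 + ε)
      ≤ A ^ (2 * a) * B ^ (2 * a) * D ^ (2 * a) := by
    apply rpow_mul_le_of_log pA pB pD
    nlinarith [mul_nonneg (by linarith : 0 ≤ 2 * a - 1 / 2 - ε) (sub_nonneg.2 lB),
      mul_nonneg (by linarith : 0 ≤ 2 * a - 1 / 2 - ε) (sub_nonneg.2 lD)]
  calc M ^ 2 * |m * n| ^ (1 + 2 * ε)
      ≤ (9 * K ^ 2 * A ^ (-2 * α)) * (16 * (A ^ (1 + 2 * ε) * B ^ (1 / 2 + ε) * D ^ (1 / 2 + ε))) := by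
        gcongr
    _ = 144 * K ^ 2 * ((A ^ (1 + 2 * ε) * A ^ (-2 * α)) * B ^ (1 / 2 + ε) * D ^ (1 / 2 + ε)) := by ring
    _ = 144 * K ^ 2 * (A ^ (1 + 2 * ε - 2 * α) * B ^ (1 / 2 + ε) * D ^ (1 / 2 + ε)) := by
        rw [← Real.rpow_add (by linarith)]; ring_nf
    _ ≤ _ := by gcongr

/-- The case of `weight_bound` in which `D` is the smallest of `A, B, D`. -/
lemma weight_bound_diag {a ε α K c A B D M m n : ℝ} (hε : 0 < ε) (hε' : ε ≤ 1 / 2)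
    (ha : a ≤ 1 / 2) (ha0 : 0 < a) (h2 : 2 + 4 * ε ≤ 6 * a + 2 * α) (hα : 0 < α) (hK : 1 ≤ K)
    (hc : 1 ≤ c) (hcD : c ≤ D) (hDA : D ≤ A) (hDB : D ≤ B) (hM0 : 0 ≤ M)
    (hM : M ≤ K * (A ^ (-α) + B ^ (-α) + D ^ (-α))) (hM2 : M * |m * n| ≤ 8 * D * B ^ (1 - α))
    (hm : |m| ≤ c + A) (hn : |n| ≤ c + B) (hm' : A ≤ |m| + c) (hn' : B ≤ |n| + c)
    (hAB : A ≤ c + B + D) (hBA : B ≤ c + A + D) :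
    M ^ 2 * |m * n| ^ (1 + 2 * ε) ≤ 36864 * K ^ 2 * (A ^ (2 * a) * B ^ (2 * a) * D ^ (2 * a)) := by
  have pD : 1 ≤ D := hc.trans hcD
  have pA : 1 ≤ A := pD.trans hDA
  have pB : 1 ≤ B := pD.trans hDB
  -- If A and B both exceed 2D, then |m|, |n|, A and B are comparable, and the antipodal
  -- cancellation `hM2` is needed against the large |mn|. Otherwise A, B and D are all comparable
  -- and M ≲ D^{-α} suffices.
  by_cases hcase : 2 * D ≤ A ∧ 2 * D ≤ B
  · have lm : A / 2 ≤ |m| := by linarith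
    have ln : B / 2 ≤ |n| := by linarith
    have hA3 : B / 3 ≤ A := by linarith
    have hL : B ^ 2 / 12 ≤ |m * n| := by
      rw [abs_mul]
      calc B ^ 2 / 12 = (B / 3 / 2) * (B / 2) := by ring
        _ ≤ _ := by gcongr; linarith
    have pL : 0 < |m * n| := lt_of_lt_of_le (by positivity) hL
    -- Two powers of |mn| go with M² into `hM2`. The remaining exponent -1 + 2ε is nonpositive,
    -- which is why a lower bound for |mn| is wanted.
    have e1 : |m * n| ^ (1 + 2 * ε) = |m * n| ^ 2 * |m * n| ^ (-1 + 2 * ε) := by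
      rw [← Real.rpow_natCast, ← Real.rpow_add pL]; push_cast; ring_nf
    have e2 : |m * n| ^ (-1 + 2 * ε) ≤ 12 * B ^ (-2 + 4 * ε) := by
      calc |m * n| ^ (-1 + 2 * ε) ≤ (B ^ 2 / 12) ^ (-1 + 2 * ε) :=
            Real.rpow_le_rpow_of_nonpos (by positivity) hL (by linarith)
        _ = B ^ (-2 + 4 * ε) * 12 ^ (1 - 2 * ε) := by
          rw [Real.div_rpow (by positivity) (by norm_num), div_eq_mul_inv,
            ← Real.rpow_neg (by norm_num), ← Real.rpow_natCast B, ← Real.rpow_mul (by linarith)]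
          push_cast; ring_nf
        _ ≤ B ^ (-2 + 4 * ε) * 12 := by
          gcongr
          calc (12 : ℝ) ^ (1 - 2 * ε) ≤ 12 ^ (1 : ℝ) :=
                Real.rpow_le_rpow_of_exponent_le (by norm_num) (by linarith)
            _ = 12 := Real.rpow_one _
        _ = _ := by ring
    have e3 : (M * |m * n|) ^ 2 ≤ 64 * (D ^ (2 : ℝ) * B ^ (2 - 2 * α)) := by
      calc (M * |m * n|) ^ 2 ≤ (8 * D * B ^ (1 - α)) ^ 2 :=
            pow_le_pow_left₀ (by positivity) hM2 2
        _ = _ := by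
          rw [mul_pow, mul_pow, ← Real.rpow_natCast (B ^ (1 - α)), ← Real.rpow_mul (by linarith),
            ← Real.rpow_natCast D]
          push_cast; ring_nf
    have lB := Real.log_le_log (by linarith) hDB
    have lD := Real.log_nonneg pD
    have fin : D ^ (2 : ℝ) * B ^ (4 * ε - 2 * α) * (1:ℝ) ^ (0:ℝ)
        ≤ D ^ (2 * a) * B ^ (4 * a) * (1:ℝ) ^ (0:ℝ) := by
      apply rpow_mul_le_of_log pD pB le_rfl
      simp only [Real.log_one, mul_zero, add_zero]
      nlinarith [mul_nonneg (by linarith : 0 ≤ 2 - 2 * a) (sub_nonneg.2 lB),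
        mul_nonneg (by linarith : 0 ≤ 6 * a + 2 * α - 2 - 4 * ε) (lD.trans lB)]
    simp only [Real.one_rpow, mul_one] at fin
    have e4 : B ^ (4 * a) ≤ 3 * (A ^ (2 * a) * B ^ (2 * a)) := by
      have : B ^ (2 * a) ≤ 3 * A ^ (2 * a) := by
        calc B ^ (2 * a) = (3 * (B / 3)) ^ (2 * a) := by ring_nf
          _ = 3 ^ (2 * a) * (B / 3) ^ (2 * a) := Real.mul_rpow (by norm_num) (by positivity)
          _ ≤ 3 ^ (1 : ℝ) * A ^ (2 * a) := by
            gcongr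
            · norm_num
            · linarith
          _ = 3 * A ^ (2 * a) := by rw [Real.rpow_one]
      calc B ^ (4 * a) = B ^ (2 * a) * B ^ (2 * a) := by
            rw [← Real.rpow_add (by linarith)]; ring_nf
        _ ≤ 3 * A ^ (2 * a) * B ^ (2 * a) := by gcongr
        _ = _ := by ring
    calc M ^ 2 * |m * n| ^ (1 + 2 * ε) = (M * |m * n|) ^ 2 * |m * n| ^ (-1 + 2 * ε) := by
          rw [e1]; ring
      _ ≤ (64 * (D ^ (2 : ℝ) * B ^ (2 - 2 * α))) * (12 * B ^ (-2 + 4 * ε)) := by gcongr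
      _ = 768 * (D ^ (2 : ℝ) * (B ^ (2 - 2 * α) * B ^ (-2 + 4 * ε))) := by ring
      _ = 768 * (D ^ (2 : ℝ) * B ^ (4 * ε - 2 * α)) := by
          rw [← Real.rpow_add (by linarith)]; ring_nf
      _ ≤ 768 * (D ^ (2 * a) * (3 * (A ^ (2 * a) * B ^ (2 * a)))) := by
          gcongr 768 * ?_
          exact fin.trans (by gcongr)
      _ = 2304 * 1 * (A ^ (2 * a) * B ^ (2 * a) * D ^ (2 * a)) := by ring
      _ ≤ _ := by
          gcongr
          · norm_num
          · nlinarith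
  · have hA4 : A ≤ 4 * D := by
      by_contra hA; exact hcase ⟨by linarith, by linarith⟩
    have hB4 : B ≤ 4 * D := by
      by_contra hA; exact hcase ⟨by linarith, by linarith⟩
    have iA : A ^ (-α) ≤ D ^ (-α) := Real.rpow_le_rpow_of_nonpos (by linarith) hDA (by linarith)
    have iB : B ^ (-α) ≤ D ^ (-α) := Real.rpow_le_rpow_of_nonpos (by linarith) hDB (by linarith)
    have hM' : M ≤ 3 * K * D ^ (-α) := hM.trans (by nlinarith)
    have hMsq : M ^ 2 ≤ 9 * K ^ 2 * D ^ (-2 * α) := by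
      calc M ^ 2 ≤ (3 * K * D ^ (-α)) ^ 2 := pow_le_pow_left₀ hM0 hM' 2
        _ = 9 * K ^ 2 * D ^ (-2 * α) := by
          rw [mul_pow, ← Real.rpow_natCast (D ^ (-α)), ← Real.rpow_mul (by linarith)]
          push_cast; ring_nf
    have hL : |m * n| ≤ 64 * D ^ 2 := by
      rw [abs_mul]
      calc |m| * |n| ≤ (8 * D) * (8 * D) := by
            apply mul_le_mul _ _ (abs_nonneg _) <;> linarith
        _ = _ := by ring
    have hL' : |m * n| ^ (1 + 2 * ε) ≤ 4096 * D ^ (2 + 4 * ε) := by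
      calc |m * n| ^ (1 + 2 * ε) ≤ (64 * D ^ 2) ^ (1 + 2 * ε) :=
            Real.rpow_le_rpow (abs_nonneg _) hL (by linarith)
        _ = 64 ^ (1 + 2 * ε) * D ^ (2 + 4 * ε) := by
            rw [Real.mul_rpow (by norm_num) (by positivity), ← Real.rpow_natCast D,
              ← Real.rpow_mul (by linarith)]
            push_cast; ring_nf
        _ ≤ 4096 * D ^ (2 + 4 * ε) := by
            gcongr
            calc (64 : ℝ) ^ (1 + 2 * ε) ≤ 64 ^ (2 : ℝ) :=
                  Real.rpow_le_rpow_of_exponent_le (by norm_num) (by linarith)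
              _ = 4096 := by norm_num
    have lA := Real.log_le_log (by linarith) hDA
    have lB := Real.log_le_log (by linarith) hDB
    have lD := Real.log_nonneg pD
    have fin : A ^ (0:ℝ) * B ^ (0:ℝ) * D ^ (2 + 4 * ε - 2 * α)
        ≤ A ^ (2 * a) * B ^ (2 * a) * D ^ (2 * a) := by
      apply rpow_mul_le_of_log pA pB pD
      nlinarith [mul_nonneg (by linarith : 0 ≤ 2 * a) (sub_nonneg.2 lB),
        mul_nonneg (by linarith : 0 ≤ 2 * a) (sub_nonneg.2 lA),
        mul_nonneg (by linarith : 0 ≤ 6 * a + 2 * α - 2 - 4 * ε) lD]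
    simp only [Real.rpow_zero, one_mul] at fin
    calc M ^ 2 * |m * n| ^ (1 + 2 * ε)
        ≤ (9 * K ^ 2 * D ^ (-2 * α)) * (4096 * D ^ (2 + 4 * ε)) := by gcongr
      _ = 36864 * K ^ 2 * (D ^ (2 + 4 * ε) * D ^ (-2 * α)) := by ring
      _ = 36864 * K ^ 2 * D ^ (2 + 4 * ε - 2 * α) := by
        rw [← Real.rpow_add (by linarith)]; ring_nf
      _ ≤ _ := by gcongr

/-- With y the smallest corner, the position of the next smallest decides. If it is adjacent to y,
`weight_bound_edge` applies, up to exchanging m and n. If it is opposite to y, `weight_bound_diag`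
applies, with |2y + m + n| ≤ 2D fed into `abs_symb_mul_le`. The weight of y itself is at least 1 and
is not needed. -/
lemma weight_bound_of_min {a ε s : ℝ} (hε : 0 < ε) (hε' : ε ≤ 1 / 2) (hs : 0 < s) (hs' : s < 1 / 2)
    (ha : a ≤ 1 / 2) (ha0 : 0 < a)
    (h1 : 1 + 2 * ε ≤ 4 * a) (h2 : 2 + 4 * ε ≤ 6 * a + 2 * (1 - 2 * s)) {y m n : ℝ}
    (hA : |y| ≤ |y + m|) (hB : |y| ≤ |y + n|) (hD : |y| ≤ |y + m + n|) :
    symb s y m n ^ 2 * |m * n| ^ (1 + 2 * ε) ≤ 36864 * 60 ^ 2 *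
      (jap y ^ (2 * a) * jap (y + m) ^ (2 * a) * jap (y + n) ^ (2 * a)
        * jap (y + m + n) ^ (2 * a)) := by
  have hM := abs_symb_le hs hs' y m n
  have hM2 := abs_symb_mul_le hs hs' y m n
  rw [show 2 * s - 1 = -(1 - 2 * s) by ring] at hM
  have cA := jap_le_jap hA
  have cB := jap_le_jap hB
  have cD := jap_le_jap hD
  have hc := one_le_jap y
  have tri : ∀ u v : ℝ, |u - v| ≤ jap v + jap u := fun u v =>
    (abs_sub u v).trans (by linarith [abs_le_jap u, abs_le_jap v])
  have m1 := tri (y + m) y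
  have n1 := tri (y + n) y
  have m2 := tri (y + m + n) (y + n)
  have n2 := tri (y + m + n) (y + m)
  have p1 := tri (y + m + n) (-y)
  have q1 := jap_add_le y m
  have q2 := jap_add_le y n
  have AB : jap (y + m) ≤ jap y + jap (y + n) + jap (y + m + n) := by
    have := jap_add_le_add (y + m + n) (y + -(y + n))
    have := jap_add_le_add y (-(y + n))
    rw [jap_neg] at this
    rw [show y + m + n + (y + -(y + n)) = y + m by ring] at *
    linarith
  have BA : jap (y + n) ≤ jap y + jap (y + m) + jap (y + m + n) := by
    have := jap_add_le_add (y + m + n) (y + -(y + m))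
    have := jap_add_le_add y (-(y + m))
    rw [jap_neg] at this
    rw [show y + m + n + (y + -(y + m)) = y + n by ring] at *
    linarith
  have sq : symb s y m n ^ 2 = |symb s y m n| ^ 2 := (sq_abs _).symm
  rw [show y + m - y = m by ring] at m1
  rw [show y + n - y = n by ring] at n1
  rw [show y + m + n - (y + n) = m by ring] at m2
  rw [show y + m + n - (y + m) = n by ring] at n2
  rw [show y + m + n - -y = 2 * y + m + n by ring, jap_neg] at p1
  set c := jap y
  set A := jap (y + m)
  set B := jap (y + n)
  set D := jap (y + m + n)
  have hM0 := abs_nonneg (symb s y m n)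
  have pA : 0 < A := by linarith
  have pB : 0 < B := by linarith
  have pD : 0 < D := by linarith
  have main : symb s y m n ^ 2 * |m * n| ^ (1 + 2 * ε) ≤
      36864 * 60 ^ 2 * (A ^ (2 * a) * B ^ (2 * a) * D ^ (2 * a)) := by
    have pos : 0 ≤ A ^ (2 * a) * B ^ (2 * a) * D ^ (2 * a) := by positivity
    rw [sq]
    rcases le_total A B with hAB | hAB
    · rcases le_total A D with hAD | hAD
      · exact (weight_bound_edge hε hε' h1 h2 (by linarith) (by norm_num) hc cA hAB hAD hM0 hM m1 n1
          (by linarith)).trans (by nlinarith)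
      · refine weight_bound_diag hε hε' ha ha0 h2 (by linarith) (by norm_num) hc cD hAD
          (hAD.trans hAB) hM0 hM ?_ m1 n1 (by linarith) (by linarith) AB BA
        refine hM2.trans ?_
        have : c ^ (2 * s) ≤ B ^ (2 * s) := Real.rpow_le_rpow (by linarith) cB (by linarith)
        rw [show 1 - (1 - 2 * s) = 2 * s by ring]
        calc 2 * |2 * y + m + n| * (B ^ (2 * s) + c ^ (2 * s))
            ≤ 2 * (D + D) * (B ^ (2 * s) + B ^ (2 * s)) := by gcongr; linarith
          _ = _ := by ring
    · rcases le_total B D with hBD | hBD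
      · rw [mul_comm m n]
        have := weight_bound_edge hε hε' h1 h2 (by linarith) (by norm_num : (0:ℝ) ≤ 60) hc cB hAB hBD
          hM0 (hM.trans (le_of_eq (by ring))) n1 m1 (by linarith)
        refine this.trans ?_
        nlinarith
      · refine weight_bound_diag hε hε' ha ha0 h2 (by linarith) (by norm_num) hc cD (hBD.trans hAB)
          hBD hM0 hM ?_ m1 n1 (by linarith) (by linarith) AB BA
        refine hM2.trans ?_
        have : c ^ (2 * s) ≤ B ^ (2 * s) := Real.rpow_le_rpow (by linarith) cB (by linarith)
        rw [show 1 - (1 - 2 * s) = 2 * s by ring]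
        calc 2 * |2 * y + m + n| * (B ^ (2 * s) + c ^ (2 * s))
            ≤ 2 * (D + D) * (B ^ (2 * s) + B ^ (2 * s)) := by gcongr; linarith
          _ = _ := by ring
  refine main.trans ?_
  have c1 : 1 ≤ c ^ (2 * a) := Real.one_le_rpow hc (by linarith)
  have pos : 0 ≤ A ^ (2 * a) * B ^ (2 * a) * D ^ (2 * a) := by positivity
  calc 36864 * 60 ^ 2 * (A ^ (2 * a) * B ^ (2 * a) * D ^ (2 * a))
      ≤ 36864 * 60 ^ 2 * (c ^ (2 * a) * (A ^ (2 * a) * B ^ (2 * a) * D ^ (2 * a))) := by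
        exact mul_le_mul_of_nonneg_left (le_mul_of_one_le_left pos c1) (by norm_num)
    _ = _ := by ring

/-- The weight in the resonant interaction is dominated by the regularity of the four factors. -/
lemma weight_bound {a ε s : ℝ} (hε : 0 < ε) (hε' : ε ≤ 1 / 2) (hs : 0 < s) (hs' : s < 1 / 2)
    (ha : a ≤ 1 / 2) (ha0 : 0 < a)
    (h1 : 1 + 2 * ε ≤ 4 * a) (h2 : 2 + 4 * ε ≤ 6 * a + 2 * (1 - 2 * s)) (y m n : ℝ) :
    symb s y m n ^ 2 * |m * n| ^ (1 + 2 * ε) ≤ 36864 * 60 ^ 2 *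
      (jap y ^ (2 * a) * jap (y + m) ^ (2 * a) * jap (y + n) ^ (2 * a)
        * jap (y + m + n) ^ (2 * a)) := by
  have key : ∀ {y m n : ℝ}, |y| ≤ |y + m| → |y| ≤ |y + n| → |y| ≤ |y + m + n| → _ := fun hA hB hD =>
    weight_bound_of_min hε hε' hs hs' ha ha0 h1 h2 hA hB hD
  have symb_reflect' : ∀ y m n, symb s (y + n) m (-n) = symb s y m n := fun y m n => by
    rw [symb_swap, symb_reflect, symb_swap]
  -- reflections move any corner of the parallelogram to the base point
  have key2 : ∀ {y m n : ℝ}, |y| ≤ |y + m| → |y + n| ≤ |y + m + n| →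
      symb s y m n ^ 2 * |m * n| ^ (1 + 2 * ε) ≤ 36864 * 60 ^ 2 *
      (jap y ^ (2 * a) * jap (y + m) ^ (2 * a) * jap (y + n) ^ (2 * a)
        * jap (y + m + n) ^ (2 * a)) := by
    intro y m n hA hD
    rcases le_total |y| |y + n| with h | h
    · exact key hA h (h.trans hD)
    · have := key (y := y + n) (m := m) (n := -n) (by rwa [show y + n + m = y + m + n by ring])
        (by rwa [show y + n + -n = y by ring])
        (by rw [show y + n + m + -n = y + m by ring]; exact h.trans hA)
      rw [symb_reflect', show y + n + m + -n = y + m by ring, show y + n + m = y + m + n by ring,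
        show y + n + -n = y by ring, show m * -n = -(m * n) by ring, abs_neg] at this
      refine this.trans (le_of_eq ?_)
      ring
  have key3 : ∀ {y m n : ℝ}, |y| ≤ |y + m| →
      symb s y m n ^ 2 * |m * n| ^ (1 + 2 * ε) ≤ 36864 * 60 ^ 2 *
      (jap y ^ (2 * a) * jap (y + m) ^ (2 * a) * jap (y + n) ^ (2 * a)
        * jap (y + m + n) ^ (2 * a)) := by
    intro y m n hA
    rcases le_total |y + n| |y + m + n| with h | h
    · exact key2 hA h
    · rcases le_total |y| |y + n| with h3 | h3
      · rcases le_total |y| |y + m + n| with h4 | h4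
        · exact key hA h3 h4
        · have := key (y := y + m + n) (m := -m) (n := -n)
            (by rwa [show y + m + n + -m = y + n by ring])
            (by rw [show y + m + n + -n = y + m by ring]; exact h4.trans hA)
            (by rwa [show y + m + n + -m + -n = y by ring])
          rw [show y + m + n = y + n + m by ring, symb_reflect, symb_reflect',
            show y + n + m + -m + -n = y by ring, show y + n + m + -m = y + n by ring,
            show y + n + m + -n = y + m by ring, show -m * -n = m * n by ring] at this
          rw [show y + m + n = y + n + m by ring]
          refine this.trans (le_of_eq ?_)
          ring
      · have := key (y := y + m + n) (m := -m) (n := -n)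
          (by rwa [show y + m + n + -m = y + n by ring])
          (by rw [show y + m + n + -n = y + m by ring]; exact (h.trans h3).trans hA)
          (by rw [show y + m + n + -m + -n = y by ring]; exact h.trans h3)
        rw [show y + m + n = y + n + m by ring, symb_reflect, symb_reflect',
          show y + n + m + -m + -n = y by ring, show y + n + m + -m = y + n by ring,
          show y + n + m + -n = y + m by ring, show -m * -n = m * n by ring] at this
        rw [show y + m + n = y + n + m by ring]
        refine this.trans (le_of_eq ?_)
        ring
  rcases le_total |y| |y + m| with h | h
  · exact key3 h
  · have := key3 (y := y + m) (m := -m) (n := n) (by rwa [show y + m + -m = y by ring])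
    rw [symb_reflect, show y + m + -m = y by ring, show -m * n = -(m * n) by ring, abs_neg] at this
    refine this.trans (le_of_eq ?_)
    ring

/-- The square of the symbol, weighted by three of the four regularities, is summable. -/
lemma symb_sq_le {a ε s : ℝ} (hε : 0 < ε) (hs : 0 < s) (hs' : s < 1 / 2)
    (h1 : 1 + 2 * ε ≤ 4 * a) (h2 : 2 + 4 * ε ≤ 6 * a + 2 * (1 - 2 * s)) (y m n : ℝ) :
    symb s y m n ^ 2 ≤ 180 ^ 2 *
      (jap (y + m) ^ (2 * a) * jap (y + n) ^ (2 * a) * jap (y + m + n) ^ (2 * a)) *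
      (jap (y + m) ^ (-1 - 2 * ε) * jap (y + n) ^ (-1 - 2 * ε)
        + jap (y + m) ^ (-1 - 2 * ε) * jap (y + m + n) ^ (-1 - 2 * ε)
        + jap (y + n) ^ (-1 - 2 * ε) * jap (y + m + n) ^ (-1 - 2 * ε)) := by
  have hM := abs_symb_le hs hs' y m n
  have pA := one_le_jap (y + m)
  have pB := one_le_jap (y + n)
  have pD := one_le_jap (y + m + n)
  rw [← sq_abs]
  have hM0 := abs_nonneg (symb s y m n)
  set A := jap (y + m)
  set B := jap (y + n)
  set D := jap (y + m + n)
  set S := |symb s y m n|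
  -- `X ≤ Y ≤ Z` is an ordering of the three brackets
  have core : ∀ X Y Z : ℝ, 1 ≤ X → X ≤ Y → Y ≤ Z →
      S ≤ 60 * (X ^ (2 * s - 1) + Y ^ (2 * s - 1) + Z ^ (2 * s - 1)) →
      S ^ 2 ≤ 180 ^ 2 * (X ^ (2 * a) * Y ^ (2 * a) * Z ^ (2 * a))
        * (X ^ (-1 - 2 * ε) * Y ^ (-1 - 2 * ε)) := by
    intro X Y Z hX hXY hYZ hS
    have hY := hX.trans hXY
    have hZ := hY.trans hYZ
    have i1 : Y ^ (2 * s - 1) ≤ X ^ (2 * s - 1) :=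
      Real.rpow_le_rpow_of_nonpos (by linarith) hXY (by linarith)
    have i2 : Z ^ (2 * s - 1) ≤ Y ^ (2 * s - 1) :=
      Real.rpow_le_rpow_of_nonpos (by linarith) hYZ (by linarith)
    have hS' : S ≤ 180 * X ^ (2 * s - 1) := hS.trans (by linarith)
    have lX := Real.log_nonneg hX
    have lY := Real.log_le_log (by linarith) hXY
    have lZ := Real.log_le_log (by linarith) hYZ
    calc S ^ 2 ≤ (180 * X ^ (2 * s - 1)) ^ 2 := pow_le_pow_left₀ hM0 hS' 2
      _ = 180 ^ 2 * (X ^ (2 * (2 * s - 1)) * Y ^ (0:ℝ) * Z ^ (0:ℝ)) := by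
        rw [mul_pow, ← Real.rpow_natCast (X ^ (2 * s - 1)), ← Real.rpow_mul (by linarith)]
        simp only [Real.rpow_zero]; push_cast; ring_nf
      _ ≤ 180 ^ 2 * (X ^ (2 * a - 1 - 2 * ε) * Y ^ (2 * a - 1 - 2 * ε) * Z ^ (2 * a)) := by
        gcongr 180 ^ 2 * ?_
        -- Lower Z to Y using 2a ≥ 0, then Y to X using 4a ≥ 1 + 2ε; the total exponent left on X is
        -- nonnegative by `h2`.
        apply rpow_mul_le_of_log hX hY hZ
        nlinarith [mul_nonneg (by linarith : 0 ≤ 2 * a) (sub_nonneg.2 lZ),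
          mul_nonneg (by linarith : 0 ≤ 4 * a - 1 - 2 * ε) (sub_nonneg.2 lY),
          mul_nonneg (by linarith : 0 ≤ 6 * a + 2 * (1 - 2 * s) - 2 - 4 * ε) lX]
      _ = 180 ^ 2 * ((X ^ (2 * a) * X ^ (-1 - 2 * ε)) * (Y ^ (2 * a) * Y ^ (-1 - 2 * ε))
            * Z ^ (2 * a)) := by
        rw [← Real.rpow_add (by linarith), ← Real.rpow_add (by linarith)]; ring_nf
      _ = _ := by ring
  have qA : 0 < A ^ (-1 - 2 * ε) := Real.rpow_pos_of_pos (by linarith) _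
  have qB : 0 < B ^ (-1 - 2 * ε) := Real.rpow_pos_of_pos (by linarith) _
  have qD : 0 < D ^ (-1 - 2 * ε) := Real.rpow_pos_of_pos (by linarith) _
  have q : 0 < 180 ^ 2 * (A ^ (2 * a) * B ^ (2 * a) * D ^ (2 * a)) := by positivity
  have w1 := mul_pos q (mul_pos qA qB)
  have w2 := mul_pos q (mul_pos qA qD)
  have w3 := mul_pos q (mul_pos qB qD)
  rw [mul_add, mul_add]
  rcases le_total A B with hAB | hAB <;> rcases le_total A D with hAD | hAD <;>
    rcases le_total B D with hBD | hBD
  · linarith [core A B D pA hAB hBD (by linarith)]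
  · linarith [core A D B pA hAD hBD (by linarith)]
  · linarith [core A B D pA hAB hBD (by linarith)]
  · linarith [core D A B pD hAD hAB (by linarith)]
  · linarith [core B A D pB hAB hAD (by linarith)]
  · linarith [core A D B pA hAD hBD (by linarith)]
  · linarith [core B D A pB hBD hAD (by linarith)]
  · linarith [core D B A pD hBD hAB (by linarith)]

/-! ### The divisor bound -/

/-- For p ≥ 2^{1/ε} one has p^ε ≥ 2, and e + 1 ≤ 2^e needs no constant. For smaller p, the bound
p^{eε} ≥ 1 + εe log 2 dominates e + 1 up to a constant. Hence only boundedly many primes contribute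
a constant to the divisor bound. -/
lemma succ_le_mul_rpow {ε : ℝ} (hε : 0 < ε) {p : ℕ} (hp : 2 ≤ p) (e : ℕ) :
    (e + 1 : ℝ) ≤ (if (p : ℝ) < 2 ^ (1 / ε) then 1 / (ε * Real.log 2) + 1 else 1)
      * ((p : ℝ) ^ e) ^ ε := by
  have hp0 : (0 : ℝ) < p := by positivity
  have hl2 : 0 < Real.log 2 := Real.log_pos (by norm_num)
  have hcomm : ((p : ℝ) ^ e) ^ ε = ((p : ℝ) ^ ε) ^ e := by
    rw [← Real.rpow_natCast, ← Real.rpow_mul hp0.le, ← Real.rpow_natCast, ← Real.rpow_mul hp0.le,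
      mul_comm]
  split_ifs with h
  · have h1 : 1 + ε * e * Real.log 2 ≤ ((p : ℝ) ^ e) ^ ε := by
      have h2 : ((2 : ℝ) ^ e) ^ ε ≤ ((p : ℝ) ^ e) ^ ε := by
        gcongr; exact_mod_cast hp
      refine le_trans ?_ h2
      rw [← Real.rpow_natCast, ← Real.rpow_mul (by norm_num), Real.rpow_def_of_pos (by norm_num)]
      have := Real.add_one_le_exp (Real.log 2 * (e * ε))
      linarith
    have : (e + 1 : ℝ) ≤ (1 / (ε * Real.log 2) + 1) * (1 + ε * e * Real.log 2) := by
      have e1 : (1 / (ε * Real.log 2) + 1) * (1 + ε * e * Real.log 2)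
          = 1 / (ε * Real.log 2) + e + 1 + ε * e * Real.log 2 := by field_simp; ring
      rw [e1]
      have : 0 ≤ 1 / (ε * Real.log 2) := by positivity
      have : 0 ≤ ε * e * Real.log 2 := by positivity
      linarith
    exact this.trans (by gcongr)
  · rw [one_mul, hcomm]
    have h2 : (2 : ℝ) ≤ (p : ℝ) ^ ε := by
      calc (2 : ℝ) = (2 ^ (1 / ε)) ^ ε := by
            rw [← Real.rpow_mul (by norm_num), one_div, inv_mul_cancel₀ hε.ne', Real.rpow_one]
        _ ≤ _ := by gcongr; exact not_lt.1 h
    calc (e + 1 : ℝ) ≤ 2 ^ e := by exact_mod_cast Nat.lt_two_pow_self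
      _ ≤ _ := by gcongr

/-- The divisor bound `d(n) ≤ C_ε n ^ ε`. -/
lemma exists_card_divisors_le {ε : ℝ} (hε : 0 < ε) :
    ∃ C : ℝ, 1 ≤ C ∧ ∀ n : ℕ, n ≠ 0 → (n.divisors.card : ℝ) ≤ C * (n : ℝ) ^ ε := by
  have hl2 : 0 < Real.log 2 := Real.log_pos (by norm_num)
  set K : ℝ := 1 / (ε * Real.log 2) + 1 with hK
  have hK1 : 1 ≤ K := by
    have : 0 ≤ 1 / (ε * Real.log 2) := by positivity
    linarith
  set N : ℕ := ⌈(2 : ℝ) ^ (1 / ε)⌉₊ with hN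
  refine ⟨K ^ N, one_le_pow₀ hK1, fun n hn => ?_⟩
  rw [Nat.card_divisors hn]
  push_cast
  have hn' : (n : ℝ) = ∏ p ∈ n.primeFactors, (p : ℝ) ^ n.factorization p := by
    conv_lhs => rw [← Nat.prod_factorization_pow_eq_self hn]
    rw [Finsupp.prod, Nat.support_factorization]
    push_cast; rfl
  calc ∏ p ∈ n.primeFactors, ((n.factorization p : ℝ) + 1)
      ≤ ∏ p ∈ n.primeFactors, ((if (p : ℝ) < 2 ^ (1 / ε) then K else 1)
        * ((p : ℝ) ^ n.factorization p) ^ ε) :=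
        Finset.prod_le_prod (fun _ _ => by positivity)
          fun p hp => succ_le_mul_rpow hε (Nat.prime_of_mem_primeFactors hp).two_le _
    _ = (∏ p ∈ n.primeFactors, (if (p : ℝ) < 2 ^ (1 / ε) then K else 1)) * (n : ℝ) ^ ε := by
        rw [Finset.prod_mul_distrib, hn', Real.finsetProd_rpow _ _ (fun _ _ => by positivity)]
    _ ≤ K ^ N * (n : ℝ) ^ ε := by
        gcongr
        rw [← Finset.prod_filter, Finset.prod_const]
        apply pow_le_pow_right₀ hK1
        calc _ ≤ (Finset.range N).card := by
              apply Finset.card_le_card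
              intro p hp
              rw [Finset.mem_filter] at hp
              rw [Finset.mem_range, hN]
              exact Nat.lt_ceil.2 hp.2
          _ = N := Finset.card_range N

lemma tsum_dvd_le {k : ℤ} (hk : k ≠ 0) :
    ∑' m : ℤ, (if m ∣ k then (1 : ℝ≥0∞) else 0) ≤ 2 * (k.natAbs.divisors.card : ℝ≥0∞) := by
  classical
  set S : Finset ℤ := k.natAbs.divisors.image (fun d : ℕ => (d : ℤ)) ∪
    k.natAbs.divisors.image (fun d : ℕ => -(d : ℤ)) with hS
  have hmem : ∀ m ∉ S, (if m ∣ k then (1 : ℝ≥0∞) else 0) = 0 := by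
    intro m hm
    rw [if_neg]
    intro hd
    apply hm
    have hd' : m.natAbs ∈ k.natAbs.divisors :=
      Nat.mem_divisors.2 ⟨Int.natAbs_dvd_natAbs.2 hd, by simpa using hk⟩
    rw [hS, Finset.mem_union, Finset.mem_image, Finset.mem_image]
    rcases Int.natAbs_eq m with h | h
    · exact Or.inl ⟨_, hd', h.symm⟩
    · exact Or.inr ⟨_, hd', h.symm⟩
  rw [tsum_eq_sum hmem]
  calc ∑ m ∈ S, (if m ∣ k then (1 : ℝ≥0∞) else 0) ≤ ∑ m ∈ S, 1 :=
        Finset.sum_le_sum fun _ _ => by split_ifs <;> simp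
    _ = (S.card : ℝ≥0∞) := by simp
    _ ≤ ((k.natAbs.divisors.card + k.natAbs.divisors.card : ℕ) : ℝ≥0∞) := by
        gcongr
        exact (Finset.card_union_le _ _).trans
          (add_le_add Finset.card_image_le Finset.card_image_le)
    _ = _ := by push_cast; ring

/-- Summation over the level sets of `(m, n) ↦ mn`. -/
lemma exists_tsum_mul_le {δ : ℝ} (hδ : 0 < δ) :
    ∃ C : ℝ≥0∞, C ≠ ∞ ∧ ∀ H : ℤ → ℝ≥0∞,
      ∑' m : ℤ, ∑' n : ℤ, (if m * n = 0 then 0 else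
        ENNReal.ofReal (|((m * n : ℤ) : ℝ)| ^ (-δ)) * H (m * n)) ≤ C * ∑' k, H k := by
  obtain ⟨C, hC, hdiv⟩ := exists_card_divisors_le hδ
  refine ⟨2 * ENNReal.ofReal C, by finiteness, fun H => ?_⟩
  -- The level k = 0 is removed, having infinitely many factorisations.
  set φ : ℤ → ℝ≥0∞ := fun k => if k = 0 then 0 else ENNReal.ofReal (|(k : ℝ)| ^ (-δ)) * H k with hφ
  have step : ∀ m : ℤ, ∑' n : ℤ, φ (m * n) ≤ ∑' k : ℤ, (if m ∣ k then (1 : ℝ≥0∞) else 0) * φ k := by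
    intro m
    by_cases hm : m = 0
    · simp [hm, hφ]
    · have inj : Function.Injective fun n : ℤ => m * n := mul_right_injective₀ hm
      refine le_trans (le_of_eq ?_) (ENNReal.tsum_comp_le_tsum_of_injective inj _)
      simp
  calc ∑' m : ℤ, ∑' n : ℤ, φ (m * n)
      ≤ ∑' m : ℤ, ∑' k : ℤ, (if m ∣ k then (1 : ℝ≥0∞) else 0) * φ k := ENNReal.tsum_le_tsum step
    _ = ∑' k : ℤ, (∑' m : ℤ, (if m ∣ k then (1 : ℝ≥0∞) else 0)) * φ k := by
        rw [ENNReal.tsum_comm]; simp_rw [ENNReal.tsum_mul_right]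
    _ ≤ ∑' k : ℤ, 2 * ENNReal.ofReal C * H k := by
        refine ENNReal.tsum_le_tsum fun k => ?_
        by_cases hk : k = 0
        · simp [hφ, hk]
        · have hk' : (0 : ℝ) < |(k : ℝ)| := by positivity
          have h1 : (k.natAbs.divisors.card : ℝ≥0∞) ≤ ENNReal.ofReal (C * |(k : ℝ)| ^ δ) := by
            have := hdiv k.natAbs (by simpa using hk)
            rw [Nat.cast_natAbs, Int.cast_abs] at this
            rw [← ENNReal.ofReal_natCast]
            exact ENNReal.ofReal_le_ofReal this
          simp only [hφ, if_neg hk]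
          calc _ ≤ (2 * ENNReal.ofReal (C * |(k : ℝ)| ^ δ)) *
                (ENNReal.ofReal (|(k : ℝ)| ^ (-δ)) * H k) := by
                gcongr
                exact (tsum_dvd_le hk).trans (by gcongr)
            _ = 2 * (ENNReal.ofReal (C * |(k : ℝ)| ^ δ) * ENNReal.ofReal (|(k : ℝ)| ^ (-δ))) * H k := by
                ring
            _ = _ := by
                rw [← ENNReal.ofReal_mul (by positivity), mul_assoc C, ← Real.rpow_add hk']
                simp
    _ = _ := by rw [ENNReal.tsum_mul_left]

/-! ### Cauchy–Schwarz and sums over frequencies -/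

lemma lintegral_mul_le_sqrt {α : Type*} [MeasurableSpace α] (μ : Measure α) {f g : α → ℝ≥0∞}
    (hf : AEMeasurable f μ) (hg : AEMeasurable g μ) :
    ∫⁻ x, f x * g x ∂μ ≤ (∫⁻ x, f x ^ 2 ∂μ) ^ (1 / 2 : ℝ) * (∫⁻ x, g x ^ 2 ∂μ) ^ (1 / 2 : ℝ) := by
  have := ENNReal.lintegral_mul_le_Lp_mul_Lq μ Real.HolderConjugate.two_two hf hg
  simpa using this

lemma tsum_mul_le_sqrt {ι : Type*} (f g : ι → ℝ≥0∞) :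
    ∑' i, f i * g i ≤ (∑' i, f i ^ 2) ^ (1 / 2 : ℝ) * (∑' i, g i ^ 2) ^ (1 / 2 : ℝ) := by
  let _ : MeasurableSpace ι := ⊤
  have := lintegral_mul_le_sqrt (Measure.count : Measure ι) (f := f) (g := g)
    measurable_from_top.aemeasurable measurable_from_top.aemeasurable
  simpa only [lintegral_count] using this

lemma sq_sqrt_ennreal (x : ℝ≥0∞) : (x ^ 2) ^ (1 / 2 : ℝ) = x := by
  rw [← ENNReal.rpow_natCast, ← ENNReal.rpow_mul]; norm_num

lemma sqrt_sq_ennreal (x : ℝ≥0∞) : (x ^ (1 / 2 : ℝ)) ^ 2 = x := by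
  rw [← ENNReal.rpow_natCast, ← ENNReal.rpow_mul]; norm_num

/-- The weighted `ℓ²` norm `(∑ (⟨ξ⟩^a c_ξ)²)^{1/2}`. -/
def hNorm (a : ℝ) (c : ℤ → ℝ≥0∞) : ℝ≥0∞ :=
  (∑' ξ : ℤ, (ENNReal.ofReal (jap ξ ^ a) * c ξ) ^ 2) ^ (1 / 2 : ℝ)

lemma hNorm_mono {a : ℝ} {c d : ℤ → ℝ≥0∞} (h : ∀ ξ, c ξ ≤ d ξ) : hNorm a c ≤ hNorm a d := by
  unfold hNorm
  gcongr with ξ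
  exact h ξ

lemma hNorm_zero_le {a : ℝ} (ha : 0 ≤ a) (c : ℤ → ℝ≥0∞) : hNorm 0 c ≤ hNorm a c := by
  unfold hNorm
  gcongr with ξ
  exact one_le_jap _

lemma hNorm_const_mul (a : ℝ) (k : ℝ≥0∞) (c : ℤ → ℝ≥0∞) :
    hNorm a (fun ξ => k * c ξ) = k * hNorm a c := by
  unfold hNorm
  have : ∀ ξ : ℤ, (ENNReal.ofReal (jap ξ ^ a) * (k * c ξ)) ^ 2
      = k ^ 2 * (ENNReal.ofReal (jap ξ ^ a) * c ξ) ^ 2 := fun ξ => by ring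
  simp_rw [this]
  rw [ENNReal.tsum_mul_left, ENNReal.mul_rpow_of_nonneg _ _ (by norm_num), sq_sqrt_ennreal]

lemma tsum_add_left (f : ℤ → ℝ≥0∞) (y : ℤ) : ∑' m, f (y + m) = ∑' m, f m :=
  (Equiv.addLeft y).tsum_eq f

/-- The corners p = y + m, q = y + m + n, r = y + n are independent integers, since y = p + r - q;
hence the sum factorises. -/
lemma tsum_parallelogram (d₁ d₂ d₃ : ℤ → ℝ≥0∞) :
    ∑' (y : ℤ) (m : ℤ) (n : ℤ), d₁ (y + m) * d₂ (y + m + n) * d₃ (y + n)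
      = (∑' ξ, d₁ ξ) * (∑' ξ, d₂ ξ) * (∑' ξ, d₃ ξ) := by
  have h1 : ∀ y : ℤ, ∑' (m : ℤ) (n : ℤ), d₁ (y + m) * d₂ (y + m + n) * d₃ (y + n)
      = ∑' (p : ℤ) (r : ℤ), d₁ p * d₂ (p + r - y) * d₃ r := by
    intro y
    rw [← tsum_add_left (fun p => ∑' r : ℤ, d₁ p * d₂ (p + r - y) * d₃ r) y]
    refine tsum_congr fun m => ?_
    rw [← tsum_add_left (fun r => d₁ (y + m) * d₂ (y + m + r - y) * d₃ r) y]
    refine tsum_congr fun n => ?_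
    congr 3; ring
  simp_rw [h1]
  rw [ENNReal.tsum_comm]
  have h2 : ∀ p : ℤ, ∑' (y : ℤ) (r : ℤ), d₁ p * d₂ (p + r - y) * d₃ r
      = d₁ p * ((∑' ξ, d₂ ξ) * (∑' ξ, d₃ ξ)) := by
    intro p
    rw [ENNReal.tsum_comm, ← ENNReal.tsum_mul_left, ← ENNReal.tsum_mul_left]
    refine tsum_congr fun r => ?_
    simp_rw [mul_assoc, ENNReal.tsum_mul_left, ENNReal.tsum_mul_right]
    rw [← (Equiv.subLeft (p + r)).tsum_eq d₂]
    simp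
  simp_rw [h2]
  rw [ENNReal.tsum_mul_right, mul_assoc]

/-- For fixed y, any two of the other three corners determine m and n, so each of the three terms
factorises with a value independent of y. -/
lemma tsum_pair_le (f g : ℤ → ℝ≥0∞) (y : ℤ) :
    ∑' (m : ℤ) (n : ℤ), (f (y + m) * g (y + n) + f (y + m) * g (y + m + n)
      + f (y + n) * g (y + m + n)) = 3 * ((∑' ξ, f ξ) * ∑' ξ, g ξ) := by
  simp_rw [ENNReal.tsum_add]
  have h1 : ∑' (m : ℤ) (n : ℤ), f (y + m) * g (y + n) = (∑' ξ, f ξ) * ∑' ξ, g ξ := by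
    simp_rw [ENNReal.tsum_mul_left, ENNReal.tsum_mul_right]
    rw [tsum_add_left, tsum_add_left]
  have h2 : ∑' (m : ℤ) (n : ℤ), f (y + m) * g (y + m + n) = (∑' ξ, f ξ) * ∑' ξ, g ξ := by
    simp_rw [ENNReal.tsum_mul_left, tsum_add_left, ENNReal.tsum_mul_right]
    rw [tsum_add_left]
  have h3 : ∑' (m : ℤ) (n : ℤ), f (y + n) * g (y + m + n) = (∑' ξ, f ξ) * ∑' ξ, g ξ := by
    rw [ENNReal.tsum_comm, ← h2]
    refine tsum_congr fun n => tsum_congr fun m => ?_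
    rw [add_right_comm]
  rw [h1, h2, h3]
  ring

lemma tsum_jap_ne_top {b : ℝ} (hb : 1 < b) :
    ∑' ξ : ℤ, ENNReal.ofReal (jap ξ ^ (-b)) ≠ ∞ := by
  have : Summable fun ξ : ℤ => jap ξ ^ (-b) := by
    refine Summable.of_norm_bounded_eventually (Real.summable_abs_int_rpow hb) ?_
    filter_upwards [(Set.finite_singleton (0 : ℤ)).compl_mem_cofinite] with ξ hξ
    have hξ' : ξ ≠ 0 := by simpa using hξ
    rw [Real.norm_of_nonneg (jap_rpow_pos _ _).le]
    exact Real.rpow_le_rpow_of_nonpos (by positivity) (abs_le_jap _) (by linarith)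
  exact this.tsum_ofReal_ne_top

lemma ofReal_rpow_neg_mul (x a : ℝ) (c : ℝ≥0∞) :
    ENNReal.ofReal (jap x ^ (-a)) * (ENNReal.ofReal (jap x ^ a) * c) = c := by
  rw [← mul_assoc, ← ENNReal.ofReal_mul (jap_rpow_pos _ _).le, ← Real.rpow_add (jap_pos x)]
  simp

/-- Cauchy–Schwarz on a sum over parallelograms. -/
lemma tsum_parallelogram_le (a : ℝ) (c₁ c₂ c₃ : ℤ → ℝ≥0∞) (W : ℤ → ℤ → ℤ → ℝ≥0∞) :
    ∑' (y : ℤ) (m : ℤ) (n : ℤ), W y m n * (c₁ (y + m) * c₂ (y + m + n) * c₃ (y + n))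
      ≤ (∑' (y : ℤ) (m : ℤ) (n : ℤ), (W y m n * ENNReal.ofReal
          (jap ((y + m : ℤ) : ℝ) ^ (-a) * jap ((y + m + n : ℤ) : ℝ) ^ (-a)
            * jap ((y + n : ℤ) : ℝ) ^ (-a))) ^ 2) ^ (1 / 2 : ℝ)
        * (hNorm a c₁ * hNorm a c₂ * hNorm a c₃) := by
  set w : ℤ → ℝ≥0∞ := fun ξ => ENNReal.ofReal (jap ξ ^ a)
  have e1 : hNorm a c₁ * hNorm a c₂ * hNorm a c₃ = (∑' (y : ℤ) (m : ℤ) (n : ℤ),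
      ((w (y + m) * c₁ (y + m)) * (w (y + m + n) * c₂ (y + m + n)) * (w (y + n) * c₃ (y + n))) ^ 2)
        ^ (1 / 2 : ℝ) := by
    have sq : ∀ x y z : ℝ≥0∞, (x * y * z) ^ 2 = x ^ 2 * y ^ 2 * z ^ 2 := fun x y z => by ring
    simp_rw [sq]
    rw [tsum_parallelogram (fun ξ => (w ξ * c₁ ξ) ^ 2) (fun ξ => (w ξ * c₂ ξ) ^ 2)
      (fun ξ => (w ξ * c₃ ξ) ^ 2), ENNReal.mul_rpow_of_nonneg _ _ (by norm_num),
      ENNReal.mul_rpow_of_nonneg _ _ (by norm_num)]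
    rfl
  have p3 : ∀ F : ℤ → ℤ → ℤ → ℝ≥0∞, ∑' (y : ℤ) (m : ℤ) (n : ℤ), F y m n
      = ∑' p : ℤ × ℤ × ℤ, F p.1 p.2.1 p.2.2 := by
    intro F
    rw [ENNReal.tsum_prod (f := fun y (q : ℤ × ℤ) => F y q.1 q.2)]
    exact tsum_congr fun y => (ENNReal.tsum_prod (f := F y)).symm
  rw [e1, p3, p3, p3]
  refine le_trans (le_of_eq (tsum_congr fun p => ?_)) (tsum_mul_le_sqrt _ _)
  obtain ⟨y, m, n⟩ := p
  simp only
  rw [ENNReal.ofReal_mul (mul_pos (jap_rpow_pos _ _) (jap_rpow_pos _ _)).le, ENNReal.ofReal_mul (jap_rpow_pos _ _).le]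
  conv_lhs => rw [← ofReal_rpow_neg_mul ((y + m : ℤ) : ℝ) a (c₁ (y + m)),
    ← ofReal_rpow_neg_mul ((y + m + n : ℤ) : ℝ) a (c₂ (y + m + n)),
    ← ofReal_rpow_neg_mul ((y + n : ℤ) : ℝ) a (c₃ (y + n))]
  ring

/-- The quadrilinear estimate at a fixed time. -/
lemma exists_fixed_time_bound {a ε s : ℝ} (hε : 0 < ε) (hs : 0 < s) (hs' : s < 1 / 2)
    (h1 : 1 + 2 * ε ≤ 4 * a) (h2 : 2 + 4 * ε ≤ 6 * a + 2 * (1 - 2 * s)) :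
    ∃ K : ℝ≥0∞, K ≠ ∞ ∧ ∀ c₁ c₂ c₃ c₄ : ℤ → ℝ≥0∞,
      ∑' (y : ℤ) (m : ℤ) (n : ℤ), ENNReal.ofReal |symb s y m n| *
        (c₁ (y + m) * c₂ (y + m + n) * c₃ (y + n) * c₄ y)
      ≤ K * (hNorm a c₁ * hNorm a c₂ * hNorm a c₃ * hNorm 0 c₄) := by
  set S : ℝ≥0∞ := ∑' ξ : ℤ, ENNReal.ofReal (jap ξ ^ (-(1 + 2 * ε))) with hS
  have hS' : S ≠ ∞ := tsum_jap_ne_top (by linarith)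
  refine ⟨(ENNReal.ofReal (180 ^ 2) * (3 * (S * S))) ^ (1 / 2 : ℝ), by finiteness, ?_⟩
  intro c₁ c₂ c₃ c₄
  have e : ∀ y m n : ℤ, ENNReal.ofReal |symb s y m n| *
        (c₁ (y + m) * c₂ (y + m + n) * c₃ (y + n) * c₄ y)
      = (ENNReal.ofReal |symb s y m n| * c₄ y) * (c₁ (y + m) * c₂ (y + m + n) * c₃ (y + n)) :=
    fun y m n => by ring
  simp_rw [e]
  refine (tsum_parallelogram_le a c₁ c₂ c₃ _).trans ?_
  -- For each y the weight is summable in (m, n) uniformly in y, by `symb_sq_le`. Thus no regularity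
  -- is required of the fourth factor here.
  have bound : ∑' (y : ℤ) (m : ℤ) (n : ℤ), (ENNReal.ofReal |symb s y m n| * c₄ y * ENNReal.ofReal
          (jap ((y + m : ℤ) : ℝ) ^ (-a) * jap ((y + m + n : ℤ) : ℝ) ^ (-a)
            * jap ((y + n : ℤ) : ℝ) ^ (-a))) ^ 2
      ≤ (ENNReal.ofReal (180 ^ 2) * (3 * (S * S))) * ∑' y : ℤ, c₄ y ^ 2 := by
    rw [← ENNReal.tsum_mul_left]
    refine ENNReal.tsum_le_tsum fun y => ?_
    set f : ℤ → ℝ≥0∞ := fun ξ => ENNReal.ofReal (jap ξ ^ (-(1 + 2 * ε))) with hf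
    have pt : ∀ m n : ℤ, (ENNReal.ofReal |symb s y m n| * c₄ y * ENNReal.ofReal
          (jap ((y + m : ℤ) : ℝ) ^ (-a) * jap ((y + m + n : ℤ) : ℝ) ^ (-a)
            * jap ((y + n : ℤ) : ℝ) ^ (-a))) ^ 2
        ≤ ENNReal.ofReal (180 ^ 2) * (f (y + m) * f (y + n) + f (y + m) * f (y + m + n)
          + f (y + n) * f (y + m + n)) * c₄ y ^ 2 := by
      intro m n
      have := symb_sq_le hε hs hs' h1 h2 (y : ℝ) m n
      have hA := jap_pos ((y : ℝ) + m)
      have hB := jap_pos ((y : ℝ) + n)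
      have hD := jap_pos ((y : ℝ) + m + n)
      rw [show ENNReal.ofReal |symb s y m n| * c₄ y * ENNReal.ofReal
          (jap ((y + m : ℤ) : ℝ) ^ (-a) * jap ((y + m + n : ℤ) : ℝ) ^ (-a)
            * jap ((y + n : ℤ) : ℝ) ^ (-a)) = ENNReal.ofReal |symb s y m n| * ENNReal.ofReal
          (jap ((y + m : ℤ) : ℝ) ^ (-a) * jap ((y + m + n : ℤ) : ℝ) ^ (-a)
            * jap ((y + n : ℤ) : ℝ) ^ (-a)) * c₄ y by ring, mul_pow]
      gcongr
      simp only [hf]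
      push_cast
      rw [← ENNReal.ofReal_mul (abs_nonneg _), ← ENNReal.ofReal_pow (by positivity)]
      simp only [← ENNReal.ofReal_mul (jap_rpow_pos _ _).le]
      rw [← ENNReal.ofReal_add (by positivity) (by positivity),
        ← ENNReal.ofReal_add (by positivity) (by positivity), ← ENNReal.ofReal_mul (by norm_num)]
      apply ENNReal.ofReal_le_ofReal
      set A := jap ((y : ℝ) + m)
      set B := jap ((y : ℝ) + n)
      set D := jap ((y : ℝ) + m + n)
      have sq : ∀ {X : ℝ}, 0 < X → (X ^ (-a)) ^ 2 * X ^ (2 * a) = 1 := by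
        intro X hX
        rw [← Real.rpow_natCast, ← Real.rpow_mul hX.le, ← Real.rpow_add hX]
        push_cast; ring_nf; simp
      rw [mul_pow, sq_abs]
      rw [show -1 - 2 * ε = -(1 + 2 * ε) by ring] at this
      set R := A ^ (-(1 + 2 * ε)) * B ^ (-(1 + 2 * ε)) + A ^ (-(1 + 2 * ε)) * D ^ (-(1 + 2 * ε))
        + B ^ (-(1 + 2 * ε)) * D ^ (-(1 + 2 * ε))
      calc symb s y m n ^ 2 * (A ^ (-a) * D ^ (-a) * B ^ (-a)) ^ 2
          ≤ (180 ^ 2 * (A ^ (2 * a) * B ^ (2 * a) * D ^ (2 * a)) * R)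
            * (A ^ (-a) * D ^ (-a) * B ^ (-a)) ^ 2 := by gcongr
        _ = 180 ^ 2 * R * ((A ^ (-a)) ^ 2 * A ^ (2 * a)) * ((B ^ (-a)) ^ 2 * B ^ (2 * a))
            * ((D ^ (-a)) ^ 2 * D ^ (2 * a)) := by ring
        _ = 180 ^ 2 * R := by rw [sq hA, sq hB, sq hD]; ring
    calc _ ≤ ∑' (m : ℤ) (n : ℤ), ENNReal.ofReal (180 ^ 2) * (f (y + m) * f (y + n)
          + f (y + m) * f (y + m + n) + f (y + n) * f (y + m + n)) * c₄ y ^ 2 :=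
          ENNReal.tsum_le_tsum fun m => ENNReal.tsum_le_tsum fun n => pt m n
      _ = _ := by
          simp_rw [ENNReal.tsum_mul_right, ENNReal.tsum_mul_left]
          rw [tsum_pair_le]
  calc _ ≤ ((ENNReal.ofReal (180 ^ 2) * (3 * (S * S))) * ∑' y : ℤ, c₄ y ^ 2) ^ (1 / 2 : ℝ)
        * (hNorm a c₁ * hNorm a c₂ * hNorm a c₃) := by gcongr
    _ = _ := by
        rw [ENNReal.mul_rpow_of_nonneg _ _ (by norm_num)]
        have : hNorm 0 c₄ = (∑' y : ℤ, c₄ y ^ 2) ^ (1 / 2 : ℝ) := by simp [hNorm]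
        rw [this]
        ring

/-- The resonant part: a loss of `|mn|^{1/2 + ε/2}`, compensated by counting divisors. -/
lemma exists_resonant_bound {a ε s : ℝ} (hε : 0 < ε) (hε' : ε ≤ 1 / 2) (hs : 0 < s)
    (hs' : s < 1 / 2) (ha : a ≤ 1 / 2) (ha0 : 0 < a)
    (h1 : 1 + 2 * ε ≤ 4 * a) (h2 : 2 + 4 * ε ≤ 6 * a + 2 * (1 - 2 * s)) :
    ∃ K : ℝ≥0∞, K ≠ ∞ ∧ ∀ (c₁ c₂ c₃ w : ℤ → ℝ≥0∞) (H : ℤ → ℤ → ℝ≥0∞),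
      (∀ y, ∑' k, H y k ^ 2 ≤ w y ^ 2) →
      ∑' (y : ℤ) (m : ℤ) (n : ℤ),
        ENNReal.ofReal (|symb s y m n| * |((m * n : ℤ) : ℝ)| ^ (1 / 2 + ε / 2)) *
        (c₁ (y + m) * c₂ (y + m + n) * c₃ (y + n) * H y (m * n))
      ≤ K * (hNorm a c₁ * hNorm a c₂ * hNorm a c₃ * hNorm a w) := by
  obtain ⟨C, hC, hcount⟩ := exists_tsum_mul_le hε
  refine ⟨(ENNReal.ofReal (36864 * 60 ^ 2) * C) ^ (1 / 2 : ℝ), by finiteness, ?_⟩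
  intro c₁ c₂ c₃ w H hH
  have e : ∀ y m n : ℤ,
      ENNReal.ofReal (|symb s y m n| * |((m * n : ℤ) : ℝ)| ^ (1 / 2 + ε / 2)) *
        (c₁ (y + m) * c₂ (y + m + n) * c₃ (y + n) * H y (m * n))
      = (ENNReal.ofReal (|symb s y m n| * |((m * n : ℤ) : ℝ)| ^ (1 / 2 + ε / 2)) * H y (m * n))
        * (c₁ (y + m) * c₂ (y + m + n) * c₃ (y + n)) :=
    fun y m n => by ring
  simp_rw [e]
  refine (tsum_parallelogram_le a c₁ c₂ c₃ _).trans ?_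
  have bound : ∑' (y : ℤ) (m : ℤ) (n : ℤ),
      (ENNReal.ofReal (|symb s y m n| * |((m * n : ℤ) : ℝ)| ^ (1 / 2 + ε / 2)) * H y (m * n)
        * ENNReal.ofReal (jap ((y + m : ℤ) : ℝ) ^ (-a) * jap ((y + m + n : ℤ) : ℝ) ^ (-a)
            * jap ((y + n : ℤ) : ℝ) ^ (-a))) ^ 2
      ≤ (ENNReal.ofReal (36864 * 60 ^ 2) * C)
        * ∑' y : ℤ, (ENNReal.ofReal (jap y ^ a) * w y) ^ 2 := by
    rw [← ENNReal.tsum_mul_left]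
    refine ENNReal.tsum_le_tsum fun y => ?_
    have pt : ∀ m n : ℤ,
      (ENNReal.ofReal (|symb s y m n| * |((m * n : ℤ) : ℝ)| ^ (1 / 2 + ε / 2)) * H y (m * n)
        * ENNReal.ofReal (jap ((y + m : ℤ) : ℝ) ^ (-a) * jap ((y + m + n : ℤ) : ℝ) ^ (-a)
            * jap ((y + n : ℤ) : ℝ) ^ (-a))) ^ 2
        ≤ (ENNReal.ofReal (36864 * 60 ^ 2) * ENNReal.ofReal (jap y ^ a) ^ 2) *
          (if m * n = 0 then 0 else
            ENNReal.ofReal (|((m * n : ℤ) : ℝ)| ^ (-ε)) * (H y (m * n)) ^ 2) := by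
      intro m n
      by_cases hmn : m * n = 0
      · rw [symb_zero (by exact_mod_cast hmn)]; simp
      rw [if_neg hmn]
      have hb := weight_bound hε hε' hs hs' ha ha0 h1 h2 (y : ℝ) m n
      have hA := jap_pos ((y : ℝ) + m)
      have hB := jap_pos ((y : ℝ) + n)
      have hD := jap_pos ((y : ℝ) + m + n)
      have hc := jap_pos (y : ℝ)
      have hL : (0 : ℝ) < |(m : ℝ) * n| := by
        have : ((m * n : ℤ) : ℝ) ≠ 0 := by exact_mod_cast hmn
        push_cast at this
        positivity
      have sq3 : ∀ x y z : ℝ≥0∞, (x * y * z) ^ 2 = (x * z) ^ 2 * y ^ 2 := fun x y z => by ring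
      rw [sq3, ← mul_assoc]
      gcongr
      push_cast
      rw [← ENNReal.ofReal_mul (by positivity), ← ENNReal.ofReal_pow (by positivity),
        ← ENNReal.ofReal_pow (by positivity), ← ENNReal.ofReal_mul (by positivity),
        ← ENNReal.ofReal_mul (by positivity)]
      apply ENNReal.ofReal_le_ofReal
      set A := jap ((y : ℝ) + m)
      set B := jap ((y : ℝ) + n)
      set D := jap ((y : ℝ) + m + n)
      set L := |(m : ℝ) * n|
      have sq : ∀ {X : ℝ}, 0 < X → (X ^ (-a)) ^ 2 * X ^ (2 * a) = 1 := by
        intro X hX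
        rw [← Real.rpow_natCast, ← Real.rpow_mul hX.le, ← Real.rpow_add hX]
        push_cast; ring_nf; simp
      have sq' : jap (y : ℝ) ^ (2 * a) = (jap y ^ a) ^ 2 := by
        rw [← Real.rpow_natCast, ← Real.rpow_mul hc.le]; push_cast; ring_nf
      -- The exponent is split as 1 + ε = (1 + 2ε) - ε: the first part is absorbed by
      -- `weight_bound`, and L^{-ε} pays for the divisor count.
      have hLe : (L ^ (1 / 2 + ε / 2)) ^ 2 = L ^ (1 + 2 * ε) * L ^ (-ε) := by
        rw [← Real.rpow_natCast, ← Real.rpow_mul hL.le, ← Real.rpow_add hL]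
        push_cast; ring_nf
      calc (|symb s y m n| * L ^ (1 / 2 + ε / 2) * (A ^ (-a) * D ^ (-a) * B ^ (-a))) ^ 2
          = (symb s y m n ^ 2 * L ^ (1 + 2 * ε)) * (L ^ (-ε) * (A ^ (-a) * D ^ (-a) * B ^ (-a)) ^ 2) := by
            rw [mul_pow, mul_pow, sq_abs, hLe]; ring
        _ ≤ (36864 * 60 ^ 2 * (jap y ^ (2 * a) * A ^ (2 * a) * B ^ (2 * a) * D ^ (2 * a)))
            * (L ^ (-ε) * (A ^ (-a) * D ^ (-a) * B ^ (-a)) ^ 2) := by gcongr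
        _ = 36864 * 60 ^ 2 * jap y ^ (2 * a) * L ^ (-ε) * ((A ^ (-a)) ^ 2 * A ^ (2 * a))
            * ((B ^ (-a)) ^ 2 * B ^ (2 * a)) * ((D ^ (-a)) ^ 2 * D ^ (2 * a)) := by ring
        _ = 36864 * 60 ^ 2 * (jap y ^ a) ^ 2 * L ^ (-ε) := by rw [sq hA, sq hB, sq hD, sq']; ring
    calc _ ≤ ∑' (m : ℤ) (n : ℤ), (ENNReal.ofReal (36864 * 60 ^ 2) * ENNReal.ofReal (jap y ^ a) ^ 2) *
          (if m * n = 0 then 0 else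
            ENNReal.ofReal (|((m * n : ℤ) : ℝ)| ^ (-ε)) * (H y (m * n)) ^ 2) :=
          ENNReal.tsum_le_tsum fun m => ENNReal.tsum_le_tsum fun n => pt m n
      _ ≤ (ENNReal.ofReal (36864 * 60 ^ 2) * ENNReal.ofReal (jap y ^ a) ^ 2) * (C * w y ^ 2) := by
          simp_rw [ENNReal.tsum_mul_left]
          gcongr
          exact (hcount fun k => H y k ^ 2).trans (by gcongr; exact hH y)
      _ = _ := by ring
  calc _ ≤ ((ENNReal.ofReal (36864 * 60 ^ 2) * C)
        * ∑' y : ℤ, (ENNReal.ofReal (jap y ^ a) * w y) ^ 2) ^ (1 / 2 : ℝ)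
        * (hNorm a c₁ * hNorm a c₂ * hNorm a c₃) := by gcongr
    _ = _ := by
        rw [ENNReal.mul_rpow_of_nonneg _ _ (by norm_num)]
        unfold hNorm
        ring

/-! ### The multilinear estimate for nonnegative functions -/

lemma lintegral_eq_lintegral_tsum {f : ℝ → ℝ≥0∞} (hf : Measurable f) :
    ∫⁻ c, f c = ∫⁻ c in Set.Ioc (0 : ℝ) 2, ∑' k : ℤ, f (2 * k + c) := by
  have h1 : ∫⁻ c, f c = ∑' k : ℤ, ∫⁻ c in Set.Ioc (0 + k • (2 : ℝ)) (0 + (k + 1) • (2 : ℝ)), f c := by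
    rw [← lintegral_iUnion (fun _ => measurableSet_Ioc) (Set.pairwise_disjoint_Ioc_add_zsmul (0 : ℝ) 2),
      iUnion_Ioc_add_zsmul (by norm_num : (0 : ℝ) < 2), Measure.restrict_univ]
  rw [h1, lintegral_tsum fun k => by fun_prop]
  refine tsum_congr fun k => ?_
  rw [← lintegral_indicator measurableSet_Ioc, ← lintegral_indicator measurableSet_Ioc,
    ← lintegral_add_left_eq_self _ (2 * (k : ℝ))]
  congr 1 with c
  simp only [Set.indicator, Set.mem_Ioc, zsmul_eq_mul]
  push_cast
  congr 1
  apply propext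
  constructor <;> rintro ⟨h1, h2⟩ <;> constructor <;> linarith

/-- The line is folded along 2ℤ and the sampling bound is integrated over one period, whose length 2
is the constant. -/
lemma lintegral_sq_le_of_sampling {G : ℝ → ℝ≥0∞} (hG : Measurable G) {w : ℝ≥0∞}
    (h : ∀ c, ∑' k : ℤ, G (2 * k + c) ^ 2 ≤ w ^ 2) : ∫⁻ c, G c ^ 2 ≤ 2 * w ^ 2 := by
  rw [lintegral_eq_lintegral_tsum (hG.pow_const 2)]
  calc _ ≤ ∫⁻ _ in Set.Ioc (0 : ℝ) 2, w ^ 2 := lintegral_mono fun c => h c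
    _ = _ := by simp [mul_comm]

lemma lintegral_jap_ne_top {b : ℝ} (hb : 1 < b) :
    ∫⁻ x : ℝ, ENNReal.ofReal (jap x ^ (-b)) ≠ ∞ := by
  have : Integrable fun x : ℝ => (1 + ‖x‖ ^ 2) ^ (-b / 2) :=
    integrable_rpow_neg_one_add_norm_sq (by simpa using hb)
  have e : (fun x : ℝ => (1 + ‖x‖ ^ 2) ^ (-b / 2)) = fun x => jap x ^ (-b) := by
    ext x
    rw [show -b = 2 * (-b / 2) by ring, jap_rpow_two_mul, Real.norm_eq_abs, sq_abs]
    ring_nf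
  rw [e] at this
  exact this.lintegral_lt_top.ne

section Convolution

variable {Q₁ Q₂ Q₃ G : ℝ → ℝ≥0∞}

lemma lintegral_triple (h₁ : Measurable Q₁) (h₂ : Measurable Q₂) (h₃ : Measurable Q₃) :
    ∫⁻ p : ℝ × ℝ × ℝ, Q₁ p.1 * Q₂ p.2.1 * Q₃ p.2.2
      = (∫⁻ x, Q₁ x) * (∫⁻ x, Q₂ x) * ∫⁻ x, Q₃ x := by
  have := lintegral_prod_mul (μ := (volume : Measure ℝ)) (ν := (volume : Measure (ℝ × ℝ)))
    (f := Q₁) (g := fun q => Q₂ q.1 * Q₃ q.2) h₁.aemeasurable (by fun_prop)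
  rw [← Measure.volume_eq_prod] at this
  have h2 := lintegral_prod_mul (μ := (volume : Measure ℝ)) (ν := (volume : Measure ℝ))
    (f := Q₂) (g := Q₃) h₂.aemeasurable h₃.aemeasurable
  rw [← Measure.volume_eq_prod] at h2
  rw [mul_assoc, ← h2, ← this]
  simp_rw [mul_assoc]

lemma lintegral_mul_shift_le (h₁ : Measurable Q₁) (hG : Measurable G) (c : ℝ) :
    ∫⁻ x, Q₁ x * G (c + x) ≤
      (∫⁻ x, Q₁ x ^ 2) ^ (1 / 2 : ℝ) * (∫⁻ x, G x ^ 2) ^ (1 / 2 : ℝ) := by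
  refine (lintegral_mul_le_sqrt volume h₁.aemeasurable (by fun_prop)).trans (le_of_eq ?_)
  rw [lintegral_add_left_eq_self (fun x => G x ^ 2) c]

lemma lintegral_mul_reflect_le (h₁ : Measurable Q₁) (hG : Measurable G) (c : ℝ) :
    ∫⁻ x, Q₁ x * G (c - x) ≤
      (∫⁻ x, Q₁ x ^ 2) ^ (1 / 2 : ℝ) * (∫⁻ x, G x ^ 2) ^ (1 / 2 : ℝ) := by
  refine (lintegral_mul_le_sqrt volume h₁.aemeasurable (by fun_prop)).trans (le_of_eq ?_)
  rw [lintegral_sub_left_eq_self (fun x => G x ^ 2) c]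

/-- A form of Young's inequality: Cauchy–Schwarz in the variable of the factor placed in L², using
translation invariance for `G`, then the L¹ norms of the other two. The next two lemmas place a
different factor in L². -/
lemma lintegral_triple_le_first (h₁ : Measurable Q₁) (h₂ : Measurable Q₂) (h₃ : Measurable Q₃)
    (hG : Measurable G) (Ω : ℝ) :
    ∫⁻ p : ℝ × ℝ × ℝ, Q₁ p.1 * Q₂ p.2.1 * Q₃ p.2.2 * G (p.1 - p.2.1 + p.2.2 + Ω)
      ≤ (∫⁻ x, Q₁ x ^ 2) ^ (1 / 2 : ℝ) * (∫⁻ x, Q₂ x) * (∫⁻ x, Q₃ x)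
        * (∫⁻ x, G x ^ 2) ^ (1 / 2 : ℝ) := by
  rw [Measure.volume_eq_prod, lintegral_prod_symm _ (by fun_prop)]
  calc _ = ∫⁻ q : ℝ × ℝ, Q₂ q.1 * Q₃ q.2 * ∫⁻ x, Q₁ x * G (-q.1 + q.2 + Ω + x) := by
        refine lintegral_congr fun q => ?_
        rw [← lintegral_const_mul _ (by fun_prop)]
        refine lintegral_congr fun x => ?_
        rw [show x - q.1 + q.2 + Ω = -q.1 + q.2 + Ω + x by ring]; ring
    _ ≤ ∫⁻ q : ℝ × ℝ, Q₂ q.1 * Q₃ q.2 *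
        ((∫⁻ x, Q₁ x ^ 2) ^ (1 / 2 : ℝ) * (∫⁻ x, G x ^ 2) ^ (1 / 2 : ℝ)) :=
        lintegral_mono fun q => by gcongr; exact lintegral_mul_shift_le h₁ hG _
    _ = _ := by
        rw [lintegral_mul_const _ (by fun_prop), Measure.volume_eq_prod,
          lintegral_prod_mul h₂.aemeasurable h₃.aemeasurable]
        ring

lemma lintegral_triple_le_second (h₁ : Measurable Q₁) (h₂ : Measurable Q₂) (h₃ : Measurable Q₃)
    (hG : Measurable G) (Ω : ℝ) :
    ∫⁻ p : ℝ × ℝ × ℝ, Q₁ p.1 * Q₂ p.2.1 * Q₃ p.2.2 * G (p.1 - p.2.1 + p.2.2 + Ω)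
      ≤ (∫⁻ x, Q₁ x) * (∫⁻ x, Q₂ x ^ 2) ^ (1 / 2 : ℝ) * (∫⁻ x, Q₃ x)
        * (∫⁻ x, G x ^ 2) ^ (1 / 2 : ℝ) := by
  rw [Measure.volume_eq_prod, lintegral_prod _ (by fun_prop)]
  calc _ = ∫⁻ x : ℝ, ∫⁻ v : ℝ, Q₁ x * (Q₃ v * ∫⁻ u, Q₂ u * G (x + v + Ω - u)) := by
        refine lintegral_congr fun x => ?_
        rw [Measure.volume_eq_prod, lintegral_prod_symm _ (by fun_prop)]
        refine lintegral_congr fun v => ?_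
        rw [← mul_assoc, ← lintegral_const_mul _ (by fun_prop)]
        refine lintegral_congr fun u => ?_
        simp only
        rw [show x - u + v + Ω = x + v + Ω - u by ring]; ring
    _ ≤ ∫⁻ x : ℝ, ∫⁻ v : ℝ, Q₁ x * (Q₃ v *
        ((∫⁻ x, Q₂ x ^ 2) ^ (1 / 2 : ℝ) * (∫⁻ x, G x ^ 2) ^ (1 / 2 : ℝ))) :=
        lintegral_mono fun q => lintegral_mono fun v => by
          gcongr; exact lintegral_mul_reflect_le h₂ hG _
    _ = _ := by
        simp_rw [lintegral_const_mul _ (h₃.mul_const _)]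
        rw [lintegral_mul_const _ h₁, lintegral_mul_const _ h₃]
        ring

lemma lintegral_triple_le_third (h₁ : Measurable Q₁) (h₂ : Measurable Q₂) (h₃ : Measurable Q₃)
    (hG : Measurable G) (Ω : ℝ) :
    ∫⁻ p : ℝ × ℝ × ℝ, Q₁ p.1 * Q₂ p.2.1 * Q₃ p.2.2 * G (p.1 - p.2.1 + p.2.2 + Ω)
      ≤ (∫⁻ x, Q₁ x) * (∫⁻ x, Q₂ x) * (∫⁻ x, Q₃ x ^ 2) ^ (1 / 2 : ℝ)
        * (∫⁻ x, G x ^ 2) ^ (1 / 2 : ℝ) := by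
  rw [Measure.volume_eq_prod, lintegral_prod _ (by fun_prop)]
  calc _ = ∫⁻ x : ℝ, ∫⁻ u : ℝ, Q₁ x * (Q₂ u * ∫⁻ v, Q₃ v * G (x - u + Ω + v)) := by
        refine lintegral_congr fun x => ?_
        rw [Measure.volume_eq_prod, lintegral_prod _ (by fun_prop)]
        refine lintegral_congr fun u => ?_
        rw [← mul_assoc, ← lintegral_const_mul _ (by fun_prop)]
        refine lintegral_congr fun v => ?_
        simp only
        rw [show x - u + v + Ω = x - u + Ω + v by ring]; ring
    _ ≤ ∫⁻ x : ℝ, ∫⁻ v : ℝ, Q₁ x * (Q₂ v *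
        ((∫⁻ x, Q₃ x ^ 2) ^ (1 / 2 : ℝ) * (∫⁻ x, G x ^ 2) ^ (1 / 2 : ℝ))) :=
        lintegral_mono fun q => lintegral_mono fun v => by
          gcongr; exact lintegral_mul_shift_le h₃ hG _
    _ = _ := by
        simp_rw [lintegral_const_mul _ (h₂.mul_const _)]
        rw [lintegral_mul_const _ h₁, lintegral_mul_const _ h₂]
        ring

end Convolution

/-- Distribution of the modulation of the fourth factor over the other three and the resonance. -/
lemma jap_rpow_half_le {ε : ℝ} (hε : 0 < ε) (x y z : ℝ) {k : ℤ} (hk : k ≠ 0) :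
    jap (x - y + z + 2 * k) ^ (1 / 2 : ℝ) ≤ 3 * (jap x ^ (1 / 2 : ℝ) + jap y ^ (1 / 2 : ℝ)
      + jap z ^ (1 / 2 : ℝ) + |(k : ℝ)| ^ (1 / 2 + ε / 2) *
        (jap x ^ (-(ε / 6)) * jap y ^ (-(ε / 6)) * jap z ^ (-(ε / 6)))) := by
  have hL : (1 : ℝ) ≤ |(k : ℝ)| := by exact_mod_cast Int.one_le_abs hk
  have h0 : jap (x - y + z + 2 * k) ≤ jap x + jap y + jap z + 2 * |(k : ℝ)| := by
    have e1 := jap_add_le (x - y + z) (2 * k)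
    have e2 := jap_add_le_add (x - y) z
    have e3 := jap_add_le_add x (-y)
    rw [jap_neg, ← sub_eq_add_neg] at e3
    rw [abs_mul, abs_two] at e1
    linarith
  have px := one_le_jap x
  have py := one_le_jap y
  have pz := one_le_jap z
  have qx := jap_rpow_pos x (1 / 2)
  have qy := jap_rpow_pos y (1 / 2)
  have qz := jap_rpow_pos z (1 / 2)
  have rx := jap_rpow_pos x (-(ε / 6))
  have ry := jap_rpow_pos y (-(ε / 6))
  have rz := jap_rpow_pos z (-(ε / 6))
  have pc := jap_pos (x - y + z + 2 * k)
  set X := jap x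
  set Y := jap y
  set Z := jap z
  set L := |(k : ℝ)|
  have hLp : 0 < L ^ (1 / 2 + ε / 2) := Real.rpow_pos_of_pos (by linarith) _
  have rest : 0 < L ^ (1 / 2 + ε / 2) * (X ^ (-(ε / 6)) * Y ^ (-(ε / 6)) * Z ^ (-(ε / 6))) := by
    positivity
  -- By `h0` the bracket is at most 5W; it is enlarged to 9W to have an exact square root.
  have big : ∀ W : ℝ, 1 ≤ W → X ≤ W → Y ≤ W → Z ≤ W → L ≤ W →
      jap (x - y + z + 2 * k) ^ (1 / 2 : ℝ) ≤ 3 * W ^ (1 / 2 : ℝ) := by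
    intro W hW hX hY hZ hL
    calc jap (x - y + z + 2 * k) ^ (1 / 2 : ℝ) ≤ (9 * W) ^ (1 / 2 : ℝ) :=
          Real.rpow_le_rpow pc.le (by linarith) (by norm_num)
      _ = 3 * W ^ (1 / 2 : ℝ) := by
          rw [Real.mul_rpow (by norm_num) (by linarith), ← Real.sqrt_eq_rpow 9,
            show (9 : ℝ) = 3 ^ 2 by norm_num, Real.sqrt_sq (by norm_num)]
  by_cases hX : L ≤ X ∧ Y ≤ X ∧ Z ≤ X
  · linarith [big X px le_rfl hX.2.1 hX.2.2 hX.1]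
  by_cases hY : L ≤ Y ∧ X ≤ Y ∧ Z ≤ Y
  · linarith [big Y py hY.2.1 le_rfl hY.2.2 hY.1]
  by_cases hZ : L ≤ Z ∧ X ≤ Z ∧ Y ≤ Z
  · linarith [big Z pz hZ.2.1 hZ.2.2 le_rfl hZ.1]
  have hmax : X ≤ L ∧ Y ≤ L ∧ Z ≤ L := by
    by_contra hcon
    rcases le_total X Y with h1 | h1 <;> rcases le_total Y Z with h2 | h2 <;>
      rcases le_total X Z with h3 | h3 <;> grind
  obtain ⟨h1, h2, h3⟩ := hmax
  have hpow : ∀ {W : ℝ}, 1 ≤ W → W ≤ L → L ^ (-(ε / 6)) ≤ W ^ (-(ε / 6)) := fun hW hWL =>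
    Real.rpow_le_rpow_of_nonpos (by linarith) hWL (by linarith)
  -- When the resonance dominates, the surplus L^{ε/2} is exactly what three factors ⟨·⟩^{-ε/6} can
  -- cost, each bracket being at most L.
  have hLL : L ^ (1 / 2 : ℝ) ≤
      L ^ (1 / 2 + ε / 2) * (X ^ (-(ε / 6)) * Y ^ (-(ε / 6)) * Z ^ (-(ε / 6))) := by
    calc L ^ (1 / 2 : ℝ) = L ^ (1 / 2 + ε / 2) * (L ^ (-(ε / 6)) * L ^ (-(ε / 6)) * L ^ (-(ε / 6))) := by
          rw [← Real.rpow_add (by linarith), ← Real.rpow_add (by linarith),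
            ← Real.rpow_add (by linarith)]
          ring_nf
      _ ≤ _ := by
          have := Real.rpow_pos_of_pos (by linarith : 0 < L) (-(ε / 6))
          have hX := hpow px h1
          have hY := hpow py h2
          have hZ := hpow pz h3
          gcongr ?_ * (?_ * ?_ * ?_)
  linarith [big L hL h1 h2 h3 le_rfl]

/-- The `Y`-norm, for nonnegative functions of frequency and modulation. -/
def modNorm (a : ℝ) (P : ℤ → ℝ → ℝ≥0∞) : ℝ≥0∞ :=
  hNorm a (fun ξ => (∫⁻ σ, (ENNReal.ofReal (jap σ ^ (1 / 2 : ℝ)) * P ξ σ) ^ 2) ^ (1 / 2 : ℝ))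
    + hNorm a (fun ξ => ∫⁻ σ, P ξ σ)

lemma measurable_hNorm {a : ℝ} {P : ℤ → ℝ → ℝ≥0∞} (hP : ∀ ξ, Measurable (P ξ)) :
    Measurable fun σ => hNorm a (fun ξ => P ξ σ) := by
  unfold hNorm
  exact (Measurable.tsum fun ξ => ((hP ξ).const_mul _).pow_const 2).pow_const _

/-- The endpoint `b = 1/2` barely fails to control `L¹_σ ℓ²_ξ`. -/
lemma exists_lintegral_hNorm_le {δ : ℝ} (hδ : 0 < δ) (a : ℝ) :
    ∃ K : ℝ≥0∞, K ≠ ∞ ∧ ∀ P : ℤ → ℝ → ℝ≥0∞, (∀ ξ, Measurable (P ξ)) →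
      ∫⁻ σ, hNorm a (fun ξ => ENNReal.ofReal (jap σ ^ (-δ)) * P ξ σ) ≤ K * hNorm a
        (fun ξ => (∫⁻ σ, (ENNReal.ofReal (jap σ ^ (1 / 2 : ℝ)) * P ξ σ) ^ 2) ^ (1 / 2 : ℝ)) := by
  refine ⟨(∫⁻ σ : ℝ, ENNReal.ofReal (jap σ ^ (-(1 + 2 * δ)))) ^ (1 / 2 : ℝ), ?_, fun P hP => ?_⟩
  · exact ENNReal.rpow_ne_top_of_nonneg (by norm_num) (lintegral_jap_ne_top (by linarith))
  have mj : ∀ b : ℝ, Measurable fun σ => ENNReal.ofReal (jap σ ^ b) := fun b =>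
    (continuous_jap_rpow b).measurable.ennreal_ofReal
  -- Writing -δ = -(1/2 + δ) + 1/2 prepares Cauchy–Schwarz in σ: the weight ⟨σ⟩^{-(1+2δ)} is
  -- integrable, and the other factor becomes the b = 1/2 norm.
  have e1 : ∀ σ, hNorm a (fun ξ => ENNReal.ofReal (jap σ ^ (-δ)) * P ξ σ)
      = ENNReal.ofReal (jap σ ^ (-(1 / 2 + δ))) *
        hNorm a (fun ξ => ENNReal.ofReal (jap σ ^ (1 / 2 : ℝ)) * P ξ σ) := by
    intro σ
    rw [hNorm_const_mul, hNorm_const_mul, ← mul_assoc, ← ENNReal.ofReal_mul (jap_rpow_pos _ _).le,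
      ← Real.rpow_add (jap_pos σ)]
    ring_nf
  simp_rw [e1]
  refine (lintegral_mul_le_sqrt volume (mj _).aemeasurable
    (measurable_hNorm fun ξ => (mj _).mul (hP ξ)).aemeasurable).trans (le_of_eq ?_)
  congr 1
  · congr 1
    refine lintegral_congr fun σ => ?_
    rw [← ENNReal.ofReal_pow (jap_rpow_pos _ _).le, ← Real.rpow_natCast,
      ← Real.rpow_mul (jap_pos σ).le]
    push_cast; ring_nf
  · unfold hNorm
    congr 1
    simp_rw [sqrt_sq_ennreal]
    rw [lintegral_tsum fun ξ => (((((mj _).mul (hP ξ))).const_mul _).pow_const 2).aemeasurable]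
    refine tsum_congr fun ξ => ?_
    simp_rw [mul_pow (ENNReal.ofReal (jap ξ ^ a))]
    rw [lintegral_const_mul _ (((mj _).mul (hP ξ)).pow_const 2), sqrt_sq_ennreal]
    rfl

/-- The `L²` norm with the modulation weight `⟨σ⟩^{1/2}`. -/
def modL2 (Q : ℝ → ℝ≥0∞) : ℝ≥0∞ :=
  (∫⁻ σ, (ENNReal.ofReal (jap σ ^ (1 / 2 : ℝ)) * Q σ) ^ 2) ^ (1 / 2 : ℝ)

lemma measurable_ofReal_jap_rpow (b : ℝ) : Measurable fun σ => ENNReal.ofReal (jap σ ^ b) :=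
  (continuous_jap_rpow b).measurable.ennreal_ofReal

/-- The contribution of one parallelogram, with k = mn. The weight of the fourth factor is split by
`jap_rpow_half_le`; when another modulation dominates, Young's inequality finishes. The resonant
term is left as an integral, because its samples of `g` have to be summed over frequencies before
integrating. The constant is 6 = 3 · 2: 3 from the splitting, 2 from bounding the L² norm of `g` by
2w. -/
lemma lintegral_modulation_le {ε : ℝ} (hε : 0 < ε) {Q₁ Q₂ Q₃ g : ℝ → ℝ≥0∞} (h₁ : Measurable Q₁)
    (h₂ : Measurable Q₂) (h₃ : Measurable Q₃) (hg : Measurable g) (b : ℝ≥0∞) {w : ℝ≥0∞}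
    (hw : ∫⁻ c, g c ^ 2 ≤ 2 * w ^ 2) {k : ℤ} (hk : k ≠ 0) :
    ∫⁻ p : ℝ × ℝ × ℝ, Q₁ p.1 * Q₂ p.2.1 * Q₃ p.2.2 *
        (ENNReal.ofReal (jap (p.1 - p.2.1 + p.2.2 + 2 * k) ^ (1 / 2 : ℝ))
          * g (p.1 - p.2.1 + p.2.2 + 2 * k) + b)
      ≤ (∫⁻ x, Q₁ x) * (∫⁻ x, Q₂ x) * (∫⁻ x, Q₃ x) * b
        + 6 * (modL2 Q₁ * (∫⁻ x, Q₂ x) * (∫⁻ x, Q₃ x) * w)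
        + 6 * ((∫⁻ x, Q₁ x) * modL2 Q₂ * (∫⁻ x, Q₃ x) * w)
        + 6 * ((∫⁻ x, Q₁ x) * (∫⁻ x, Q₂ x) * modL2 Q₃ * w)
        + 3 * ∫⁻ p : ℝ × ℝ × ℝ, ENNReal.ofReal (|(k : ℝ)| ^ (1 / 2 + ε / 2)) *
          ((ENNReal.ofReal (jap p.1 ^ (-(ε / 6))) * Q₁ p.1)
          * (ENNReal.ofReal (jap p.2.1 ^ (-(ε / 6))) * Q₂ p.2.1)
          * (ENNReal.ofReal (jap p.2.2 ^ (-(ε / 6))) * Q₃ p.2.2)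
          * g (2 * k + (p.1 - p.2.1 + p.2.2))) := by
  have mj := measurable_ofReal_jap_rpow
  have hw' : (∫⁻ c, g c ^ 2) ^ (1 / 2 : ℝ) ≤ 2 * w := by
    calc (∫⁻ c, g c ^ 2) ^ (1 / 2 : ℝ) ≤ ((2 * w) ^ 2) ^ (1 / 2 : ℝ) := by
          gcongr
          refine hw.trans ?_
          rw [mul_pow]
          gcongr
          norm_num
      _ = 2 * w := sq_sqrt_ennreal _
  set J : ℝ → ℝ≥0∞ := fun σ => ENNReal.ofReal (jap σ ^ (1 / 2 : ℝ)) with hJ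
  have mJ : Measurable J := mj _
  set R : ℝ → ℝ≥0∞ := fun σ => ENNReal.ofReal (jap σ ^ (-(ε / 6))) with hR
  have mR : Measurable R := mj _
  set lam := ENNReal.ofReal (|(k : ℝ)| ^ (1 / 2 + ε / 2)) with hlam
  have pt : ∀ x y z : ℝ, J (x - y + z + 2 * k) ≤
      3 * J x + 3 * J y + 3 * J z + 3 * (lam * (R x * R y * R z)) := by
    intro x y z
    simp only [hJ, hR, hlam]
    refine (ENNReal.ofReal_le_ofReal (jap_rpow_half_le hε x y z hk)).trans (le_of_eq ?_)
    have qx := jap_rpow_pos x (1 / 2)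
    have qy := jap_rpow_pos y (1 / 2)
    have qz := jap_rpow_pos z (1 / 2)
    have rx := jap_rpow_pos x (-(ε / 6))
    have ry := jap_rpow_pos y (-(ε / 6))
    have rz := jap_rpow_pos z (-(ε / 6))
    rw [ENNReal.ofReal_mul (by norm_num), ENNReal.ofReal_add (by positivity) (by positivity),
      ENNReal.ofReal_add (by positivity) (by positivity),
      ENNReal.ofReal_add (by positivity) (by positivity), ENNReal.ofReal_mul (by positivity),
      ENNReal.ofReal_mul (by positivity), ENNReal.ofReal_mul (by positivity), ENNReal.ofReal_ofNat]
    ring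
  calc _ ≤ ∫⁻ p : ℝ × ℝ × ℝ, (Q₁ p.1 * Q₂ p.2.1 * Q₃ p.2.2 * b
        + 3 * ((J p.1 * Q₁ p.1) * Q₂ p.2.1 * Q₃ p.2.2 * g (p.1 - p.2.1 + p.2.2 + 2 * k))
        + 3 * (Q₁ p.1 * (J p.2.1 * Q₂ p.2.1) * Q₃ p.2.2 * g (p.1 - p.2.1 + p.2.2 + 2 * k))
        + 3 * (Q₁ p.1 * Q₂ p.2.1 * (J p.2.2 * Q₃ p.2.2) * g (p.1 - p.2.1 + p.2.2 + 2 * k))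
        + 3 * (lam * ((R p.1 * Q₁ p.1) * (R p.2.1 * Q₂ p.2.1) * (R p.2.2 * Q₃ p.2.2)
          * g (2 * k + (p.1 - p.2.1 + p.2.2))))) := by
        refine lintegral_mono fun p => ?_
        rw [show 2 * (k : ℝ) + (p.1 - p.2.1 + p.2.2) = p.1 - p.2.1 + p.2.2 + 2 * k by ring]
        calc _ ≤ Q₁ p.1 * Q₂ p.2.1 * Q₃ p.2.2 *
              ((3 * J p.1 + 3 * J p.2.1 + 3 * J p.2.2 + 3 * (lam * (R p.1 * R p.2.1 * R p.2.2)))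
              * g (p.1 - p.2.1 + p.2.2 + 2 * k) + b) := by
              gcongr; exact pt _ _ _
          _ = _ := by ring
    _ = (∫⁻ p : ℝ × ℝ × ℝ, Q₁ p.1 * Q₂ p.2.1 * Q₃ p.2.2 * b)
        + 3 * (∫⁻ p : ℝ × ℝ × ℝ,
            (J p.1 * Q₁ p.1) * Q₂ p.2.1 * Q₃ p.2.2 * g (p.1 - p.2.1 + p.2.2 + 2 * k))
        + 3 * (∫⁻ p : ℝ × ℝ × ℝ,
            Q₁ p.1 * (J p.2.1 * Q₂ p.2.1) * Q₃ p.2.2 * g (p.1 - p.2.1 + p.2.2 + 2 * k))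
        + 3 * (∫⁻ p : ℝ × ℝ × ℝ,
            Q₁ p.1 * Q₂ p.2.1 * (J p.2.2 * Q₃ p.2.2) * g (p.1 - p.2.1 + p.2.2 + 2 * k))
        + 3 * (∫⁻ p : ℝ × ℝ × ℝ,
            lam * ((R p.1 * Q₁ p.1) * (R p.2.1 * Q₂ p.2.1) * (R p.2.2 * Q₃ p.2.2)
          * g (2 * k + (p.1 - p.2.1 + p.2.2)))) := by
        rw [lintegral_add_right _ (by fun_prop), lintegral_add_right _ (by fun_prop),
          lintegral_add_right _ (by fun_prop), lintegral_add_right _ (by fun_prop),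
          lintegral_const_mul _ (by fun_prop), lintegral_const_mul _ (by fun_prop),
          lintegral_const_mul _ (by fun_prop), lintegral_const_mul _ (by fun_prop)]
    _ ≤ _ := by
        have t1 := lintegral_triple_le_first (Q₁ := fun x => J x * Q₁ x) (mJ.mul h₁) h₂ h₃ hg (2 * k)
        have t2 := lintegral_triple_le_second (Q₂ := fun x => J x * Q₂ x) h₁ (mJ.mul h₂) h₃ hg (2 * k)
        have t3 := lintegral_triple_le_third (Q₃ := fun x => J x * Q₃ x) h₁ h₂ (mJ.mul h₃) hg (2 * k)
        rw [lintegral_mul_const _ (by fun_prop), lintegral_triple h₁ h₂ h₃]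
        have s1 := t1.trans (mul_le_mul_right hw' _)
        have s2 := t2.trans (mul_le_mul_right hw' _)
        have s3 := t3.trans (mul_le_mul_right hw' _)
        have six : ∀ u v x z : ℝ≥0∞, 6 * (u * v * x * z) = 3 * (u * v * x * (2 * z)) :=
          fun u v x z => by ring
        rw [six, six, six]
        exact add_le_add (add_le_add (add_le_add (add_le_add le_rfl (mul_le_mul_right s1 _))
          (mul_le_mul_right s2 _)) (mul_le_mul_right s3 _)) le_rfl

/-- The multilinear estimate for nonnegative functions of frequency and modulation. -/
theorem exists_multilinear_bound {a ε s : ℝ} (hε : 0 < ε) (hε' : ε ≤ 1 / 2) (hs : 0 < s)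
    (hs' : s < 1 / 2) (ha : a ≤ 1 / 2) (ha0 : 0 < a)
    (h1 : 1 + 2 * ε ≤ 4 * a) (h2 : 2 + 4 * ε ≤ 6 * a + 2 * (1 - 2 * s)) :
    ∃ K : ℝ≥0∞, K ≠ ∞ ∧ ∀ (P₁ P₂ P₃ G : ℤ → ℝ → ℝ≥0∞) (b w : ℤ → ℝ≥0∞),
      (∀ ξ, Measurable (P₁ ξ)) → (∀ ξ, Measurable (P₂ ξ)) → (∀ ξ, Measurable (P₃ ξ)) →
      (∀ y, Measurable (G y)) → (∀ y c, ∑' k : ℤ, G y (2 * k + c) ^ 2 ≤ w y ^ 2) →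
      ∑' (y : ℤ) (m : ℤ) (n : ℤ), ENNReal.ofReal |symb s y m n| *
        ∫⁻ p : ℝ × ℝ × ℝ, P₁ (y + m) p.1 * P₂ (y + m + n) p.2.1 * P₃ (y + n) p.2.2 *
          (ENNReal.ofReal (jap (p.1 - p.2.1 + p.2.2 + 2 * (m * n : ℤ)) ^ (1 / 2 : ℝ))
            * G y (p.1 - p.2.1 + p.2.2 + 2 * (m * n : ℤ)) + b y)
      ≤ K * (modNorm a P₁ * modNorm a P₂ * modNorm a P₃ * (hNorm a w + hNorm a b)) := by
  obtain ⟨K₁, hK₁, fixed⟩ := exists_fixed_time_bound hε hs hs' h1 h2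
  obtain ⟨K₂, hK₂, res⟩ := exists_resonant_bound hε hε' hs hs' ha ha0 h1 h2
  obtain ⟨K₃, hK₃, endp⟩ := exists_lintegral_hNorm_le (δ := ε / 6) (by positivity) a
  -- 19 = 1 + 6 + 6 + 6 collects the term with `b` and the three terms with a dominating modulation;
  -- the last summand is the resonant one.
  refine ⟨19 * K₁ + 3 * (K₂ * (K₃ * K₃ * K₃)), by finiteness, ?_⟩
  intro P₁ P₂ P₃ G b w m₁ m₂ m₃ mG hG
  have mR := measurable_ofReal_jap_rpow (-(ε / 6))
  set R : ℝ → ℝ≥0∞ := fun σ => ENNReal.ofReal (jap σ ^ (-(ε / 6))) with hR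
  set A : (ℤ → ℝ → ℝ≥0∞) → ℤ → ℝ≥0∞ := fun P ξ => ∫⁻ σ, P ξ σ with hA
  set B : (ℤ → ℝ → ℝ≥0∞) → ℤ → ℝ≥0∞ := fun P ξ => modL2 (P ξ) with hB
  have nA : ∀ P, hNorm a (A P) ≤ modNorm a P := fun P => le_add_self
  have nB : ∀ P, hNorm a (B P) ≤ modNorm a P := fun P => le_self_add
  set Y := modNorm a P₁ * modNorm a P₂ * modNorm a P₃ with hY
  set Z := hNorm a w + hNorm a b with hZ
  have zw : hNorm 0 w ≤ Z := (hNorm_zero_le ha0.le w).trans le_self_add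
  have zb : hNorm 0 b ≤ Z := (hNorm_zero_le ha0.le b).trans le_add_self
  have nonres : ∀ c₁ c₂ c₃ c₄ : ℤ → ℝ≥0∞, hNorm a c₁ ≤ modNorm a P₁ → hNorm a c₂ ≤ modNorm a P₂ →
      hNorm a c₃ ≤ modNorm a P₃ → hNorm 0 c₄ ≤ Z →
      ∑' (y : ℤ) (m : ℤ) (n : ℤ), ENNReal.ofReal |symb s y m n| *
        (c₁ (y + m) * c₂ (y + m + n) * c₃ (y + n) * c₄ y) ≤ K₁ * (Y * Z) := by
    intro c₁ c₂ c₃ c₄ k₁ k₂ k₃ k₄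
    refine (fixed c₁ c₂ c₃ c₄).trans ?_
    rw [hY]
    gcongr
  have resonant : ∑' (y : ℤ) (m : ℤ) (n : ℤ), ∫⁻ p : ℝ × ℝ × ℝ,
      ENNReal.ofReal (|symb s y m n| * |((m * n : ℤ) : ℝ)| ^ (1 / 2 + ε / 2)) *
        ((R p.1 * P₁ (y + m) p.1) * (R p.2.1 * P₂ (y + m + n) p.2.1)
          * (R p.2.2 * P₃ (y + n) p.2.2) * G y (2 * (m * n : ℤ) + (p.1 - p.2.1 + p.2.2)))
      ≤ K₂ * (K₃ * K₃ * K₃) * (Y * Z) := by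
    have mint : ∀ y m n : ℤ, Measurable fun p : ℝ × ℝ × ℝ =>
      ENNReal.ofReal (|symb s y m n| * |((m * n : ℤ) : ℝ)| ^ (1 / 2 + ε / 2)) *
        ((R p.1 * P₁ (y + m) p.1) * (R p.2.1 * P₂ (y + m + n) p.2.1)
          * (R p.2.2 * P₃ (y + n) p.2.2) * G y (2 * (m * n : ℤ) + (p.1 - p.2.1 + p.2.2))) := by
      intro y m n
      have := m₁ (y + m)
      have := m₂ (y + m + n)
      have := m₃ (y + n)
      have := mG y
      fun_prop
    -- The frequency sum is moved inside: at fixed modulations `G y` is sampled at 2mn plus an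
    -- offset independent of the frequencies, so `hG` and `exists_resonant_bound` apply pointwise.
    have swap : ∑' (y : ℤ) (m : ℤ) (n : ℤ), ∫⁻ p : ℝ × ℝ × ℝ,
      ENNReal.ofReal (|symb s y m n| * |((m * n : ℤ) : ℝ)| ^ (1 / 2 + ε / 2)) *
        ((R p.1 * P₁ (y + m) p.1) * (R p.2.1 * P₂ (y + m + n) p.2.1)
          * (R p.2.2 * P₃ (y + n) p.2.2) * G y (2 * (m * n : ℤ) + (p.1 - p.2.1 + p.2.2)))
      = ∫⁻ p : ℝ × ℝ × ℝ, ∑' (y : ℤ) (m : ℤ) (n : ℤ),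
      ENNReal.ofReal (|symb s y m n| * |((m * n : ℤ) : ℝ)| ^ (1 / 2 + ε / 2)) *
        ((R p.1 * P₁ (y + m) p.1) * (R p.2.1 * P₂ (y + m + n) p.2.1)
          * (R p.2.2 * P₃ (y + n) p.2.2) * G y (2 * (m * n : ℤ) + (p.1 - p.2.1 + p.2.2))) := by
      rw [lintegral_tsum fun y => (Measurable.tsum fun m => Measurable.tsum fun n =>
        mint y m n).aemeasurable]
      refine tsum_congr fun y => ?_
      rw [lintegral_tsum fun m => (Measurable.tsum fun n => mint y m n).aemeasurable]
      refine tsum_congr fun m => ?_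
      rw [lintegral_tsum fun n => (mint y m n).aemeasurable]
    rw [swap]
    calc _ ≤ ∫⁻ p : ℝ × ℝ × ℝ, K₂ * (hNorm a (fun ξ => R p.1 * P₁ ξ p.1)
          * hNorm a (fun ξ => R p.2.1 * P₂ ξ p.2.1) * hNorm a (fun ξ => R p.2.2 * P₃ ξ p.2.2)
          * hNorm a w) :=
          lintegral_mono fun p => res (fun ξ => R p.1 * P₁ ξ p.1) (fun ξ => R p.2.1 * P₂ ξ p.2.1)
            (fun ξ => R p.2.2 * P₃ ξ p.2.2) w (fun y k => G y (2 * k + (p.1 - p.2.1 + p.2.2)))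
            fun y => hG y _
      _ = K₂ * ((∫⁻ σ, hNorm a (fun ξ => R σ * P₁ ξ σ)) * (∫⁻ σ, hNorm a (fun ξ => R σ * P₂ ξ σ))
          * (∫⁻ σ, hNorm a (fun ξ => R σ * P₃ ξ σ)) * hNorm a w) := by
          have q₁ : Measurable fun σ => hNorm a (fun ξ => R σ * P₁ ξ σ) :=
            measurable_hNorm fun ξ => mR.mul (m₁ ξ)
          have q₂ : Measurable fun σ => hNorm a (fun ξ => R σ * P₂ ξ σ) :=
            measurable_hNorm fun ξ => mR.mul (m₂ ξ)
          have q₃ : Measurable fun σ => hNorm a (fun ξ => R σ * P₃ ξ σ) :=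
            measurable_hNorm fun ξ => mR.mul (m₃ ξ)
          have q : Measurable fun p : ℝ × ℝ × ℝ => hNorm a (fun ξ => R p.1 * P₁ ξ p.1)
              * hNorm a (fun ξ => R p.2.1 * P₂ ξ p.2.1) * hNorm a (fun ξ => R p.2.2 * P₃ ξ p.2.2) :=
            ((q₁.comp measurable_fst).mul (q₂.comp (measurable_fst.comp measurable_snd))).mul
              (q₃.comp (measurable_snd.comp measurable_snd))
          rw [lintegral_const_mul _ (q.mul_const _), lintegral_mul_const _ q,
            lintegral_triple q₁ q₂ q₃]
      _ ≤ K₂ * ((K₃ * modNorm a P₁) * (K₃ * modNorm a P₂) * (K₃ * modNorm a P₃) * Z) := by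
          gcongr
          · exact (endp P₁ m₁).trans (mul_le_mul_right (nB P₁) _)
          · exact (endp P₂ m₂).trans (mul_le_mul_right (nB P₂) _)
          · exact (endp P₃ m₃).trans (mul_le_mul_right (nB P₃) _)
          · exact le_self_add
      _ = _ := by ring
  calc _ ≤ ∑' (y : ℤ) (m : ℤ) (n : ℤ), (
        ENNReal.ofReal |symb s y m n| * (A P₁ (y + m) * A P₂ (y + m + n) * A P₃ (y + n) * b y)
        + 6 * (ENNReal.ofReal |symb s y m n| *
          (B P₁ (y + m) * A P₂ (y + m + n) * A P₃ (y + n) * w y))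
        + 6 * (ENNReal.ofReal |symb s y m n| *
          (A P₁ (y + m) * B P₂ (y + m + n) * A P₃ (y + n) * w y))
        + 6 * (ENNReal.ofReal |symb s y m n| *
          (A P₁ (y + m) * A P₂ (y + m + n) * B P₃ (y + n) * w y))
        + 3 * ∫⁻ p : ℝ × ℝ × ℝ,
          ENNReal.ofReal (|symb s y m n| * |((m * n : ℤ) : ℝ)| ^ (1 / 2 + ε / 2)) *
          ((R p.1 * P₁ (y + m) p.1) * (R p.2.1 * P₂ (y + m + n) p.2.1)
          * (R p.2.2 * P₃ (y + n) p.2.2) * G y (2 * (m * n : ℤ) + (p.1 - p.2.1 + p.2.2)))) := by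
        refine ENNReal.tsum_le_tsum fun y => ENNReal.tsum_le_tsum fun m =>
          ENNReal.tsum_le_tsum fun n => ?_
        by_cases hmn : m * n = 0
        · rw [symb_zero (by exact_mod_cast hmn)]; simp
        have := lintegral_modulation_le hε (m₁ (y + m)) (m₂ (y + m + n)) (m₃ (y + n)) (mG y) (b y)
          (lintegral_sq_le_of_sampling (mG y) (hG y)) hmn
        refine (mul_le_mul_right this _).trans (le_of_eq ?_)
        have pull : ∀ (c : ℝ) (F : ℝ × ℝ × ℝ → ℝ≥0∞),
            ∫⁻ p, ENNReal.ofReal (|symb s y m n| * c) * F p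
              = ENNReal.ofReal |symb s y m n| * ∫⁻ p, ENNReal.ofReal c * F p := by
          intro c F
          rw [← lintegral_const_mul' _ _ ENNReal.ofReal_ne_top]
          simp_rw [ENNReal.ofReal_mul (abs_nonneg (symb s y m n)), mul_assoc]
        rw [pull]
        simp only [hA, hB, hR]
        ring
    _ ≤ K₁ * (Y * Z) + 6 * (K₁ * (Y * Z)) + 6 * (K₁ * (Y * Z)) + 6 * (K₁ * (Y * Z))
        + 3 * (K₂ * (K₃ * K₃ * K₃) * (Y * Z)) := by
        simp_rw [ENNReal.tsum_add, ENNReal.tsum_mul_left]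
        gcongr
        · exact nonres _ _ _ _ (nA _) (nA _) (nA _) zb
        · exact nonres _ _ _ _ (nB _) (nA _) (nA _) zw
        · exact nonres _ _ _ _ (nA _) (nB _) (nA _) zw
        · exact nonres _ _ _ _ (nA _) (nA _) (nB _) zw
    _ = _ := by ring

/-! ### The Fourier transform on `L²(ℝ)` -/

/-- The L² transform agrees with the distributional one, so it moves onto the test function. With
`ae_eq_of_forall_schwartz` this identifies L² transforms almost everywhere with the usual integrals.
-/
lemma integral_schwartz_mul_fourier (f : Lp ℂ 2 (volume : Measure ℝ)) (χ : SchwartzMap ℝ ℂ) :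
    ∫ x, χ x * (𝓕 f : Lp ℂ 2 (volume : Measure ℝ)) x = ∫ x, 𝓕 (χ : ℝ → ℂ) x * f x := by
  have h := congrArg (fun D : TemperedDistribution ℝ ℂ => D χ)
    (Lp.fourier_toTemperedDistribution_eq f)
  simp only [TemperedDistribution.fourier_apply, Lp.toTemperedDistribution_apply,
    SchwartzMap.fourier_coe, smul_eq_mul] at h
  exact h.symm

lemma ae_eq_of_forall_schwartz {f g : ℝ → ℂ} (hf : LocallyIntegrable f) (hg : LocallyIntegrable g)
    (h : ∀ χ : SchwartzMap ℝ ℂ, ∫ x, χ x * f x = ∫ x, χ x * g x) : f =ᵐ[volume] g := by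
  refine ae_eq_of_integral_contDiff_smul_eq hf hg fun φ hφ hc => ?_
  have hg₁ : HasCompactSupport (Complex.ofRealCLM ∘ φ) := hc.comp_left rfl
  have hg₂ : ContDiff ℝ ((⊤ : ℕ∞) : WithTop ℕ∞) (Complex.ofRealCLM ∘ φ) :=
    Complex.ofRealCLM.contDiff.comp hφ
  simpa using h (hg₁.toSchwartzMap hg₂)

lemma continuous_fourier_of_integrable {φ : ℝ → ℂ} (h : Integrable φ) : Continuous (𝓕 φ) :=
  VectorFourier.fourierIntegral_continuous Real.continuous_fourierChar (by fun_prop) h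

lemma continuous_fourierInv_of_integrable {φ : ℝ → ℂ} (h : Integrable φ) : Continuous (𝓕⁻ φ) := by
  have : 𝓕⁻ φ = fun x => 𝓕 φ (-x) := by ext x; rw [Real.fourierInv_eq_fourier_neg]
  rw [this]
  exact (continuous_fourier_of_integrable h).comp continuous_neg

lemma locallyIntegrable_Lp (f : Lp ℂ 2 (volume : Measure ℝ)) :
    LocallyIntegrable (f : ℝ → ℂ) volume :=
  (Lp.memLp f).locallyIntegrable (by norm_num)

lemma integral_fourier_mul_eq {f g : ℝ → ℂ} (hf : Integrable f) (hg : Integrable g) :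
    ∫ x, 𝓕 f x * g x = ∫ x, f x * 𝓕 g x := by
  simpa using! VectorFourier.integral_fourierIntegral_smul_eq_flip (L := innerₗ ℝ)
    Real.continuous_fourierChar continuous_inner hf hg

lemma fourier_toLp_ae {φ : ℝ → ℂ} (h₁ : Integrable φ) (h₂ : MemLp φ 2 volume) :
    ((𝓕 (h₂.toLp φ) : Lp ℂ 2 (volume : Measure ℝ)) : ℝ → ℂ) =ᵐ[volume] 𝓕 φ := by
  refine ae_eq_of_forall_schwartz (locallyIntegrable_Lp _)
    (continuous_fourier_of_integrable h₁).locallyIntegrable fun χ => ?_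
  rw [integral_schwartz_mul_fourier]
  calc ∫ x, 𝓕 (χ : ℝ → ℂ) x * (h₂.toLp φ) x = ∫ x, 𝓕 (χ : ℝ → ℂ) x * φ x := by
        refine integral_congr_ae ?_
        filter_upwards [h₂.coeFn_toLp] with x hx
        rw [hx]
    _ = ∫ x, χ x * 𝓕 φ x :=
        integral_fourier_mul_eq χ.integrable h₁

/-- Fourier inversion for square integrable functions with integrable transform. -/
lemma ae_eq_fourierInv (f : Lp ℂ 2 (volume : Measure ℝ))
    (h : Integrable ((𝓕 f : Lp ℂ 2 (volume : Measure ℝ)) : ℝ → ℂ)) :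
    (f : ℝ → ℂ) =ᵐ[volume] 𝓕⁻ ((𝓕 f : Lp ℂ 2 (volume : Measure ℝ)) : ℝ → ℂ) := by
  refine ae_eq_of_forall_schwartz (locallyIntegrable_Lp _)
    (continuous_fourierInv_of_integrable h).locallyIntegrable fun χ => ?_
  have h1 := integral_schwartz_mul_fourier f (𝓕⁻ χ)
  have h2 : 𝓕 ((𝓕⁻ χ : SchwartzMap ℝ ℂ) : ℝ → ℂ) = χ := by
    rw [← SchwartzMap.fourier_coe, FourierTransform.fourier_fourierInv_eq]
  rw [h2] at h1
  rw [← h1]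
  have h3 : ((𝓕⁻ χ : SchwartzMap ℝ ℂ) : ℝ → ℂ) = fun x => 𝓕 (χ : ℝ → ℂ) (-x) := by
    ext x
    rw [SchwartzMap.fourierInv_coe, Real.fourierInv_eq_fourier_neg]
  rw [h3]
  set F : ℝ → ℂ := ⇑(𝓕 f : Lp ℂ 2 (volume : Measure ℝ)) with hF
  calc ∫ x, 𝓕 (χ : ℝ → ℂ) (-x) * F x = ∫ x, 𝓕 (χ : ℝ → ℂ) x * F (-x) := by
        rw [← integral_neg_eq_self]; simp
    _ = ∫ x, χ x * 𝓕 (fun y => F (-y)) x :=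
        integral_fourier_mul_eq χ.integrable h.comp_neg
    _ = ∫ x, χ x * 𝓕⁻ F x := by
        congr with x
        congr 1
        rw [Real.fourierInv_eq_fourier_comp_neg]

/-- The normalising constant `(2π)^{-1/2}` of the Fourier transform. -/
def kap : ℝ := 1 / Real.sqrt (2 * Real.pi)

lemma kap_pos : 0 < kap := by unfold kap; positivity

lemma kap_sq : kap ^ 2 * (2 * Real.pi) = 1 := by
  unfold kap
  rw [div_pow, Real.sq_sqrt (by positivity)]
  field_simp

lemma kap_le : 2 * kap ≤ 1 := by
  have h := kap_sq
  have := Real.pi_gt_three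
  have := kap_pos
  nlinarith

lemma tFT_eq {f : ℝ → ℂ} (h : MemLp f 2 volume) (τ : ℝ) :
    tFT f τ = (kap : ℂ) * (𝓕 (h.toLp f) : Lp ℂ 2 (volume : Measure ℝ)) (τ / (2 * Real.pi)) := by
  rw [tFT, dif_pos h]; rfl

lemma quasiMeasurePreserving_mul {c : ℝ} (hc : c ≠ 0) :
    Measure.QuasiMeasurePreserving (fun x : ℝ => c * x) volume volume := by
  refine ⟨by fun_prop, ?_⟩
  rw [Real.map_volume_mul_left hc]
  exact Measure.smul_absolutelyContinuous

lemma ae_comp_mul {p : ℝ → Prop} (h : ∀ᵐ x, p x) {c : ℝ} (hc : c ≠ 0) : ∀ᵐ x : ℝ, p (c * x) :=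
  (quasiMeasurePreserving_mul hc).ae h

lemma aestronglyMeasurable_tFT (f : ℝ → ℂ) : AEStronglyMeasurable (tFT f) volume := by
  by_cases h : MemLp f 2 volume
  · have e : tFT f = fun τ => (kap : ℂ) *
        (𝓕 (h.toLp f) : Lp ℂ 2 (volume : Measure ℝ)) ((2 * Real.pi)⁻¹ * τ) := by
      ext τ; rw [tFT_eq h, div_eq_inv_mul]
    rw [e]
    exact ((Lp.aestronglyMeasurable _).comp_quasiMeasurePreserving
      (quasiMeasurePreserving_mul (by positivity))).const_mul _
  · have : tFT f = fun _ => 0 := by ext τ; rw [tFT, dif_neg h]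
    rw [this]; exact aestronglyMeasurable_const

lemma two_pi_ne : (2 * Real.pi : ℝ) ≠ 0 := by positivity

/-- Fourier inversion in the normalisation of `tFT`. -/
lemma ae_eq_integral_tFT {f : ℝ → ℂ} (h : MemLp f 2 volume) (hF : Integrable (tFT f)) :
    ∀ᵐ t, f t = (kap : ℂ) * ∫ τ : ℝ, Complex.exp (Complex.I * t * τ) * tFT f τ := by
  set g : ℝ → ℂ := ⇑(𝓕 (h.toLp f) : Lp ℂ 2 (volume : Measure ℝ)) with hg
  have hk : (kap : ℂ) ≠ 0 := by exact_mod_cast kap_pos.ne'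
  have e : ∀ v, g v = (kap : ℂ)⁻¹ * tFT f (v * (2 * Real.pi)) := by
    intro v
    rw [tFT_eq h, mul_div_cancel_right₀ _ two_pi_ne, ← mul_assoc, inv_mul_cancel₀ hk, one_mul]
  have hgi : Integrable g := by
    rw [show g = fun v => (kap : ℂ)⁻¹ * tFT f (v * (2 * Real.pi)) from funext e]
    exact (hF.comp_mul_right' two_pi_ne).const_mul _
  filter_upwards [h.coeFn_toLp, ae_eq_fourierInv _ hgi] with t h1 h2
  rw [← h1, h2, Real.fourierInv_eq']
  simp only [smul_eq_mul]
  have e2 : ∀ v : ℝ, Complex.exp (((2 * Real.pi * inner ℝ v t : ℝ) : ℂ) * Complex.I) * g v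
      = (fun τ : ℝ => (kap : ℂ)⁻¹ * (Complex.exp (Complex.I * t * τ) * tFT f τ))
        (v * (2 * Real.pi)) := by
    intro v
    have hin : inner ℝ v t = t * v := by simp
    rw [e v, hin]
    push_cast
    rw [show 2 * (Real.pi : ℂ) * ((t : ℂ) * v) * Complex.I = Complex.I * t * (v * (2 * Real.pi)) by ring]
    ring
  rw [integral_congr_ae (ae_of_all _ e2), Measure.integral_comp_mul_right
    (fun τ : ℝ => (kap : ℂ)⁻¹ * (Complex.exp (Complex.I * t * τ) * tFT f τ)), integral_const_mul,
    Complex.real_smul, ← mul_assoc]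
  congr 1
  rw [abs_of_pos (by positivity)]
  have := kap_sq
  rw [← Complex.ofReal_inv, ← Complex.ofReal_mul]
  congr 1
  have := kap_pos
  field_simp
  linarith

/-! ### The sharp time cutoff -/

/-- The Fourier transform of the indicator function of `[0, T]`. -/
def sharpCutoff (T c : ℝ) : ℂ :=
  (kap : ℂ) * ∫ t in (0 : ℝ)..T, Complex.exp (-(Complex.I * c * t))

lemma norm_exp_neg_I_mul (c t : ℝ) : ‖Complex.exp (-(Complex.I * c * t))‖ = 1 := by
  rw [show -(Complex.I * c * t) = ((-(c * t) : ℝ) : ℂ) * Complex.I by push_cast; ring,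
    Complex.norm_exp_ofReal_mul_I]

lemma norm_exp_I_mul (c t : ℝ) : ‖Complex.exp (Complex.I * c * t)‖ = 1 := by
  rw [show Complex.I * c * t = ((c * t : ℝ) : ℂ) * Complex.I by push_cast; ring,
    Complex.norm_exp_ofReal_mul_I]

lemma continuous_sharpCutoff (T : ℝ) : Continuous (sharpCutoff T) := by
  unfold sharpCutoff
  refine continuous_const.mul ?_
  exact intervalIntegral.continuous_parametric_intervalIntegral_of_continuous' (by fun_prop) 0 T

lemma norm_sharpCutoff_le {T : ℝ} (hT : 0 ≤ T) (hT' : T ≤ 1) (c : ℝ) : ‖sharpCutoff T c‖ ≤ 1 := by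
  rw [sharpCutoff, norm_mul, Complex.norm_real, Real.norm_of_nonneg kap_pos.le]
  have : ‖∫ t in (0 : ℝ)..T, Complex.exp (-(Complex.I * c * t))‖ ≤ 1 * |T - 0| :=
    intervalIntegral.norm_integral_le_of_norm_le_const fun t _ => (norm_exp_neg_I_mul c t).le
  rw [sub_zero, abs_of_nonneg hT] at this
  have := kap_le
  have := kap_pos
  nlinarith

/-- Integrate the exponential; 2 (2π)^{-1/2} ≤ 1. This decay suffices for square integrability, and
in the commutator it cancels against a difference of weights. -/
lemma norm_sharpCutoff_mul_le (T c : ℝ) : ‖sharpCutoff T c‖ * |c| ≤ 1 := by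
  by_cases hc : c = 0
  · simp [hc]
  have hc' : -(Complex.I * c) ≠ 0 := by
    simp [hc]
  have e : ∫ t in (0 : ℝ)..T, Complex.exp (-(Complex.I * c * t))
      = (Complex.exp (-(Complex.I * c) * T) - 1) / (-(Complex.I * c)) := by
    have := integral_exp_mul_complex (a := 0) (b := T) hc'
    simp only [Complex.ofReal_zero, mul_zero, Complex.exp_zero] at this
    rw [← this]
    congr with t; congr 1; ring
  rw [sharpCutoff, norm_mul, Complex.norm_real, Real.norm_of_nonneg kap_pos.le, e, norm_div,
    norm_neg, norm_mul, Complex.norm_I, one_mul, Complex.norm_real, Real.norm_eq_abs, mul_assoc,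
    div_mul_cancel₀ _ (abs_pos.2 hc).ne']
  have : ‖Complex.exp (-(Complex.I * c) * T) - 1‖ ≤ 2 := by
    refine (norm_sub_le _ _).trans ?_
    have := norm_exp_neg_I_mul c T
    rw [show -(Complex.I * c * T) = -(Complex.I * c) * (T : ℂ) by ring] at this
    rw [this, norm_one]; norm_num
  have := kap_le
  have := kap_pos
  nlinarith

lemma memLp_sharpCutoff {T : ℝ} (hT : 0 ≤ T) (hT' : T ≤ 1) : MemLp (sharpCutoff T) 2 volume := by
  rw [memLp_two_iff_integrable_sq_norm (continuous_sharpCutoff T).aestronglyMeasurable]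
  have hint : Integrable fun x : ℝ => 4 * (1 + x ^ 2)⁻¹ := integrable_inv_one_add_sq.const_mul 4
  refine hint.mono' (by have := continuous_sharpCutoff T; fun_prop) (ae_of_all _ fun c => ?_)
  have h1 := norm_sharpCutoff_le hT hT' c
  have h2 := norm_sharpCutoff_mul_le T c
  have h3 := norm_nonneg (sharpCutoff T c)
  rw [Real.norm_of_nonneg (by positivity), ← div_eq_mul_inv, le_div_iff₀ (by positivity)]
  have e1 : ‖sharpCutoff T c‖ ^ 2 * c ^ 2 ≤ 1 := by
    rw [← sq_abs c, ← mul_pow]; exact pow_le_one₀ (by positivity) h2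
  nlinarith

/-- Parseval's identity against the truncated exponential. -/
lemma integral_exp_mul_eq {f : ℝ → ℂ} (h : MemLp f 2 volume) {T : ℝ} (hT : 0 ≤ T) (c : ℝ) :
    ∫ t in (0 : ℝ)..T, Complex.exp (-(Complex.I * c * t)) * f t
      = ∫ τ, sharpCutoff T (c - τ) * tFT f τ := by
  set φ : ℝ → ℂ := (Set.Ioc 0 T).indicator fun t => Complex.exp (Complex.I * c * t) with hφ
  have hm : AEStronglyMeasurable φ volume :=
    (Continuous.aestronglyMeasurable (by fun_prop)).indicator measurableSet_Ioc
  have hb : MemLp (fun t : ℝ => Complex.exp (Complex.I * c * t)) ⊤ (volume.restrict (Set.Ioc 0 T)) :=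
    memLp_top_of_bound (Continuous.aestronglyMeasurable (by fun_prop)) 1
      (ae_of_all _ fun t => (norm_exp_I_mul c t).le)
  have hp : ∀ p : ℝ≥0∞, MemLp φ p volume := fun p =>
    (memLp_indicator_iff_restrict measurableSet_Ioc).2 (hb.mono_exponent le_top)
  have h1 : Integrable φ := memLp_one_iff_integrable.1 (hp 1)
  have h2 := hp 2
  have pars := Lp.inner_fourier_eq (h2.toLp φ) (h.toLp f)
  rw [L2.inner_def, L2.inner_def] at pars
  have lhs : ∫ t in (0 : ℝ)..T, Complex.exp (-(Complex.I * c * t)) * f t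
      = ∫ t, inner ℂ ((h2.toLp φ : Lp ℂ 2 (volume : Measure ℝ)) t)
          ((h.toLp f : Lp ℂ 2 (volume : Measure ℝ)) t) := by
    rw [intervalIntegral.integral_of_le hT, ← integral_indicator measurableSet_Ioc]
    refine integral_congr_ae ?_
    filter_upwards [h2.coeFn_toLp, h.coeFn_toLp] with t e1 e2
    rw [e1, e2, hφ, RCLike.inner_apply]
    by_cases ht : t ∈ Set.Ioc 0 T
    · rw [Set.indicator_of_mem ht, Set.indicator_of_mem ht, ← Complex.exp_conj]
      simp only [map_mul, Complex.conj_I, Complex.conj_ofReal]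
      rw [mul_comm]; congr 2; ring
    · rw [Set.indicator_of_notMem ht, Set.indicator_of_notMem ht]; simp
  rw [lhs, ← pars]
  have hk : (kap : ℂ) ≠ 0 := by exact_mod_cast kap_pos.ne'
  have key : ∀ v : ℝ, conj (𝓕 φ v) = (kap : ℂ)⁻¹ * sharpCutoff T (c - v * (2 * Real.pi)) := by
    intro v
    rw [sharpCutoff, ← mul_assoc, inv_mul_cancel₀ hk, one_mul, Real.fourier_eq', ← integral_conj,
      intervalIntegral.integral_of_le hT, ← integral_indicator measurableSet_Ioc]
    congr 1 with t
    by_cases ht : t ∈ Set.Ioc 0 T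
    · rw [Set.indicator_of_mem ht, hφ, Set.indicator_of_mem ht, smul_eq_mul, ← Complex.exp_add,
        ← Complex.exp_conj]
      congr 1
      simp only [inner, map_add, map_mul, Complex.conj_I, Complex.conj_ofReal]
      push_cast
      simp
      ring
    · rw [Set.indicator_of_notMem ht, hφ, Set.indicator_of_notMem ht]; simp
  set g : ℝ → ℂ := ⇑(𝓕 (h.toLp f) : Lp ℂ 2 (volume : Measure ℝ)) with hg
  have e : ∀ v, g v = (kap : ℂ)⁻¹ * tFT f (v * (2 * Real.pi)) := by
    intro v
    rw [tFT_eq h, mul_div_cancel_right₀ _ two_pi_ne, ← mul_assoc, inv_mul_cancel₀ hk, one_mul]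
  calc _ = ∫ v, (fun τ => ((kap : ℂ)⁻¹) ^ 2 * (sharpCutoff T (c - τ) * tFT f τ))
        (v * (2 * Real.pi)) := by
        refine integral_congr_ae ?_
        filter_upwards [fourier_toLp_ae h1 h2] with v hv
        rw [RCLike.inner_apply, hv, key v, e v]
        ring
    _ = _ := by
        rw [Measure.integral_comp_mul_right
          (fun τ => ((kap : ℂ)⁻¹) ^ 2 * (sharpCutoff T (c - τ) * tFT f τ)), integral_const_mul, abs_of_pos (by positivity),
          Complex.real_smul, ← mul_assoc]
        have : (((2 * Real.pi)⁻¹ : ℝ) : ℂ) * ((kap : ℂ)⁻¹) ^ 2 = 1 := by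
          rw [← Complex.ofReal_inv, ← Complex.ofReal_pow, ← Complex.ofReal_mul, ← Complex.ofReal_one]
          congr 1
          have h3 := kap_sq
          have := kap_pos
          field_simp
          linarith
        rw [this, one_mul]

/-! ### Sampling, commutator and Fubini -/

lemma eLpNorm_two_eq {α E : Type*} [MeasurableSpace α] [ENorm E] {μ : Measure α} (f : α → E) :
    eLpNorm f 2 μ = (∫⁻ x, ‖f x‖ₑ ^ 2 ∂μ) ^ (1 / 2 : ℝ) := by
  rw [eLpNorm_eq_lintegral_rpow_enorm_toReal (by norm_num) (by norm_num)]
  simp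

lemma eLpNorm_two_sq {α E : Type*} [MeasurableSpace α] [ENorm E] {μ : Measure α} (f : α → E) :
    eLpNorm f 2 μ ^ 2 = ∫⁻ x, ‖f x‖ₑ ^ 2 ∂μ := by
  rw [eLpNorm_two_eq, sqrt_sq_ennreal]

lemma enorm_sq_eq_ofReal (z : ℂ) : ‖z‖ₑ ^ 2 = ENNReal.ofReal (‖z‖ ^ 2) := by
  rw [← ofReal_norm, ENNReal.ofReal_pow (norm_nonneg _)]

lemma eLpNorm_two_sq_eq_ofReal {f : ℝ → ℂ} {μ : Measure ℝ} (hf : MemLp f 2 μ) :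
    eLpNorm f 2 μ ^ 2 = ENNReal.ofReal (∫ x, ‖f x‖ ^ 2 ∂μ) := by
  rw [eLpNorm_two_sq, ofReal_integral_eq_lintegral_ofReal
    ((memLp_two_iff_integrable_sq_norm hf.1).1 hf) (ae_of_all _ fun _ => by positivity)]
  simp_rw [enorm_sq_eq_ofReal]

/-- The functions e^{2ikt} are the characters of period π and [0, T] lies in [0, π]. So the
integrals are π times the Fourier coefficients on (0, π) of the cut-off function modulated by
e^{-ict}. Parseval gives π times its squared L² norm, and π ≤ 4; the bound is uniform in c. -/
lemma tsum_integral_exp_sq_le {g : ℝ → ℂ} (hg : MemLp g 2 volume) {T : ℝ} (hT : 0 ≤ T) (hT' : T ≤ 1)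
    (c : ℝ) : ∑' k : ℤ, ‖∫ t in (0 : ℝ)..T,
      Complex.exp (-(Complex.I * ((2 * k + c : ℝ) : ℂ) * t)) * g t‖ₑ ^ 2
      ≤ (2 * eLpNorm g 2 volume) ^ 2 := by
  have hπ := Real.pi_gt_three
  have hπ0 : 0 < Real.pi := Real.pi_pos
  set f : ℝ → ℂ := (Set.Ioc 0 T).indicator fun t => Complex.exp (-(Complex.I * c * t)) * g t with hf
  have hfm : AEStronglyMeasurable f volume :=
    ((Continuous.aestronglyMeasurable (by fun_prop)).mul hg.1).indicator measurableSet_Ioc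
  have hfg : ∀ t, ‖f t‖ ≤ ‖g t‖ := by
    intro t
    by_cases ht : t ∈ Set.Ioc 0 T
    · rw [hf, Set.indicator_of_mem ht, norm_mul, norm_exp_neg_I_mul, one_mul]
    · rw [hf, Set.indicator_of_notMem ht, norm_zero]; exact norm_nonneg _
  have hfL : MemLp f 2 volume := hg.mono hfm (ae_of_all _ hfg)
  have hcoef : ∀ k : ℤ, ∫ t in (0 : ℝ)..T,
      Complex.exp (-(Complex.I * ((2 * k + c : ℝ) : ℂ) * t)) * g t
        = (Real.pi : ℂ) * fourierCoeffOn hπ0 f k := by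
    intro k
    rw [fourierCoeffOn_eq_integral, intervalIntegral.integral_of_le hπ0.le,
      intervalIntegral.integral_of_le hT, Complex.real_smul, ← mul_assoc]
    have : (Real.pi : ℂ) * ((1 / (Real.pi - 0) : ℝ) : ℂ) = 1 := by
      push_cast
      rw [sub_zero]
      field_simp
    rw [this, one_mul]
    have hsub : Set.Ioc 0 T ⊆ Set.Ioc 0 Real.pi := Set.Ioc_subset_Ioc_right (by linarith)
    have e : ∀ t : ℝ, fourier (-k) (t : AddCircle (Real.pi - 0)) • f t
        = (Set.Ioc 0 T).indicator (fun t : ℝ =>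
          Complex.exp (-(Complex.I * ((2 * k + c : ℝ) : ℂ) * t)) * g t) t := by
      intro t
      by_cases ht : t ∈ Set.Ioc 0 T
      · rw [hf, Set.indicator_of_mem ht, Set.indicator_of_mem ht, fourier_coe_apply, smul_eq_mul,
          ← mul_assoc, ← Complex.exp_add]
        congr 2
        push_cast
        rw [sub_zero]
        field_simp
        ring
      · rw [hf, Set.indicator_of_notMem ht, Set.indicator_of_notMem ht, smul_zero]
    simp_rw [e]
    rw [setIntegral_indicator measurableSet_Ioc, Set.inter_eq_self_of_subset_right hsub]
  have hsum := hasSum_sq_fourierCoeffOn hπ0 (hfL.restrict (Set.Ioc 0 Real.pi))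
  have hle : ∫ x in (0 : ℝ)..Real.pi, ‖f x‖ ^ 2 ≤ ∫ x, ‖g x‖ ^ 2 := by
    rw [intervalIntegral.integral_of_le hπ0.le]
    have i1 := (memLp_two_iff_integrable_sq_norm hfm).1 hfL
    have i2 := (memLp_two_iff_integrable_sq_norm hg.1).1 hg
    refine (setIntegral_le_integral i1 (ae_of_all _ fun _ => by positivity)).trans ?_
    exact integral_mono i1 i2 fun t => pow_le_pow_left₀ (norm_nonneg _) (hfg t) 2
  calc _ = ∑' k : ℤ, ENNReal.ofReal (Real.pi ^ 2 * ‖fourierCoeffOn hπ0 f k‖ ^ 2) := by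
        refine tsum_congr fun k => ?_
        rw [hcoef, enorm_sq_eq_ofReal, norm_mul, Complex.norm_real, Real.norm_of_nonneg hπ0.le,
          mul_pow]
    _ = ENNReal.ofReal (Real.pi ^ 2 * ((Real.pi - 0)⁻¹ • ∫ x in (0 : ℝ)..Real.pi, ‖f x‖ ^ 2)) := by
        rw [← ENNReal.ofReal_tsum_of_nonneg (fun _ => by positivity) (hsum.summable.mul_left _),
          tsum_mul_left, hsum.tsum_eq]
    _ ≤ ENNReal.ofReal (4 * ∫ x, ‖g x‖ ^ 2) := by
        apply ENNReal.ofReal_le_ofReal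
        have e : Real.pi ^ 2 * ((Real.pi - 0)⁻¹ • ∫ x in (0 : ℝ)..Real.pi, ‖f x‖ ^ 2)
            = Real.pi * ∫ x in (0 : ℝ)..Real.pi, ‖f x‖ ^ 2 := by
          rw [smul_eq_mul, sub_zero]; field_simp
        rw [e]
        have h0 : 0 ≤ ∫ x in (0 : ℝ)..Real.pi, ‖f x‖ ^ 2 :=
          intervalIntegral.integral_nonneg hπ0.le fun _ _ => by positivity
        exact mul_le_mul Real.pi_le_four hle h0 (by norm_num)
    _ = _ := by
        rw [ENNReal.ofReal_mul (by norm_num), ← eLpNorm_two_sq_eq_ofReal hg, mul_pow]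
        norm_num

/-- Sampling the transform of a function cut off to `[0, T]` at integer spacing. -/
lemma tsum_sharpCutoff_sq_le {w : ℝ → ℂ} (hw : MemLp w 2 volume) {T : ℝ} (hT : 0 ≤ T) (hT' : T ≤ 1)
    (c : ℝ) : ∑' k : ℤ, ‖∫ τ, sharpCutoff T (2 * k + c - τ) * w τ‖ₑ ^ 2
      ≤ (2 * eLpNorm w 2 volume) ^ 2 := by
  have hk : (kap : ℂ) ≠ 0 := by exact_mod_cast kap_pos.ne'
  set w' : ℝ → ℂ := fun v => (kap : ℂ)⁻¹ * w (2 * Real.pi * v) with hw'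
  have hm' : AEStronglyMeasurable w' volume :=
    (hw.1.comp_quasiMeasurePreserving (quasiMeasurePreserving_mul two_pi_ne)).const_mul _
  have hnorm : ∀ v, ‖w' v‖ ^ 2 = (kap ^ 2)⁻¹ * ‖w (2 * Real.pi * v)‖ ^ 2 := by
    intro v
    rw [hw', norm_mul, norm_inv, Complex.norm_real, Real.norm_of_nonneg kap_pos.le]
    ring
  have hL' : MemLp w' 2 volume := by
    rw [memLp_two_iff_integrable_sq_norm hm']
    simp_rw [hnorm]
    exact (((memLp_two_iff_integrable_sq_norm hw.1).1 hw).comp_mul_left' two_pi_ne).const_mul _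
  have hint : ∫ v, ‖w' v‖ ^ 2 = ∫ v, ‖w v‖ ^ 2 := by
    simp_rw [hnorm]
    rw [integral_const_mul, Measure.integral_comp_mul_left (fun v => ‖w v‖ ^ 2), smul_eq_mul,
      ← mul_assoc, abs_of_pos (by positivity)]
    have h3 : (kap ^ 2)⁻¹ * (2 * Real.pi)⁻¹ = 1 := by rw [← mul_inv, kap_sq, inv_one]
    rw [h3, one_mul]
  -- `g` is the function whose transform `tFT` is `w`. The rescaling in `w'` adjusts the
  -- normalisation and preserves the L² norm, since kap² · 2π = 1.
  set g : Lp ℂ 2 (volume : Measure ℝ) := 𝓕⁻ (hL'.toLp w') with hg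
  have hgL : MemLp g 2 volume := Lp.memLp g
  have hnormg : eLpNorm g 2 volume = eLpNorm w 2 volume := by
    have e1 : ‖g‖ = ‖hL'.toLp w'‖ := by
      rw [← Lp.norm_fourier_eq g, hg, FourierTransform.fourier_fourierInv_eq]
    have e2 : eLpNorm g 2 volume = eLpNorm w' 2 volume := by
      rw [Lp.norm_def, Lp.norm_toLp] at e1
      exact (ENNReal.toReal_eq_toReal_iff' hgL.2.ne hL'.2.ne).1 e1
    rw [e2]
    have e3 : eLpNorm w' 2 volume ^ 2 = eLpNorm w 2 volume ^ 2 := by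
      rw [eLpNorm_two_sq_eq_ofReal hL', eLpNorm_two_sq_eq_ofReal hw, hint]
    rw [← sq_sqrt_ennreal (eLpNorm w' 2 volume), e3, sq_sqrt_ennreal]
  have htFT : ∀ᵐ τ, tFT g τ = w τ := by
    have h1 : ∀ᵐ τ : ℝ, (hL'.toLp w') ((2 * Real.pi)⁻¹ * τ) = w' ((2 * Real.pi)⁻¹ * τ) :=
      ae_comp_mul hL'.coeFn_toLp (inv_ne_zero two_pi_ne)
    filter_upwards [h1] with τ hτ
    rw [tFT_eq hgL, Lp.toLp_coeFn, hg, FourierTransform.fourier_fourierInv_eq, div_eq_inv_mul, hτ, hw']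
    simp only
    rw [← mul_assoc, mul_inv_cancel₀ hk, one_mul, ← mul_assoc, mul_inv_cancel₀ two_pi_ne, one_mul]
  rw [← hnormg]
  refine le_trans (le_of_eq (tsum_congr fun k => ?_)) (tsum_integral_exp_sq_le hgL hT hT' c)
  rw [integral_exp_mul_eq hgL hT]
  congr 2
  refine integral_congr_ae ?_
  filter_upwards [htFT] with τ hτ
  rw [hτ]

/-- The difference of the weights at τ and c is at most |c - τ| ⟨τ+q⟩^{-1/2}, and the factor |c - τ|
is absorbed by the decay of the cutoff kernel. -/
lemma norm_sharpCutoff_mul_jap_sub_le (T c q τ : ℝ) :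
    ‖sharpCutoff T (c - τ)‖ * |jap (τ + q) ^ (1 / 2 : ℝ) - jap (c + q) ^ (1 / 2 : ℝ)|
      ≤ jap (τ + q) ^ (-1 / 2 : ℝ) := by
  have h1 := abs_jap_rpow_sub_le (β := 1 / 2) (by norm_num) (by norm_num) (τ + q) (c + q)
  rw [show τ + q - (c + q) = -(c - τ) by ring, abs_neg, show (1 / 2 - 1 : ℝ) = -1 / 2 by norm_num] at h1
  have h2 := norm_sharpCutoff_mul_le T (c - τ)
  have h3 := jap_rpow_pos (τ + q) (-1 / 2)
  calc _ ≤ ‖sharpCutoff T (c - τ)‖ * (jap (τ + q) ^ (-1 / 2 : ℝ) * |c - τ|) := by gcongr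
    _ = jap (τ + q) ^ (-1 / 2 : ℝ) * (‖sharpCutoff T (c - τ)‖ * |c - τ|) := by ring
    _ ≤ jap (τ + q) ^ (-1 / 2 : ℝ) * 1 := by gcongr
    _ = _ := mul_one _

/-- Commuting the weight `⟨τ + q⟩^{1/2}` with the sharp time cutoff. -/
lemma enorm_integral_sharpCutoff_le {T : ℝ} (hT : 0 ≤ T) (hT' : T ≤ 1) (q c : ℝ) {V : ℝ → ℂ}
    (hw : MemLp (fun τ => ((jap (τ + q) ^ (-1 / 2 : ℝ) : ℝ) : ℂ) * V τ) 2 volume)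
    (hr : Integrable (fun τ => ((jap (τ + q) ^ (-1 : ℝ) : ℝ) : ℂ) * V τ)) :
    ‖∫ τ, sharpCutoff T (c - τ) * V τ‖ₑ ≤
      ENNReal.ofReal (jap (c + q) ^ (1 / 2 : ℝ)) *
        ‖∫ τ, sharpCutoff T (c - τ) * (((jap (τ + q) ^ (-1 / 2 : ℝ) : ℝ) : ℂ) * V τ)‖ₑ
      + ∫⁻ τ, ‖((jap (τ + q) ^ (-1 : ℝ) : ℝ) : ℂ) * V τ‖ₑ := by
  set w : ℝ → ℂ := fun τ => ((jap (τ + q) ^ (-1 / 2 : ℝ) : ℝ) : ℂ) * V τ with hwdef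
  have hK : MemLp (fun τ => sharpCutoff T (c - τ)) 2 volume :=
    (memLp_sharpCutoff hT hT').comp_measurePreserving (volume.measurePreserving_sub_left c)
  have hKw : Integrable fun τ => sharpCutoff T (c - τ) * w τ := hK.integrable_mul hw
  set X : ℝ := jap (c + q) ^ (1 / 2 : ℝ) with hX
  have hV : ∀ τ, V τ = ((jap (τ + q) ^ (1 / 2 : ℝ) : ℝ) : ℂ) * w τ := by
    intro τ
    rw [hwdef]
    simp only
    rw [← mul_assoc, ← Complex.ofReal_mul, ← Real.rpow_add (jap_pos _)]
    norm_num
  -- The commutator term. The gain ⟨τ+q⟩^{-1/2} and the weight already in `w` combine to ⟨τ+q⟩^{-1},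
  -- so the L¹ part of the Z norm controls it.
  set E : ℝ → ℂ := fun τ => sharpCutoff T (c - τ) *
    (((jap (τ + q) ^ (1 / 2 : ℝ) - X : ℝ) : ℂ) * w τ) with hE
  have hEle : ∀ τ, ‖E τ‖ ≤ ‖((jap (τ + q) ^ (-1 : ℝ) : ℝ) : ℂ) * V τ‖ := by
    intro τ
    rw [hE, hV τ]
    simp only [norm_mul, Complex.norm_real, Real.norm_eq_abs]
    have h1 : ‖sharpCutoff T (c - τ)‖ * |jap (τ + q) ^ (1 / 2 : ℝ) - X|
        ≤ |jap (τ + q) ^ (-1 : ℝ)| * |jap (τ + q) ^ (1 / 2 : ℝ)| := by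
      refine (norm_sharpCutoff_mul_jap_sub_le T c q τ).trans (le_of_eq ?_)
      rw [abs_of_pos (jap_rpow_pos _ _), abs_of_pos (jap_rpow_pos _ _),
        ← Real.rpow_add (jap_pos _)]
      norm_num
    have h2 := mul_le_mul_of_nonneg_right h1 (norm_nonneg (w τ))
    rwa [mul_assoc, mul_assoc] at h2
  have hEm : AEStronglyMeasurable E volume := by
    have c1 := continuous_sharpCutoff T
    have c2 := continuous_jap_rpow (1 / 2)
    have h1 : Continuous fun τ : ℝ => sharpCutoff T (c - τ) := by fun_prop
    have h2 : Continuous fun τ : ℝ => ((jap (τ + q) ^ (1 / 2 : ℝ) - X : ℝ) : ℂ) := by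
      refine Complex.continuous_ofReal.comp ?_
      exact (c2.comp (continuous_id.add continuous_const)).sub continuous_const
    exact h1.aestronglyMeasurable.mul (h2.aestronglyMeasurable.mul hw.1)
  have hEi : Integrable E := hr.mono hEm (ae_of_all _ hEle)
  have split : ∫ τ, sharpCutoff T (c - τ) * V τ
      = (X : ℂ) * (∫ τ, sharpCutoff T (c - τ) * w τ) + ∫ τ, E τ := by
    rw [← integral_const_mul, ← integral_add (hKw.const_mul _) hEi]
    congr 1 with τ
    rw [hE, hV τ]
    push_cast
    ring
  rw [split]
  refine (enorm_add_le _ _).trans (add_le_add ?_ ?_)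
  · rw [enorm_mul, ← ofReal_norm (X : ℂ), Complex.norm_real, Real.norm_of_nonneg (jap_rpow_pos _ _).le]
  · refine (enorm_integral_le_lintegral_enorm _).trans (lintegral_mono fun τ => ?_)
    exact enorm_le_iff_norm_le.2 (hEle τ)

lemma measurable_sharpCutoff_integral (T q : ℝ) {w : ℝ → ℂ} (hw : AEStronglyMeasurable w volume) :
    Measurable fun c => ‖∫ τ, sharpCutoff T (c + q - τ) * w τ‖ₑ := by
  have e : (fun c => ‖∫ τ, sharpCutoff T (c + q - τ) * w τ‖ₑ)
      = fun c => ‖∫ τ, sharpCutoff T (c + q - τ) * hw.mk w τ‖ₑ := by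
    ext c
    congr 1
    refine integral_congr_ae ?_
    filter_upwards [hw.ae_eq_mk] with τ hτ
    rw [hτ]
  rw [e]
  have c1 := continuous_sharpCutoff T
  have h1 : Continuous fun p : ℝ × ℝ => sharpCutoff T (p.1 + q - p.2) := by fun_prop
  have : StronglyMeasurable fun p : ℝ × ℝ => sharpCutoff T (p.1 + q - p.2) * hw.mk w p.2 :=
    h1.stronglyMeasurable.mul (hw.stronglyMeasurable_mk.comp_measurable measurable_snd)
  exact this.integral_prod_right.measurable.enorm

section Fubini

variable {μ : Measure ℝ} [SFinite μ]

/-- Fubini after inserting the inverse transform of `v`. The parameter `θ` is a sign: conjugating a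
factor reverses its time frequency. -/
lemma enorm_integral_mul_le {F h v : ℝ → ℂ} (θ : ℝ) (hF : Integrable F) (hh : Integrable h μ)
    (hv : ∀ᵐ t ∂μ, v t = (kap : ℂ) * ∫ τ : ℝ, Complex.exp (Complex.I * t * ((θ * τ : ℝ) : ℂ)) * F τ) :
    ‖∫ t, v t * h t ∂μ‖ₑ ≤ ∫⁻ τ, ‖F τ‖ₑ *
      ‖∫ t : ℝ, Complex.exp (Complex.I * t * ((θ * τ : ℝ) : ℂ)) * h t ∂μ‖ₑ := by
  have hint : Integrable (fun p : ℝ × ℝ =>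
      Complex.exp (Complex.I * p.1 * ((θ * p.2 : ℝ) : ℂ)) * (h p.1 * F p.2)) (μ.prod volume) := by
    refine (hh.mul_prod hF).bdd_mul (c := 1) (Continuous.aestronglyMeasurable (by fun_prop)) ?_
    exact ae_of_all _ fun p => (norm_exp_I_mul p.1 (θ * p.2)).le
  calc ‖∫ t, v t * h t ∂μ‖ₑ
      = ‖(kap : ℂ) * ∫ t : ℝ, (∫ τ : ℝ,
          Complex.exp (Complex.I * t * ((θ * τ : ℝ) : ℂ)) * (h t * F τ)) ∂μ‖ₑ := by
        rw [← integral_const_mul]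
        refine congrArg _ (integral_congr_ae ?_)
        filter_upwards [hv] with t ht
        rw [ht, mul_assoc, ← integral_mul_const]
        congr 2 with τ
        ring
    _ = ‖(kap : ℂ)‖ₑ * ‖∫ τ : ℝ, F τ * ∫ t : ℝ,
          Complex.exp (Complex.I * t * ((θ * τ : ℝ) : ℂ)) * h t ∂μ‖ₑ := by
        rw [enorm_mul, integral_integral_swap hint]
        congr 3 with τ
        rw [← integral_const_mul]
        congr 1 with t
        ring
    _ ≤ 1 * ∫⁻ τ, ‖F τ * ∫ t : ℝ, Complex.exp (Complex.I * t * ((θ * τ : ℝ) : ℂ)) * h t ∂μ‖ₑ := by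
        gcongr
        · rw [← ofReal_norm, Complex.norm_real, Real.norm_of_nonneg kap_pos.le, ← ENNReal.ofReal_one]
          exact ENNReal.ofReal_le_ofReal (by have := kap_le; have := kap_pos; linarith)
        · exact enorm_integral_le_lintegral_enorm _
    _ = _ := by simp_rw [one_mul, enorm_mul]

end Fubini

/-! ### The estimate for a single frequency quadruple -/

section Triple

variable {μ : Measure ℝ}

lemma continuous_integral_exp {h : ℝ → ℂ} (hh : Integrable h μ) :
    Continuous fun c : ℝ => ∫ t : ℝ, Complex.exp (Complex.I * t * c) * h t ∂μ := by
  refine continuous_of_dominated (bound := fun t => ‖h t‖) (fun c => ?_) (fun c => ?_) hh.norm ?_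
  · exact (Continuous.aestronglyMeasurable (by fun_prop)).mul hh.1
  · exact ae_of_all _ fun t => by rw [norm_mul, norm_exp_I_mul, one_mul]
  · exact ae_of_all _ fun t => by fun_prop

lemma integrable_rep_mul {F h v : ℝ → ℂ} (hF : Integrable F) (hh : Integrable h μ)
    (hv : ∀ᵐ t ∂μ, v t = (kap : ℂ) * ∫ τ : ℝ, Complex.exp (Complex.I * t * τ) * F τ) :
    Integrable (fun t => v t * h t) μ := by
  have hc : Continuous fun t : ℝ => (kap : ℂ) * ∫ τ : ℝ, Complex.exp (Complex.I * t * τ) * F τ := by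
    have := (continuous_integral_exp hF).const_mul (kap : ℂ)
    refine this.congr fun t => ?_
    congr 2 with τ
    rw [mul_right_comm]
  have hi := hh.bdd_mul (c := kap * ∫ τ, ‖F τ‖) hc.aestronglyMeasurable (ae_of_all _ fun t => ?_)
  · refine hi.congr ?_
    filter_upwards [hv] with t ht
    rw [ht]
  · rw [norm_mul, Complex.norm_real, Real.norm_of_nonneg kap_pos.le]
    refine mul_le_mul_of_nonneg_left ?_ kap_pos.le
    refine (norm_integral_le_integral_norm _).trans (le_of_eq ?_)
    congr 1 with τ
    rw [norm_mul, norm_exp_I_mul, one_mul]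

lemma integrable_conj {f : ℝ → ℂ} (hf : Integrable f μ) : Integrable (fun t => conj (f t)) μ :=
  (LipschitzWith.integrable_comp_iff_of_antilipschitz (g := fun z : ℂ => conj z)
    Complex.isometry_conj.lipschitz Complex.isometry_conj.antilipschitz (map_zero _)).2 hf

lemma conj_rep {F v : ℝ → ℂ}
    (hv : ∀ᵐ t ∂μ, v t = (kap : ℂ) * ∫ τ : ℝ, Complex.exp (Complex.I * t * τ) * F τ) :
    ∀ᵐ t ∂μ, conj (v t) = (kap : ℂ) *
      ∫ τ : ℝ, Complex.exp (Complex.I * t * (((-1 : ℝ) * τ : ℝ) : ℂ)) * conj (F τ) := by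
  filter_upwards [hv] with t ht
  rw [ht, map_mul, Complex.conj_ofReal, ← integral_conj]
  congr 2 with τ
  rw [map_mul, ← Complex.exp_conj]
  simp only [map_mul, Complex.conj_I, Complex.conj_ofReal]
  push_cast
  congr 2
  ring

/-- The previous Fubini step is applied to each of the three factors in turn, so that only the
transform of `h` at τ₁ - τ₂ + τ₃ remains. -/
lemma enorm_integral_triple_le [SFinite μ] {F₁ F₂ F₃ h v₁ v₂ v₃ : ℝ → ℂ} (h₁ : Integrable F₁)
    (h₂ : Integrable F₂) (h₃ : Integrable F₃) (m₁ : Measurable F₁) (m₂ : Measurable F₂)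
    (m₃ : Measurable F₃) (hh : Integrable h μ)
    (r₁ : ∀ᵐ t ∂μ, v₁ t = (kap : ℂ) * ∫ τ : ℝ, Complex.exp (Complex.I * t * τ) * F₁ τ)
    (r₂ : ∀ᵐ t ∂μ, v₂ t = (kap : ℂ) * ∫ τ : ℝ, Complex.exp (Complex.I * t * τ) * F₂ τ)
    (r₃ : ∀ᵐ t ∂μ, v₃ t = (kap : ℂ) * ∫ τ : ℝ, Complex.exp (Complex.I * t * τ) * F₃ τ) :
    ‖∫ t, v₁ t * (conj (v₂ t) * (v₃ t * h t)) ∂μ‖ₑ ≤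
      ∫⁻ p : ℝ × ℝ × ℝ, ‖F₁ p.1‖ₑ * ‖F₂ p.2.1‖ₑ * ‖F₃ p.2.2‖ₑ *
        ‖∫ t : ℝ, Complex.exp (Complex.I * t * ((p.1 - p.2.1 + p.2.2 : ℝ) : ℂ)) * h t ∂μ‖ₑ := by
  set H : ℝ → ℝ≥0∞ := fun c => ‖∫ t : ℝ, Complex.exp (Complex.I * t * c) * h t ∂μ‖ₑ with hH
  have hHm : Measurable H := (continuous_integral_exp hh).enorm.measurable
  have i3 : Integrable (fun t => v₃ t * h t) μ := integrable_rep_mul h₃ hh r₃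
  have hexp : ∀ (c : ℝ) {g : ℝ → ℂ}, Integrable g μ →
      Integrable (fun t : ℝ => Complex.exp (Complex.I * t * c) * g t) μ := fun c g hg =>
    hg.bdd_mul (c := 1) (Continuous.aestronglyMeasurable (by fun_prop))
      (ae_of_all _ fun t => (norm_exp_I_mul t c).le)
  have i2 : Integrable (fun t => conj (v₂ t) * (v₃ t * h t)) μ := by
    have := integrable_rep_mul h₂ (integrable_conj i3) r₂
    have := integrable_conj this
    refine this.congr (ae_of_all _ fun t => ?_)
    simp
  have r₁' : ∀ᵐ t ∂μ, v₁ t = (kap : ℂ) *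
      ∫ τ : ℝ, Complex.exp (Complex.I * t * (((1 : ℝ) * τ : ℝ) : ℂ)) * F₁ τ := by simpa using r₁
  have r₃' : ∀ᵐ t ∂μ, v₃ t = (kap : ℂ) *
      ∫ τ : ℝ, Complex.exp (Complex.I * t * (((1 : ℝ) * τ : ℝ) : ℂ)) * F₃ τ := by simpa using r₃
  have h₂' : Integrable fun τ => conj (F₂ τ) := integrable_conj h₂
  have inner : ∀ x y : ℝ, ‖∫ t : ℝ, v₃ t * (Complex.exp (Complex.I * t * y) *
      (Complex.exp (Complex.I * t * x) * h t)) ∂μ‖ₑ ≤ ∫⁻ z, ‖F₃ z‖ₑ * H (x + y + z) := by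
    intro x y
    refine (enorm_integral_mul_le 1 h₃ (hexp y (hexp x hh)) r₃').trans (le_of_eq ?_)
    refine lintegral_congr fun z => ?_
    rw [hH]
    congr 2
    refine integral_congr_ae (ae_of_all _ fun t => ?_)
    simp only
    rw [← mul_assoc, ← mul_assoc, ← Complex.exp_add, ← Complex.exp_add]
    congr 2
    push_cast
    ring
  have middle : ∀ x : ℝ, ‖∫ t : ℝ, conj (v₂ t) * (Complex.exp (Complex.I * t * x) *
      (v₃ t * h t)) ∂μ‖ₑ ≤ ∫⁻ y, ‖F₂ y‖ₑ * ∫⁻ z, ‖F₃ z‖ₑ * H (x - y + z) := by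
    intro x
    refine (enorm_integral_mul_le (-1) h₂' (hexp x i3) (conj_rep r₂)).trans
      (lintegral_mono fun y => ?_)
    refine mul_le_mul' (le_of_eq (by simp)) ?_
    refine le_trans (le_of_eq ?_) ((inner x (-1 * y)).trans (le_of_eq ?_))
    · congr 1
      refine integral_congr_ae (ae_of_all _ fun t => ?_)
      simp only
      ring
    · simp only [neg_mul, one_mul, ← sub_eq_add_neg]
  calc ‖∫ t, v₁ t * (conj (v₂ t) * (v₃ t * h t)) ∂μ‖ₑ
      ≤ ∫⁻ x, ‖F₁ x‖ₑ * ∫⁻ y, ‖F₂ y‖ₑ * ∫⁻ z, ‖F₃ z‖ₑ * H (x - y + z) := by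
        refine (enorm_integral_mul_le 1 h₁ i2 r₁').trans (lintegral_mono fun x => ?_)
        refine mul_le_mul_right (le_trans (le_of_eq ?_) (middle x)) _
        congr 1
        refine integral_congr_ae (ae_of_all _ fun t => ?_)
        simp only [one_mul]
        ring
    _ = ∫⁻ p : ℝ × ℝ × ℝ, ‖F₁ p.1‖ₑ * ‖F₂ p.2.1‖ₑ * ‖F₃ p.2.2‖ₑ * H (p.1 - p.2.1 + p.2.2) := by
        rw [Measure.volume_eq_prod, lintegral_prod _ (by fun_prop)]
        refine lintegral_congr fun x => ?_
        rw [Measure.volume_eq_prod, lintegral_prod _ (by fun_prop),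
          ← lintegral_const_mul _ (by fun_prop)]
        refine lintegral_congr fun y => ?_
        rw [← lintegral_const_mul _ (by fun_prop), ← lintegral_const_mul _ (by fun_prop)]
        refine lintegral_congr fun z => ?_
        ring

end Triple

lemma lintegral_triple_sub (f : ℝ × ℝ × ℝ → ℝ≥0∞) (a b c : ℝ) :
    ∫⁻ p : ℝ × ℝ × ℝ, f (p.1 - a, p.2.1 - b, p.2.2 - c) = ∫⁻ p, f p := by
  have : (volume : Measure (ℝ × ℝ)).IsAddHaarMeasure := by
    rw [Measure.volume_eq_prod]
    exact Measure.prod.instIsAddHaarMeasure _ _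
  have : (volume : Measure (ℝ × ℝ × ℝ)).IsAddHaarMeasure := by
    rw [Measure.volume_eq_prod]
    exact Measure.prod.instIsAddHaarMeasure _ _
  rw [← lintegral_add_left_eq_self f ((-a, -b, -c) : ℝ × ℝ × ℝ)]
  congr 1 with p
  simp only [Prod.add_def]
  congr 1
  simp [sub_eq_neg_add]

lemma xNorm_eq_hNorm (q : ℝ≥0∞) (a b : ℝ) (U : ℝ → ℤ → ℂ) :
    xNorm 2 q a b U = hNorm a fun ξ =>
      eLpNorm (fun τ : ℝ => ((jap (τ + (ξ : ℝ) ^ 2) ^ b : ℝ) : ℂ) * U τ ξ) q volume := by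
  rw [xNorm, eLpNorm_two_eq, lintegral_count, hNorm]
  rfl

lemma ne_top_of_hNorm_ne_top {a : ℝ} {c : ℤ → ℝ≥0∞} (h : hNorm a c ≠ ∞) (ξ : ℤ) : c ξ ≠ ∞ := by
  intro hc
  apply h
  have h1 : (∑' ξ : ℤ, (ENNReal.ofReal (jap ξ ^ a) * c ξ) ^ 2) = ∞ := by
    refine top_le_iff.1 (le_trans (le_of_eq ?_) (ENNReal.le_tsum ξ))
    rw [hc, ENNReal.mul_top (by simpa using jap_rpow_pos _ _)]
    simp
  rw [hNorm, h1]
  simp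

lemma enorm_ofReal_mul {x : ℝ} (hx : 0 ≤ x) (z : ℂ) :
    ‖(x : ℂ) * z‖ₑ = ENNReal.ofReal x * ‖z‖ₑ := by
  rw [enorm_mul, ← ofReal_norm (x : ℂ), Complex.norm_real, Real.norm_of_nonneg hx]

/-- The modulation profile of `F`. -/
def profile (F : ℝ → ℤ → ℂ) (ξ : ℤ) (σ : ℝ) : ℝ≥0∞ := ‖F (σ - (ξ : ℝ) ^ 2) ξ‖ₑ

lemma modNorm_profile (a : ℝ) (F : ℝ → ℤ → ℂ) : modNorm a (profile F) = yNorm a F := by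
  rw [yNorm, xNorm_eq_hNorm, xNorm_eq_hNorm, modNorm]
  congr 2
  · ext ξ
    rw [eLpNorm_two_eq, ← lintegral_add_right_eq_self _ ((ξ : ℝ) ^ 2)]
    congr 2 with σ
    rw [enorm_ofReal_mul (jap_rpow_pos _ _).le, profile, add_sub_cancel_right]
  · ext ξ
    rw [eLpNorm_one_eq_lintegral_enorm, ← lintegral_add_right_eq_self _ ((ξ : ℝ) ^ 2)]
    congr 1 with σ
    simp [profile]

/-! ### The quadrilinear estimate in Fourier variables -/

lemma jap_weight_aestronglyMeasurable (b q : ℝ) {f : ℝ → ℂ} (hf : AEStronglyMeasurable f volume) :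
    AEStronglyMeasurable (fun τ => ((jap (τ + q) ^ b : ℝ) : ℂ) * f τ) volume := by
  have h : Continuous fun τ : ℝ => ((jap (τ + q) ^ b : ℝ) : ℂ) :=
    Complex.continuous_ofReal.comp ((continuous_jap_rpow b).comp (by fun_prop))
  exact h.aestronglyMeasurable.mul hf

lemma eLpNorm_ne_top_of_xNorm {q : ℝ≥0∞} {a b : ℝ} {U : ℝ → ℤ → ℂ} (h : xNorm 2 q a b U ≠ ∞) (ξ : ℤ) :
    eLpNorm (fun τ : ℝ => ((jap (τ + (ξ : ℝ) ^ 2) ^ b : ℝ) : ℂ) * U τ ξ) q volume ≠ ∞ := by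
  rw [xNorm_eq_hNorm] at h
  exact ne_top_of_hNorm_ne_top h ξ

/-- On `[0, T]` the functions `v(·, ξ)` are the inverse transforms of the integrable functions
`F(·, ξ)`, whose `Y^a` norm is finite. -/
structure YData (a T : ℝ) (v F : ℝ → ℤ → ℂ) : Prop where
  measurable : ∀ ξ, Measurable fun τ => F τ ξ
  integrable : ∀ ξ, Integrable fun τ => F τ ξ
  rep : ∀ ξ, ∀ᵐ t ∂(volume.restrict (Set.Ioc 0 T)),
    v t ξ = (kap : ℂ) * ∫ τ : ℝ, Complex.exp (Complex.I * t * τ) * F τ ξ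
  norm_ne_top : yNorm a F ≠ ∞

/-- The transforms of the functions `v(·, y)` cut off to `[0, T]` are given by `V(·, y)`, whose `Z^a`
norm is finite. -/
structure ZData (a T : ℝ) (v V : ℝ → ℤ → ℂ) : Prop where
  integrable : ∀ y, Integrable (fun t => v t y) (volume.restrict (Set.Ioc 0 T))
  hNorm_ne_top : hNorm 0 (fun y => ∫⁻ t in Set.Ioc 0 T, ‖v t y‖ₑ) ≠ ∞
  rel : ∀ (y : ℤ) (c : ℝ), ∫ t in (0 : ℝ)..T, Complex.exp (-(Complex.I * c * t)) * v t y
    = ∫ τ, sharpCutoff T (c - τ) * V τ y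
  aestronglyMeasurable : ∀ y, AEStronglyMeasurable (fun τ => V τ y) volume
  norm_ne_top : zNorm a V ≠ ∞

/-- The transform of the time-localised function with multiplier `⟨τ + y²⟩^{-1/2}`. -/
def sampled (T : ℝ) (V : ℝ → ℤ → ℂ) (y : ℤ) (c : ℝ) : ℝ≥0∞ :=
  ‖∫ τ, sharpCutoff T (c + -((y : ℝ) ^ 2) - τ)
    * (((jap (τ + (y : ℝ) ^ 2) ^ (-1 / 2 : ℝ) : ℝ) : ℂ) * V τ y)‖ₑ

/-- The summand of the quadrilinear form in the variables `y = -ξ₄`, `m = ξ₁ + ξ₄`, `n = ξ₃ + ξ₄`. -/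
def quadIntegrand (s : ℝ) (v₁ v₂ v₃ v₄ : ℝ → ℤ → ℂ) (y m n : ℤ) (t : ℝ) : ℂ :=
  (symb s y m n : ℂ) *
    (v₁ t (y + m) * (conj (v₂ t (y + m + n)) * (v₃ t (y + n) * conj (v₄ t y))))

section

variable {a T : ℝ} {v₁ v₂ v₃ v₄ F₁ F₂ F₃ V : ℝ → ℤ → ℂ}

lemma ZData.memLp (h : ZData a T v₄ V) (y : ℤ) :
    MemLp (fun τ => ((jap (τ + (y : ℝ) ^ 2) ^ (-1 / 2 : ℝ) : ℝ) : ℂ) * V τ y) 2 volume :=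
  ⟨jap_weight_aestronglyMeasurable _ _ (h.aestronglyMeasurable y),
    (eLpNorm_ne_top_of_xNorm (ENNReal.add_ne_top.1 h.norm_ne_top).1 y).lt_top⟩

lemma ZData.integrable_weight (h : ZData a T v₄ V) (y : ℤ) :
    Integrable (fun τ => ((jap (τ + (y : ℝ) ^ 2) ^ (-1 : ℝ) : ℝ) : ℂ) * V τ y) :=
  memLp_one_iff_integrable.1 ⟨jap_weight_aestronglyMeasurable _ _ (h.aestronglyMeasurable y),
    (eLpNorm_ne_top_of_xNorm (ENNReal.add_ne_top.1 h.norm_ne_top).2 y).lt_top⟩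

lemma ZData.enorm_integral_conj_le (h : ZData a T v₄ V) (hT : 0 ≤ T) (hT' : T ≤ 1) (y : ℤ) (c : ℝ) :
    ‖∫ t in Set.Ioc 0 T, Complex.exp (Complex.I * t * ((c - (y : ℝ) ^ 2 : ℝ) : ℂ)) * conj (v₄ t y)‖ₑ
      ≤ ENNReal.ofReal (jap c ^ (1 / 2 : ℝ)) * sampled T V y c
        + ∫⁻ τ, ‖((jap (τ + (y : ℝ) ^ 2) ^ (-1 : ℝ) : ℝ) : ℂ) * V τ y‖ₑ := by
  have e : ∫ t in Set.Ioc 0 T, Complex.exp (Complex.I * t * ((c - (y : ℝ) ^ 2 : ℝ) : ℂ)) * conj (v₄ t y)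
      = conj (∫ τ, sharpCutoff T (c - (y : ℝ) ^ 2 - τ) * V τ y) := by
    rw [← h.rel, intervalIntegral.integral_of_le hT, ← integral_conj]
    congr 1 with t
    rw [map_mul, ← Complex.exp_conj]
    simp only [map_mul, map_neg, Complex.conj_I, Complex.conj_ofReal]
    congr 2
    ring
  have h2 := enorm_integral_sharpCutoff_le hT hT' ((y : ℝ) ^ 2) (c - (y : ℝ) ^ 2) (h.memLp y)
    (h.integrable_weight y)
  rw [sub_add_cancel] at h2
  rw [e, RCLike.enorm_conj]
  simpa only [sampled, ← sub_eq_add_neg] using h2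

lemma enorm_integral_quadIntegrand_le {s : ℝ} (h₁ : YData a T v₁ F₁) (h₂ : YData a T v₂ F₂)
    (h₃ : YData a T v₃ F₃) (h₄ : ZData a T v₄ V) (hT : 0 ≤ T) (hT' : T ≤ 1) (y m n : ℤ) :
    ‖∫ t in Set.Ioc 0 T, quadIntegrand s v₁ v₂ v₃ v₄ y m n t‖ₑ ≤ ENNReal.ofReal |symb s y m n| *
      ∫⁻ p : ℝ × ℝ × ℝ, profile F₁ (y + m) p.1 * profile F₂ (y + m + n) p.2.1
        * profile F₃ (y + n) p.2.2 *
          (ENNReal.ofReal (jap (p.1 - p.2.1 + p.2.2 + 2 * (m * n : ℤ)) ^ (1 / 2 : ℝ))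
            * sampled T V y (p.1 - p.2.1 + p.2.2 + 2 * (m * n : ℤ))
          + ∫⁻ τ, ‖((jap (τ + (y : ℝ) ^ 2) ^ (-1 : ℝ) : ℝ) : ℂ) * V τ y‖ₑ) := by
  unfold quadIntegrand
  rw [integral_const_mul, enorm_mul, ← ofReal_norm (symb s y m n : ℂ), Complex.norm_real,
    Real.norm_eq_abs]
  refine mul_le_mul_right ?_ _
  have hc : Integrable (fun t => conj (v₄ t y)) (volume.restrict (Set.Ioc 0 T)) :=
    integrable_conj (h₄.integrable y)
  refine (enorm_integral_triple_le (h₁.integrable (y + m)) (h₂.integrable (y + m + n))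
    (h₃.integrable (y + n)) (h₁.measurable _) (h₂.measurable _) (h₃.measurable _) hc
    (h₁.rep _) (h₂.rep _) (h₃.rep _)).trans ?_
  -- Passage from time frequencies to modulations. The resonance enters through (y+m+n)² - (y+m)² -
  -- (y+n)² + y² = 2mn, checked by the final `ring`.
  rw [← lintegral_triple_sub _ (((y + m : ℤ) : ℝ) ^ 2) (((y + m + n : ℤ) : ℝ) ^ 2)
    (((y + n : ℤ) : ℝ) ^ 2)]
  refine lintegral_mono fun p => ?_
  simp only [profile]
  refine mul_le_mul_right (le_trans (le_of_eq ?_) (h₄.enorm_integral_conj_le hT hT' y _)) _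
  congr 1
  refine integral_congr_ae (ae_of_all _ fun t => ?_)
  simp only
  congr 4
  push_cast
  ring

lemma ZData.tsum_sampled_sq_le (h : ZData a T v₄ V) (hT : 0 ≤ T) (hT' : T ≤ 1) (y : ℤ) (c : ℝ) :
    ∑' k : ℤ, sampled T V y (2 * k + c) ^ 2 ≤ (2 *
      eLpNorm (fun τ => ((jap (τ + (y : ℝ) ^ 2) ^ (-1 / 2 : ℝ) : ℝ) : ℂ) * V τ y) 2 volume) ^ 2 := by
  have := tsum_sharpCutoff_sq_le (h.memLp y) hT hT' (c + -((y : ℝ) ^ 2))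
  simpa only [sampled, add_assoc] using this

lemma YData.enorm_le (h : YData a T v₁ F₁) (ξ : ℤ) :
    ∀ᵐ t ∂(volume.restrict (Set.Ioc 0 T)), ‖v₁ t ξ‖ₑ ≤ ∫⁻ τ, ‖F₁ τ ξ‖ₑ := by
  filter_upwards [h.rep ξ] with t ht
  rw [ht, enorm_ofReal_mul kap_pos.le]
  calc _ ≤ 1 * ∫⁻ τ, ‖F₁ τ ξ‖ₑ := by
        refine mul_le_mul' ?_ ((enorm_integral_le_lintegral_enorm _).trans (le_of_eq ?_))
        · rw [← ENNReal.ofReal_one]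
          exact ENNReal.ofReal_le_ofReal (by have := kap_le; have := kap_pos; linarith)
        · refine lintegral_congr fun τ => ?_
          rw [enorm_mul, ← ofReal_norm (Complex.exp _), norm_exp_I_mul, ENNReal.ofReal_one, one_mul]
    _ = _ := one_mul _

lemma YData.hNorm_le (_ : YData a T v₁ F₁) : hNorm a (fun ξ => ∫⁻ τ, ‖F₁ τ ξ‖ₑ) ≤ yNorm a F₁ := by
  refine le_trans (le_of_eq ?_) le_add_self
  rw [xNorm_eq_hNorm]
  congr 1
  ext ξ
  rw [eLpNorm_one_eq_lintegral_enorm]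
  simp

/-- A qualitative bound with absolute values inside the integral. The L¹_τ norms bound the first
three factors uniformly in time. The time integral of the fourth is known to be finite but is not
part of the quantitative estimate; the bound serves absolute convergence and Fubini. -/
lemma lintegral_quadIntegrand_le {s : ℝ} (h₁ : YData a T v₁ F₁) (h₂ : YData a T v₂ F₂)
    (h₃ : YData a T v₃ F₃) (y m n : ℤ) :
    ∫⁻ t in Set.Ioc 0 T, ‖quadIntegrand s v₁ v₂ v₃ v₄ y m n t‖ₑ ≤ ENNReal.ofReal |symb s y m n| *
      ((∫⁻ τ, ‖F₁ τ (y + m)‖ₑ) * (∫⁻ τ, ‖F₂ τ (y + m + n)‖ₑ) * (∫⁻ τ, ‖F₃ τ (y + n)‖ₑ)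
        * ∫⁻ t in Set.Ioc 0 T, ‖v₄ t y‖ₑ) := by
  have f₁ : ∫⁻ τ, ‖F₁ τ (y + m)‖ₑ ≠ ∞ := (h₁.integrable _).2.ne
  have f₂ : ∫⁻ τ, ‖F₂ τ (y + m + n)‖ₑ ≠ ∞ := (h₂.integrable _).2.ne
  have f₃ : ∫⁻ τ, ‖F₃ τ (y + n)‖ₑ ≠ ∞ := (h₃.integrable _).2.ne
  rw [← lintegral_const_mul' _ _ (by finiteness), ← lintegral_const_mul' _ _ (by finiteness)]
  refine lintegral_mono_ae ?_
  filter_upwards [h₁.enorm_le (y + m), h₂.enorm_le (y + m + n), h₃.enorm_le (y + n)] with t e₁ e₂ e₃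
  rw [quadIntegrand, enorm_mul, ← ofReal_norm (symb s y m n : ℂ), Complex.norm_real,
    Real.norm_eq_abs, enorm_mul, enorm_mul, enorm_mul, RCLike.enorm_conj, RCLike.enorm_conj]
  refine mul_le_mul_right ?_ _
  rw [← mul_assoc, ← mul_assoc]
  gcongr

end

/-- The quadrilinear estimate in Fourier variables, together with absolute convergence. -/
theorem exists_quadIntegrand_bound {a ε s : ℝ} (hε : 0 < ε) (hε' : ε ≤ 1 / 2) (hs : 0 < s)
    (hs' : s < 1 / 2) (ha : a ≤ 1 / 2) (ha0 : 0 < a)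
    (h1 : 1 + 2 * ε ≤ 4 * a) (h2 : 2 + 4 * ε ≤ 6 * a + 2 * (1 - 2 * s)) :
    ∃ K : ℝ≥0∞, K ≠ ∞ ∧ ∀ T : ℝ, 0 ≤ T → T ≤ 1 → ∀ v₁ v₂ v₃ v₄ F₁ F₂ F₃ V : ℝ → ℤ → ℂ,
      YData a T v₁ F₁ → YData a T v₂ F₂ → YData a T v₃ F₃ → ZData a T v₄ V →
      ∑' (y : ℤ) (m : ℤ) (n : ℤ), ∫⁻ t in Set.Ioc 0 T, ‖quadIntegrand s v₁ v₂ v₃ v₄ y m n t‖ₑ ≠ ∞ ∧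
      ∑' (y : ℤ) (m : ℤ) (n : ℤ), ‖∫ t in Set.Ioc 0 T, quadIntegrand s v₁ v₂ v₃ v₄ y m n t‖ₑ
        ≤ K * (zNorm a V * (yNorm a F₁ * yNorm a F₂ * yNorm a F₃)) := by
  obtain ⟨K₁, hK₁, fixed⟩ := exists_fixed_time_bound hε hs hs' h1 h2
  obtain ⟨K₂, hK₂, multi⟩ := exists_multilinear_bound hε hε' hs hs' ha ha0 h1 h2
  refine ⟨2 * K₂, by finiteness, ?_⟩
  intro T hT hT' v₁ v₂ v₃ v₄ F₁ F₂ F₃ V d₁ d₂ d₃ d₄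
  constructor
  · refine ne_top_of_le_ne_top ?_ (le_trans (ENNReal.tsum_le_tsum fun y => ENNReal.tsum_le_tsum
      fun m => ENNReal.tsum_le_tsum fun n => lintegral_quadIntegrand_le d₁ d₂ d₃ y m n)
      (fixed (fun ξ => ∫⁻ τ, ‖F₁ τ ξ‖ₑ) (fun ξ => ∫⁻ τ, ‖F₂ τ ξ‖ₑ) (fun ξ => ∫⁻ τ, ‖F₃ τ ξ‖ₑ)
        (fun y => ∫⁻ t in Set.Ioc 0 T, ‖v₄ t y‖ₑ)))
    have n₁ := ne_top_of_le_ne_top d₁.norm_ne_top d₁.hNorm_le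
    have n₂ := ne_top_of_le_ne_top d₂.norm_ne_top d₂.hNorm_le
    have n₃ := ne_top_of_le_ne_top d₃.norm_ne_top d₃.hNorm_le
    have n₄ := d₄.hNorm_ne_top
    finiteness
  · have mprof : ∀ {v F : ℝ → ℤ → ℂ}, YData a T v F → ∀ ξ, Measurable (profile F ξ) := by
      intro v F d ξ
      exact ((d.measurable ξ).comp (by fun_prop : Measurable fun σ : ℝ => σ - (ξ : ℝ) ^ 2)).enorm
    refine le_trans (ENNReal.tsum_le_tsum fun y => ENNReal.tsum_le_tsum fun m =>
      ENNReal.tsum_le_tsum fun n => enorm_integral_quadIntegrand_le d₁ d₂ d₃ d₄ hT hT' y m n)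
      (le_trans (multi (profile F₁) (profile F₂) (profile F₃) (sampled T V)
        (fun y => ∫⁻ τ, ‖((jap (τ + (y : ℝ) ^ 2) ^ (-1 : ℝ) : ℝ) : ℂ) * V τ y‖ₑ)
        (fun y => 2 *
          eLpNorm (fun τ => ((jap (τ + (y : ℝ) ^ 2) ^ (-1 / 2 : ℝ) : ℝ) : ℂ) * V τ y) 2 volume)
        (mprof d₁) (mprof d₂) (mprof d₃)
        (fun y => measurable_sharpCutoff_integral T _ (d₄.memLp y).1)
        (d₄.tsum_sampled_sq_le hT hT')) ?_)
    rw [modNorm_profile, modNorm_profile, modNorm_profile, hNorm_const_mul]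
    have hz : 2 * hNorm a (fun y : ℤ =>
          eLpNorm (fun τ => ((jap (τ + (y : ℝ) ^ 2) ^ (-1 / 2 : ℝ) : ℝ) : ℂ) * V τ y) 2 volume)
        + hNorm a (fun y : ℤ => ∫⁻ τ, ‖((jap (τ + (y : ℝ) ^ 2) ^ (-1 : ℝ) : ℝ) : ℂ) * V τ y‖ₑ)
        ≤ 2 * zNorm a V := by
      rw [zNorm, xNorm_eq_hNorm, xNorm_eq_hNorm, mul_add]
      simp_rw [eLpNorm_one_eq_lintegral_enorm]
      refine add_le_add_right ?_ _
      exact le_mul_of_one_le_left' (by norm_num)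
    calc _ ≤ K₂ * (yNorm a F₁ * yNorm a F₂ * yNorm a F₃ * (2 * zNorm a V)) := by gcongr
      _ = _ := by ring

/-! ### Summation over the frequencies -/

lemma xFT_bar (u : ℝ → Torus → ℂ) (t : ℝ) (ξ : ℤ) : xFT (bar u) t ξ = conj (xFT u t (-ξ)) := by
  unfold xFT bar
  rw [map_mul, Complex.conj_ofReal, intervalIntegral.integral_of_le Real.two_pi_pos.le,
    intervalIntegral.integral_of_le Real.two_pi_pos.le, ← integral_conj]
  congr 2 with x
  rw [map_mul, ← Complex.exp_conj]
  simp only [map_mul, map_neg, Complex.conj_I, Complex.conj_ofReal, map_intCast]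
  push_cast
  congr 2
  ring

lemma quadTerm_eq (s : ℝ) (u₁ u₂ u₃ u₄ : ℝ → Torus → ℂ) (t : ℝ) (ξ : Gamma4) :
    quadTerm s u₁ u₂ u₃ u₄ t ξ = quadIntegrand s (xFT u₁) (xFT u₂) (xFT u₃) (xFT u₄)
      (-ξ.1 3) (ξ.1 0 + ξ.1 3) (ξ.1 2 + ξ.1 3) t := by
  have h := ξ.2.1
  have hr : (ξ.1 1 : ℝ) = -(ξ.1 0 + ξ.1 2 + ξ.1 3) := by
    have : ξ.1 1 = -(ξ.1 0 + ξ.1 2 + ξ.1 3) := by linarith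
    rw [this]
    push_cast
    ring
  have hM : M4 s ξ.1 = symb s (-ξ.1 3 : ℤ) (ξ.1 0 + ξ.1 3 : ℤ) (ξ.1 2 + ξ.1 3 : ℤ) := by
    unfold M4 symb
    push_cast
    rw [hr, show (-(ξ.1 3 : ℝ) + (ξ.1 2 + ξ.1 3)) = ξ.1 2 by ring,
      show (-(ξ.1 3 : ℝ) + (ξ.1 0 + ξ.1 3)) = ξ.1 0 by ring,
      show (ξ.1 0 + (ξ.1 2 + ξ.1 3) : ℝ) = ξ.1 0 + ξ.1 2 + ξ.1 3 by ring, jap_neg, jap_neg]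
    congr 1
    ring
  rw [quadTerm, quadIntegrand, hM, xFT_bar, xFT_bar,
    show -ξ.1 3 + (ξ.1 0 + ξ.1 3) + (ξ.1 2 + ξ.1 3) = -ξ.1 1 by linarith,
    show -ξ.1 3 + (ξ.1 0 + ξ.1 3) = ξ.1 0 by ring, show -ξ.1 3 + (ξ.1 2 + ξ.1 3) = ξ.1 2 by ring]
  ring

lemma tsum_Gamma4_le (Φ : ℤ → ℤ → ℤ → ℝ≥0∞) :
    ∑' ξ : Gamma4, Φ (-ξ.1 3) (ξ.1 0 + ξ.1 3) (ξ.1 2 + ξ.1 3) ≤ ∑' (y : ℤ) (m : ℤ) (n : ℤ), Φ y m n := by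
  have hinj : Function.Injective fun ξ : Gamma4 =>
      ((-ξ.1 3, ξ.1 0 + ξ.1 3, ξ.1 2 + ξ.1 3) : ℤ × ℤ × ℤ) := by
    intro ξ η h
    simp only [Prod.mk.injEq] at h
    have h₁ := ξ.2.1
    have h₂ := η.2.1
    ext i
    fin_cases i <;> simp <;> omega
  have := ENNReal.tsum_comp_le_tsum_of_injective hinj fun q => Φ q.1 q.2.1 q.2.2
  refine this.trans (le_of_eq ?_)
  rw [ENNReal.tsum_prod']
  exact tsum_congr fun y => ENNReal.tsum_prod'

lemma YData.aestronglyMeasurable_left {a T : ℝ} {v F : ℝ → ℤ → ℂ} (h : YData a T v F) (ξ : ℤ) :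
    AEStronglyMeasurable (fun t => v t ξ) (volume.restrict (Set.Ioc 0 T)) := by
  have := integrable_rep_mul (h.integrable ξ)
    (integrable_const (1 : ℂ) (μ := volume.restrict (Set.Ioc 0 T))) (h.rep ξ)
  simpa using this.1

/-- The quadrilinear estimate on the Fourier side of the space variable. -/
theorem exists_quadForm_bound {a ε s : ℝ} (hε : 0 < ε) (hε' : ε ≤ 1 / 2) (hs : 0 < s)
    (hs' : s < 1 / 2) (ha : a ≤ 1 / 2) (ha0 : 0 < a)
    (h1 : 1 + 2 * ε ≤ 4 * a) (h2 : 2 + 4 * ε ≤ 6 * a + 2 * (1 - 2 * s)) :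
    ∃ K : ℝ≥0∞, K ≠ ∞ ∧ ∀ T : ℝ, 0 ≤ T → T ≤ 1 → ∀ (u₁ u₂ u₃ u₄ : ℝ → Torus → ℂ)
      (F₁ F₂ F₃ V : ℝ → ℤ → ℂ), YData a T (xFT u₁) F₁ → YData a T (xFT u₂) F₂ →
      YData a T (xFT u₃) F₃ → ZData a T (xFT u₄) V →
      (∀ᵐ t ∂(volume.restrict (Set.Icc 0 T)), Summable (quadTerm s u₁ u₂ u₃ u₄ t)) ∧
      IntervalIntegrable (quadSum s u₁ u₂ u₃ u₄) volume 0 T ∧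
      ‖quadForm s T u₁ u₂ u₃ u₄‖ₑ ≤ K * (zNorm a V * (yNorm a F₁ * yNorm a F₂ * yNorm a F₃)) := by
  obtain ⟨K, hK, bound⟩ := exists_quadIntegrand_bound hε hε' hs hs' ha ha0 h1 h2
  refine ⟨K, hK, ?_⟩
  intro T hT hT' u₁ u₂ u₃ u₄ F₁ F₂ F₃ V d₁ d₂ d₃ d₄
  obtain ⟨abs, est⟩ := bound T hT hT' _ _ _ _ F₁ F₂ F₃ V d₁ d₂ d₃ d₄
  set μ : Measure ℝ := volume.restrict (Set.Ioc 0 T) with hμ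
  set Q : Gamma4 → ℝ → ℂ := fun ξ t => quadTerm s u₁ u₂ u₃ u₄ t ξ with hQ
  have hQm : ∀ ξ, AEStronglyMeasurable (Q ξ) μ := by
    intro ξ
    simp only [hQ, quadTerm_eq, quadIntegrand]
    have m₁ := d₁.aestronglyMeasurable_left
    have m₂ := d₂.aestronglyMeasurable_left
    have m₃ := d₃.aestronglyMeasurable_left
    have m₄ := fun ξ => (d₄.integrable ξ).1
    exact ((m₁ _).mul ((Complex.continuous_conj.comp_aestronglyMeasurable (m₂ _)).mul
      ((m₃ _).mul (Complex.continuous_conj.comp_aestronglyMeasurable (m₄ _))))).const_mul _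
  have hsum : ∑' ξ, ∫⁻ t, ‖Q ξ t‖ₑ ∂μ ≠ ∞ := by
    refine ne_top_of_le_ne_top abs (le_trans (le_of_eq ?_) (tsum_Gamma4_le _))
    simp only [hQ, quadTerm_eq]
  have hl : ∫⁻ t, ∑' ξ, ‖Q ξ t‖ₑ ∂μ ≠ ∞ := by
    rwa [lintegral_tsum fun ξ => (hQm ξ).enorm]
  have hae : ∀ᵐ t ∂μ, Summable fun ξ => Q ξ t := by
    filter_upwards [ae_lt_top' (AEMeasurable.tsum fun ξ => (hQm ξ).enorm) hl] with t ht
    exact Summable.of_enorm ht.ne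
  have hint : Integrable (fun t => ∑' ξ, Q ξ t) μ :=
    ⟨(AEMeasurable.tsum fun ξ => (hQm ξ).aemeasurable).aestronglyMeasurable,
      (lintegral_mono fun t => enorm_tsum_le_tsum_enorm).trans_lt hl.lt_top⟩
  refine ⟨?_, ?_, ?_⟩
  · rwa [← restrict_Ioc_eq_restrict_Icc]
  · rw [intervalIntegrable_iff_integrableOn_Ioc_of_le hT]
    exact hint
  · rw [quadForm, intervalIntegral.integral_of_le hT]
    unfold quadSum
    rw [integral_tsum hQm hsum]
    refine (enorm_tsum_le_tsum_enorm).trans ?_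
    refine le_trans (le_of_eq ?_) ((tsum_Gamma4_le _).trans est)
    simp only [hQ, quadTerm_eq]

/-! ### Square integrable functions -/

lemma xFT_eq_integral_torus (u : ℝ → Torus → ℂ) (t : ℝ) (ξ : ℤ) :
    xFT u t ξ = (kap : ℂ) * ∫ x : Torus, fourier (-ξ) x * u t x := by
  have h := AddCircle.intervalIntegral_preimage (2 * Real.pi) 0
    (fun x : Torus => fourier (-ξ) x * u t x)
  rw [← h, zero_add, xFT]
  congr 1
  refine intervalIntegral.integral_congr fun x _ => ?_
  rw [fourier_coe_apply]
  congr 2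
  push_cast
  field_simp

lemma tsum_enorm_xFT_sq {u : ℝ → Torus → ℂ} {t : ℝ} (h : MemLp (u t) 2 volume) :
    ∑' ξ : ℤ, ‖xFT u t ξ‖ₑ ^ 2 = ∫⁻ x : Torus, ‖u t x‖ₑ ^ 2 := by
  have hπ : (0 : ℝ) < 2 * Real.pi := Real.two_pi_pos
  set f : ℝ → ℂ := fun x => u t (x : Torus) with hf
  have mp := AddCircle.measurePreserving_mk (2 * Real.pi) 0
  rw [zero_add] at mp
  have hfL : MemLp f 2 (volume.restrict (Set.Ioc 0 (2 * Real.pi))) := h.comp_measurePreserving mp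
  have hcoef : ∀ ξ : ℤ, xFT u t ξ = ((kap * (2 * Real.pi) : ℝ) : ℂ) * fourierCoeffOn hπ f ξ := by
    intro ξ
    rw [fourierCoeffOn_eq_integral, Complex.real_smul, xFT, ← mul_assoc]
    have e : ((kap * (2 * Real.pi) : ℝ) : ℂ) * ((1 / (2 * Real.pi - 0) : ℝ) : ℂ) = (kap : ℂ) := by
      rw [← Complex.ofReal_mul, sub_zero, mul_assoc, mul_one_div_cancel two_pi_ne, mul_one]
    rw [e]
    congr 1
    refine intervalIntegral.integral_congr fun x _ => ?_
    rw [fourier_coe_apply, smul_eq_mul]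
    congr 2
    push_cast
    rw [sub_zero]
    field_simp
  have hsum := hasSum_sq_fourierCoeffOn hπ hfL
  have hk := kap_sq
  calc _ = ∑' ξ : ℤ, ENNReal.ofReal (2 * Real.pi * ‖fourierCoeffOn hπ f ξ‖ ^ 2) := by
        refine tsum_congr fun ξ => ?_
        rw [hcoef, enorm_sq_eq_ofReal, norm_mul, Complex.norm_real,
          Real.norm_of_nonneg (mul_pos kap_pos hπ).le, mul_pow]
        congr 2
        linear_combination (2 * Real.pi) * hk
    _ = ENNReal.ofReal (2 * Real.pi * ((2 * Real.pi - 0)⁻¹ •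
          ∫ x in (0 : ℝ)..(2 * Real.pi), ‖f x‖ ^ 2)) := by
        rw [← ENNReal.ofReal_tsum_of_nonneg (fun _ => by positivity) (hsum.summable.mul_left _),
          tsum_mul_left, hsum.tsum_eq]
    _ = ENNReal.ofReal (∫ x in Set.Ioc (0 : ℝ) (2 * Real.pi), ‖f x‖ ^ 2) := by
        rw [smul_eq_mul, sub_zero, ← mul_assoc, mul_inv_cancel₀ two_pi_ne, one_mul,
          intervalIntegral.integral_of_le hπ.le]
    _ = ∫⁻ x in Set.Ioc (0 : ℝ) (2 * Real.pi), ‖f x‖ₑ ^ 2 := by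
        rw [← eLpNorm_two_sq_eq_ofReal hfL, eLpNorm_two_sq]
    _ = _ := by
        have := AddCircle.lintegral_preimage (2 * Real.pi) 0 fun x : Torus => ‖u t x‖ₑ ^ 2
        rwa [zero_add] at this

section

variable {u : ℝ → Torus → ℂ}

lemma IsL2.aestronglyMeasurable_xFT (h : IsL2 u) (ξ : ℤ) :
    AEStronglyMeasurable (fun t => xFT u t ξ) volume := by
  simp_rw [xFT_eq_integral_torus]
  have hc : Continuous fun p : ℝ × Torus => fourier (-ξ) p.2 :=
    (map_continuous (fourier (-ξ))).comp continuous_snd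
  have : AEStronglyMeasurable (fun p : ℝ × Torus => fourier (-ξ) p.2 * u p.1 p.2)
      ((volume : Measure ℝ).prod (volume : Measure Torus)) := hc.aestronglyMeasurable.mul h.1
  exact this.integral_prod_right'.const_mul _

lemma IsL2.tsum_lintegral_xFT_sq (h : IsL2 u) : ∑' ξ : ℤ, ∫⁻ t, ‖xFT u t ξ‖ₑ ^ 2 ≠ ∞ := by
  rw [← lintegral_tsum fun ξ => (h.aestronglyMeasurable_xFT ξ).enorm.pow_const 2]
  have hfin : ∫⁻ p : ℝ × Torus, ‖u p.1 p.2‖ₑ ^ 2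
      ∂((volume : Measure ℝ).prod (volume : Measure Torus)) ≠ ∞ := by
    rw [← eLpNorm_two_sq (fun p : ℝ × Torus => u p.1 p.2)]
    exact ENNReal.pow_ne_top h.2.ne
  have hm := h.1.enorm.pow_const 2
  rw [lintegral_prod _ hm] at hfin
  have hae : ∀ᵐ t : ℝ, ∑' ξ : ℤ, ‖xFT u t ξ‖ₑ ^ 2 = ∫⁻ x : Torus, ‖u t x‖ₑ ^ 2 := by
    filter_upwards [ae_lt_top' hm.lintegral_prod_right' hfin, h.1.prodMk_left] with t ht ht'
    refine tsum_enorm_xFT_sq ⟨ht', ?_⟩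
    rw [eLpNorm_two_eq]
    exact ENNReal.rpow_lt_top_of_nonneg (by norm_num) ht.ne
  rwa [lintegral_congr_ae hae]

lemma IsL2.memLp_xFT (h : IsL2 u) (ξ : ℤ) : MemLp (fun t => xFT u t ξ) 2 volume := by
  refine ⟨h.aestronglyMeasurable_xFT ξ, ?_⟩
  rw [eLpNorm_two_eq]
  exact ENNReal.rpow_lt_top_of_nonneg (by norm_num)
    (ne_top_of_le_ne_top h.tsum_lintegral_xFT_sq (ENNReal.le_tsum ξ))

lemma aestronglyMeasurable_stFT (u : ℝ → Torus → ℂ) (ξ : ℤ) :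
    AEStronglyMeasurable (fun τ => stFT u τ ξ) volume := aestronglyMeasurable_tFT _

lemma yNorm_congr {a : ℝ} {U W : ℝ → ℤ → ℂ} (h : ∀ ξ, ∀ᵐ τ, U τ ξ = W τ ξ) :
    yNorm a U = yNorm a W := by
  have key : ∀ (q : ℝ≥0∞) (b : ℝ), xNorm 2 q a b U = xNorm 2 q a b W := by
    intro q b
    rw [xNorm_eq_hNorm, xNorm_eq_hNorm]
    congr 1 with ξ
    refine eLpNorm_congr_ae ?_
    filter_upwards [h ξ] with τ hτ
    rw [hτ]
  rw [yNorm, yNorm, key, key]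

/-- The L¹_τ part of the Y norm makes the transform integrable at each frequency, so inversion holds
almost everywhere. Measurable representatives are chosen, which does not change the norm. -/
lemma MemY.exists_yData {a : ℝ} (h : MemY a u) (T : ℝ) :
    ∃ F, YData a T (xFT u) F ∧ yNorm a F = yNorm a (stFT u) := by
  have hm := aestronglyMeasurable_stFT u
  have hint : ∀ ξ, Integrable fun τ => stFT u τ ξ := by
    intro ξ
    refine memLp_one_iff_integrable.1 ⟨hm ξ, ?_⟩
    have := eLpNorm_ne_top_of_xNorm (ENNReal.add_ne_top.1 h.2.ne).2 ξ
    simpa using this.lt_top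
  have hn : yNorm a (fun τ ξ => (hm ξ).mk _ τ) = yNorm a (stFT u) :=
    yNorm_congr fun ξ => (hm ξ).ae_eq_mk.symm
  refine ⟨fun τ ξ => (hm ξ).mk _ τ, ⟨fun ξ => (hm ξ).stronglyMeasurable_mk.measurable,
    fun ξ => (hint ξ).congr (hm ξ).ae_eq_mk, fun ξ => ae_restrict_of_ae ?_, hn ▸ h.2.ne⟩, hn⟩
  filter_upwards [ae_eq_integral_tFT (h.1.memLp_xFT ξ) (hint ξ)] with t ht
  rw [ht]
  congr 1
  refine integral_congr_ae ?_
  filter_upwards [(hm ξ).ae_eq_mk] with τ hτ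
  rw [← hτ]
  rfl

lemma MemZL2.zData {a T : ℝ} (h : MemZL2 a u) (hT : 0 ≤ T) (hT' : T ≤ 1) :
    ZData a T (xFT u) (stFT u) where
  integrable y := ((h.1.memLp_xFT y).restrict (Set.Ioc 0 T)).integrable (by norm_num)
  hNorm_ne_top := by
    -- Cauchy–Schwarz on an interval of length T ≤ 1; Parseval in x then gives square summability in
    -- y.
    have key : ∀ y : ℤ, (∫⁻ t in Set.Ioc 0 T, ‖xFT u t y‖ₑ) ^ 2 ≤ ∫⁻ t, ‖xFT u t y‖ₑ ^ 2 := by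
      intro y
      have hm := (h.1.aestronglyMeasurable_xFT y).enorm.restrict (s := Set.Ioc 0 T)
      have cs := lintegral_mul_le_sqrt (volume.restrict (Set.Ioc 0 T)) hm
        (aemeasurable_const (b := (1 : ℝ≥0∞)))
      simp only [mul_one, one_pow, lintegral_const, one_mul, Measure.restrict_apply_univ,
        Real.volume_Ioc, sub_zero] at cs
      refine (pow_le_pow_left' cs 2).trans ?_
      rw [mul_pow, sqrt_sq_ennreal, sqrt_sq_ennreal]
      refine (mul_le_mul' (setLIntegral_le_lintegral _ _) ?_).trans (le_of_eq (mul_one _))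
      rw [← ENNReal.ofReal_one]
      exact ENNReal.ofReal_le_ofReal hT'
    refine ENNReal.rpow_ne_top_of_nonneg (by norm_num)
      (ne_top_of_le_ne_top h.1.tsum_lintegral_xFT_sq (ENNReal.tsum_le_tsum fun y => ?_))
    simpa using key y
  rel y c := integral_exp_mul_eq (h.1.memLp_xFT y) hT c
  aestronglyMeasurable := aestronglyMeasurable_stFT u
  norm_ne_top := h.2.ne

end

/-! ### Truncations -/

/-- The restriction of `U` to the frequencies `|τ| ≤ R`, `|ξ| ≤ R`. -/
def boxed (U : ℝ → ℤ → ℂ) (R : ℕ) (τ : ℝ) (ξ : ℤ) : ℂ :=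
  if ξ ∈ Finset.Icc (-(R : ℤ)) R then (Set.Ioc (-(R : ℝ)) R).indicator (fun σ => U σ ξ) τ else 0

lemma integral_exp_mul_fourier (ξ k : ℤ) :
    ∫ x in (0 : ℝ)..(2 * Real.pi), Complex.exp (-(Complex.I * x * ξ)) * fourier k (x : Torus)
      = if k = ξ then ((2 * Real.pi : ℝ) : ℂ) else 0 := by
  have e : ∀ x : ℝ, Complex.exp (-(Complex.I * x * ξ)) * fourier k (x : Torus)
      = Complex.exp ((Complex.I * (k - ξ)) * x) := by
    intro x
    rw [fourier_coe_apply, ← Complex.exp_add]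
    congr 1
    push_cast
    field_simp
    ring
  simp_rw [e]
  split_ifs with h
  · subst h
    simp
  · have hne : Complex.I * ((k : ℂ) - ξ) ≠ 0 :=
      mul_ne_zero Complex.I_ne_zero (sub_ne_zero.2 (by exact_mod_cast h))
    rw [integral_exp_mul_complex hne]
    have : Complex.I * ((k : ℂ) - ξ) * ((2 * Real.pi : ℝ) : ℂ) = ((k - ξ : ℤ) : ℂ) * (2 * Real.pi * Complex.I) := by
      push_cast
      ring
    rw [this, Complex.exp_int_mul_two_pi_mul_I]
    simp

lemma continuous_truncation (U : ℝ → ℤ → ℂ) (R : ℕ) (t : ℝ) : Continuous (truncation U R t) := by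
  unfold truncation
  exact continuous_const.mul (continuous_finsetSum _ fun ξ _ =>
    continuous_const.mul (map_continuous (fourier ξ)))

lemma xFT_truncation (U : ℝ → ℤ → ℂ) (R : ℕ) (t : ℝ) (ξ : ℤ) :
    xFT (truncation U R) t ξ
      = (kap : ℂ) * ∫ τ : ℝ, Complex.exp (Complex.I * t * τ) * boxed U R τ ξ := by
  set c : ℤ → ℂ := fun k => ∫ τ in (-(R : ℝ))..(R : ℝ), Complex.exp (Complex.I * t * τ) * U τ k with hc
  have h1 : ∫ τ : ℝ, Complex.exp (Complex.I * t * τ) * boxed U R τ ξ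
      = if ξ ∈ Finset.Icc (-(R : ℤ)) R then c ξ else 0 := by
    unfold boxed
    split_ifs with hξ
    · have hR : -(R : ℝ) ≤ R := neg_le_self (Nat.cast_nonneg R)
      rw [hc]
      simp only
      rw [intervalIntegral.integral_of_le hR, ← integral_indicator measurableSet_Ioc]
      congr 1 with τ
      by_cases hτ : τ ∈ Set.Ioc (-(R : ℝ)) R
      · rw [Set.indicator_of_mem hτ, Set.indicator_of_mem hτ]
      · rw [Set.indicator_of_notMem hτ, Set.indicator_of_notMem hτ, mul_zero]
    · simp
  rw [h1, xFT]
  change (kap : ℂ) * _ = _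
  congr 1
  have e : ∀ x : ℝ, Complex.exp (-(Complex.I * x * ξ)) * truncation U R t (x : Torus)
      = ∑ k ∈ Finset.Icc (-(R : ℤ)) R, ((1 / (2 * Real.pi) : ℝ) : ℂ) * c k *
        (Complex.exp (-(Complex.I * x * ξ)) * fourier k (x : Torus)) := by
    intro x
    rw [truncation, Finset.mul_sum, Finset.mul_sum]
    refine Finset.sum_congr rfl fun k _ => ?_
    rw [hc]
    ring
  simp_rw [e]
  rw [intervalIntegral.integral_finsetSum]
  · simp_rw [intervalIntegral.integral_const_mul, integral_exp_mul_fourier, mul_ite, mul_zero]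
    rw [Finset.sum_ite_eq' (Finset.Icc (-(R : ℤ)) R) ξ]
    split_ifs
    · rw [mul_right_comm, ← Complex.ofReal_mul, one_div_mul_cancel two_pi_ne]
      simp
    · rfl
  · intro k _
    refine Continuous.intervalIntegrable ?_ _ _
    have : Continuous fun x : ℝ => fourier k (x : Torus) :=
      (map_continuous (fourier k)).comp (AddCircle.continuous_mk' _)
    fun_prop

lemma xFT_sub {u w : ℝ → Torus → ℂ} {t : ℝ} (hu : Continuous (u t)) (hw : Continuous (w t)) (ξ : ℤ) :
    xFT (fun t x => u t x - w t x) t ξ = xFT u t ξ - xFT w t ξ := by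
  have hi : ∀ {f : Torus → ℂ}, Continuous f → IntervalIntegrable (fun x : ℝ =>
      Complex.exp (-(Complex.I * x * ξ)) * f (x : Torus)) volume 0 (2 * Real.pi) := by
    intro f hf
    have : Continuous fun x : ℝ => f (x : Torus) := hf.comp (AddCircle.continuous_mk' _)
    exact Continuous.intervalIntegrable (by fun_prop) _ _
  unfold xFT
  rw [← mul_sub, ← intervalIntegral.integral_sub (hi hu) (hi hw)]
  simp_rw [mul_sub]

/-- For finitely many frequencies with integrable transforms, the relation with the cutoff kernel is
Fubini and the ℓ² condition is a finite sum. Truncations and their differences are of this kind. -/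
lemma zData_of_rep {a T : ℝ} (hT : 0 ≤ T) {v W : ℝ → ℤ → ℂ} (S : Finset ℤ)
    (hW : ∀ ξ, Integrable fun τ => W τ ξ) (hS : ∀ ξ ∉ S, ∀ τ, W τ ξ = 0)
    (hv : ∀ t ξ, v t ξ = (kap : ℂ) * ∫ τ : ℝ, Complex.exp (Complex.I * t * τ) * W τ ξ)
    (hn : zNorm a W ≠ ∞) : ZData a T v W := by
  have hint : ∀ y, Integrable (fun t => v t y) (volume.restrict (Set.Ioc 0 T)) := by
    intro y
    have := integrable_rep_mul (hW y) (integrable_const (1 : ℂ) (μ := volume.restrict (Set.Ioc 0 T)))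
      (ae_of_all _ fun t => hv t y)
    simpa using this
  refine ⟨hint, ?_, ?_, fun y => (hW y).1, hn⟩
  · refine ENNReal.rpow_ne_top_of_nonneg (by norm_num) ?_
    rw [tsum_eq_sum (s := S)]
    · refine ENNReal.sum_ne_top.2 fun y _ => ENNReal.pow_ne_top ?_
      exact ENNReal.mul_ne_top ENNReal.ofReal_ne_top (hint y).2.ne
    · intro y hy
      have : ∀ t, v t y = 0 := fun t => by simp [hv, hS y hy]
      simp [this]
  · intro y c
    rw [intervalIntegral.integral_of_le hT]
    have hprod : Integrable (fun p : ℝ × ℝ => Complex.exp (-(Complex.I * c * p.1)) *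
        Complex.exp (Complex.I * p.1 * p.2) * ((1 : ℂ) * W p.2 y))
        ((volume.restrict (Set.Ioc 0 T)).prod volume) := by
      refine ((integrable_const (1 : ℂ)).mul_prod (hW y)).bdd_mul (c := 1)
        (Continuous.aestronglyMeasurable (by fun_prop)) (ae_of_all _ fun p => ?_)
      rw [norm_mul, norm_exp_neg_I_mul, norm_exp_I_mul, one_mul]
    have e1 : ∀ t : ℝ, Complex.exp (-(Complex.I * c * t)) * v t y = (kap : ℂ) *
        ∫ τ : ℝ, Complex.exp (-(Complex.I * c * t)) *
        Complex.exp (Complex.I * t * τ) * ((1 : ℂ) * W τ y) := by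
      intro t
      rw [hv, mul_left_comm, ← integral_const_mul]
      congr 2 with τ
      ring
    simp_rw [e1]
    rw [integral_const_mul, integral_integral_swap hprod, ← integral_const_mul]
    congr 1 with τ
    rw [sharpCutoff, intervalIntegral.integral_of_le hT, mul_assoc, ← integral_mul_const]
    congr 2 with t
    rw [one_mul, ← Complex.exp_add]
    congr 2
    push_cast
    ring

lemma MemZHat.integrable_boxed {a : ℝ} {U : ℝ → ℤ → ℂ} (h : MemZHat a U) (R : ℕ) (ξ : ℤ) :
    Integrable fun τ => boxed U R τ ξ := by
  unfold boxed
  split_ifs with hξ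
  · rw [integrable_indicator_iff measurableSet_Ioc]
    have hr : Integrable (fun τ => ((jap (τ + (ξ : ℝ) ^ 2) ^ (-1 : ℝ) : ℝ) : ℂ) * U τ ξ) :=
      memLp_one_iff_integrable.1 ⟨jap_weight_aestronglyMeasurable _ _ (h.1 ξ),
        (eLpNorm_ne_top_of_xNorm (ENNReal.add_ne_top.1 h.2.ne).2 ξ).lt_top⟩
    have hr' : LocallyIntegrable (fun τ => ((jap (τ + (ξ : ℝ) ^ 2) ^ (-1 : ℝ) : ℝ) : ℂ) * U τ ξ) :=
      hr.locallyIntegrable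
    have hc : Continuous fun τ : ℝ => ((jap (τ + (ξ : ℝ) ^ 2) ^ (1 : ℝ) : ℝ) : ℂ) :=
      Complex.continuous_ofReal.comp ((continuous_jap_rpow 1).comp (by fun_prop))
    have hI : IntegrableOn (fun τ => ((jap (τ + (ξ : ℝ) ^ 2) ^ (1 : ℝ) : ℝ) : ℂ) *
        (((jap (τ + (ξ : ℝ) ^ 2) ^ (-1 : ℝ) : ℝ) : ℂ) * U τ ξ)) (Set.Icc (-(R : ℝ)) R) :=
      hr.integrableOn.continuousOn_mul hc.continuousOn isCompact_Icc
    refine (hI.mono_set Set.Ioc_subset_Icc_self).congr (ae_of_all _ fun τ => ?_)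
    simp only
    rw [← mul_assoc, ← Complex.ofReal_mul, ← Real.rpow_add (jap_pos _)]
    norm_num
  · exact integrable_zero _ _ _

lemma norm_boxed_le (U : ℝ → ℤ → ℂ) (R : ℕ) (τ : ℝ) (ξ : ℤ) : ‖boxed U R τ ξ‖ ≤ ‖U τ ξ‖ := by
  unfold boxed
  split_ifs
  · exact norm_indicator_le_norm_self _ _
  · simp

lemma boxed_eq {U : ℝ → ℤ → ℂ} {R R' : ℕ} (hR : R ≤ R') {τ : ℝ} {ξ : ℤ} :
    boxed U R τ ξ = boxed U R' τ ξ ∨ boxed U R τ ξ = 0 := by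
  have hR' : (R : ℝ) ≤ R' := by exact_mod_cast hR
  unfold boxed
  by_cases h1 : ξ ∈ Finset.Icc (-(R : ℤ)) R
  · have h2 : ξ ∈ Finset.Icc (-(R' : ℤ)) R' := by
      rw [Finset.mem_Icc] at h1 ⊢
      omega
    rw [if_pos h1, if_pos h2]
    by_cases h3 : τ ∈ Set.Ioc (-(R : ℝ)) R
    · have h4 : τ ∈ Set.Ioc (-(R' : ℝ)) R' := ⟨by linarith [h3.1], by linarith [h3.2]⟩
      rw [Set.indicator_of_mem h3, Set.indicator_of_mem h4]
      exact Or.inl rfl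
    · exact Or.inr (Set.indicator_of_notMem h3 _)
  · exact Or.inr (if_neg h1)

lemma boxed_eq_or (U : ℝ → ℤ → ℂ) (R : ℕ) (τ : ℝ) (ξ : ℤ) :
    boxed U R τ ξ = U τ ξ ∨ boxed U R τ ξ = 0 := by
  unfold boxed
  split_ifs
  · by_cases h : τ ∈ Set.Ioc (-(R : ℝ)) R
    · exact Or.inl (Set.indicator_of_mem h _)
    · exact Or.inr (Set.indicator_of_notMem h _)
  · exact Or.inr rfl

/-- Inside the box of size N both truncations equal U; outside, each is U or 0. Hence all
differences beyond N are dominated by a single tail. -/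
lemma norm_boxed_sub_le (U : ℝ → ℤ → ℂ) {N R R' : ℕ} (hR : N ≤ R) (hR' : N ≤ R') (τ : ℝ) (ξ : ℤ) :
    ‖boxed U R τ ξ - boxed U R' τ ξ‖ ≤ ‖U τ ξ - boxed U N τ ξ‖ := by
  rcases boxed_eq_or U N τ ξ with h | h
  · have key : ∀ {M : ℕ}, N ≤ M → boxed U M τ ξ = U τ ξ := by
      intro M hM
      rcases boxed_eq (U := U) hM (τ := τ) (ξ := ξ) with h' | h'
      · rw [← h', h]
      · rw [h] at h'
        rcases boxed_eq_or U M τ ξ with h'' | h''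
        · exact h''
        · rw [h'', h']
    rw [key hR, key hR', h]
  · rw [h, sub_zero]
    rcases boxed_eq_or U R τ ξ with h1 | h1 <;> rcases boxed_eq_or U R' τ ξ with h2 | h2 <;>
      simp [h1, h2]

lemma eventually_boxed_eq (U : ℝ → ℤ → ℂ) (τ : ℝ) (ξ : ℤ) : ∀ᶠ R in atTop, boxed U R τ ξ = U τ ξ := by
  obtain ⟨N, hN⟩ := exists_nat_gt (max |τ| |(ξ : ℝ)|)
  filter_upwards [eventually_ge_atTop N] with R hR
  have hR' : (N : ℝ) ≤ R := by exact_mod_cast hR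
  have h1 : |τ| < R := (le_max_left _ _).trans_lt (hN.trans_le hR')
  have h2 : |(ξ : ℝ)| < R := (le_max_right _ _).trans_lt (hN.trans_le hR')
  have h3 : |ξ| < R := by exact_mod_cast h2
  rw [abs_lt] at h1 h3
  unfold boxed
  rw [if_pos (Finset.mem_Icc.2 ⟨h3.1.le, h3.2.le⟩)]
  exact Set.indicator_of_mem (Set.mem_Ioc.2 ⟨h1.1, h1.2.le⟩) _

lemma zNorm_mono {a : ℝ} {U W : ℝ → ℤ → ℂ} (h : ∀ τ ξ, ‖U τ ξ‖ ≤ ‖W τ ξ‖) : zNorm a U ≤ zNorm a W := by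
  have key : ∀ (q : ℝ≥0∞) (b : ℝ), xNorm 2 q a b U ≤ xNorm 2 q a b W := by
    intro q b
    rw [xNorm_eq_hNorm, xNorm_eq_hNorm]
    refine hNorm_mono fun ξ => eLpNorm_mono fun τ => ?_
    rw [norm_mul, norm_mul]
    exact mul_le_mul_of_nonneg_left (h τ ξ) (norm_nonneg _)
  exact add_le_add (key _ _) (key _ _)

lemma tendsto_eLpNorm_zero {q : ℝ≥0∞} (hq : q ≠ 0) (hq' : q ≠ ∞) {f : ℕ → ℝ → ℂ} {g : ℝ → ℂ}
    (hf : ∀ n, AEStronglyMeasurable (f n) volume) (hfg : ∀ n τ, ‖f n τ‖ ≤ ‖g τ‖)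
    (hg : eLpNorm g q volume ≠ ∞) (h0 : ∀ τ, ∀ᶠ n in atTop, f n τ = 0) :
    Tendsto (fun n => eLpNorm (f n) q volume) atTop (𝓝 0) := by
  have hpos : 0 < q.toReal := ENNReal.toReal_pos hq hq'
  have hlim : Tendsto (fun n => ∫⁻ τ, ‖f n τ‖ₑ ^ q.toReal) atTop (𝓝 (∫⁻ _ : ℝ, (0 : ℝ≥0∞))) := by
    refine tendsto_lintegral_of_dominated_convergence' (fun τ => ‖g τ‖ₑ ^ q.toReal)
      (fun n => (hf n).enorm.pow_const _) (fun n => ae_of_all _ fun τ => ?_) ?_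
      (ae_of_all _ fun τ => ?_)
    · exact ENNReal.rpow_le_rpow (enorm_le_iff_norm_le.2 (hfg n τ)) hpos.le
    · exact (lintegral_rpow_enorm_lt_top_of_eLpNorm_lt_top hq hq' hg.lt_top).ne
    · refine tendsto_const_nhds.congr' ?_
      filter_upwards [h0 τ] with n hn
      rw [hn, enorm_zero, ENNReal.zero_rpow_of_pos hpos]
  rw [lintegral_zero] at hlim
  simp_rw [eLpNorm_eq_lintegral_rpow_enorm_toReal hq hq']
  have := hlim.ennrpow_const (1 / q.toReal)
  rwa [ENNReal.zero_rpow_of_pos (by positivity)] at this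

lemma tendsto_hNorm_zero {a : ℝ} {c : ℕ → ℤ → ℝ≥0∞} {C : ℤ → ℝ≥0∞} (hc : ∀ n ξ, c n ξ ≤ C ξ)
    (hC : hNorm a C ≠ ∞) (h0 : ∀ ξ, Tendsto (fun n => c n ξ) atTop (𝓝 0)) :
    Tendsto (fun n => hNorm a (c n)) atTop (𝓝 0) := by
  have hC' : ∑' ξ : ℤ, (ENNReal.ofReal (jap ξ ^ a) * C ξ) ^ 2 ≠ ∞ := by
    intro h
    apply hC
    rw [hNorm, h]
    simp
  have hlim : Tendsto (fun n => ∑' ξ : ℤ, (ENNReal.ofReal (jap ξ ^ a) * c n ξ) ^ 2) atTop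
      (𝓝 (∫⁻ _ : ℤ, (0 : ℝ≥0∞) ∂Measure.count)) := by
    simp_rw [← lintegral_count]
    refine tendsto_lintegral_of_dominated_convergence
      (fun ξ : ℤ => (ENNReal.ofReal (jap ξ ^ a) * C ξ) ^ 2) (fun n => measurable_from_top)
      (fun n => ae_of_all _ fun ξ => ?_) (by rwa [lintegral_count]) (ae_of_all _ fun ξ => ?_)
    · exact pow_le_pow_left' (mul_le_mul_right (hc n ξ) _) 2
    · have := ENNReal.Tendsto.pow (n := 2) (ENNReal.Tendsto.const_mul
        (a := ENNReal.ofReal (jap ξ ^ a)) (h0 ξ) (Or.inr ENNReal.ofReal_ne_top))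
      simpa using this
  rw [lintegral_zero] at hlim
  have := hlim.ennrpow_const (1 / 2 : ℝ)
  rwa [ENNReal.zero_rpow_of_pos (by norm_num)] at this

/-- Dominated convergence, first in τ at each frequency and then in ξ, with U itself as the
majorant. -/
lemma MemZHat.tendsto_zNorm_sub_boxed {a : ℝ} {U : ℝ → ℤ → ℂ} (h : MemZHat a U) :
    Tendsto (fun N => zNorm a fun τ ξ => U τ ξ - boxed U N τ ξ) atTop (𝓝 0) := by
  have hle : ∀ N τ ξ, ‖U τ ξ - boxed U N τ ξ‖ ≤ ‖U τ ξ‖ := by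
    intro N τ ξ
    rcases boxed_eq_or U N τ ξ with h | h <;> simp [h]
  have key : ∀ (q : ℝ≥0∞) (b : ℝ), q ≠ 0 → q ≠ ∞ → xNorm 2 q a b U ≠ ∞ →
      Tendsto (fun N => xNorm 2 q a b fun τ ξ => U τ ξ - boxed U N τ ξ) atTop (𝓝 0) := by
    intro q b hq hq' hfin
    have hw : ∀ N τ (ξ : ℤ), ‖((jap (τ + (ξ : ℝ) ^ 2) ^ b : ℝ) : ℂ) * (U τ ξ - boxed U N τ ξ)‖
        ≤ ‖((jap (τ + (ξ : ℝ) ^ 2) ^ b : ℝ) : ℂ) * U τ ξ‖ := by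
      intro N τ ξ
      rw [norm_mul, norm_mul]
      exact mul_le_mul_of_nonneg_left (hle N τ ξ) (norm_nonneg _)
    simp_rw [xNorm_eq_hNorm]
    rw [xNorm_eq_hNorm] at hfin
    refine tendsto_hNorm_zero (fun N ξ => eLpNorm_mono fun τ => hw N τ ξ) hfin fun ξ => ?_
    refine tendsto_eLpNorm_zero hq hq' (fun N => jap_weight_aestronglyMeasurable _ _
      ((h.1 ξ).sub (h.integrable_boxed N ξ).1)) (fun N τ => hw N τ ξ) (ne_top_of_hNorm_ne_top hfin ξ)
      fun τ => ?_
    filter_upwards [eventually_boxed_eq U τ ξ] with N hN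
    rw [hN, sub_self, mul_zero]
  have hfin := ENNReal.add_ne_top.1 h.2.ne
  have := (key 2 (-1 / 2) (by norm_num) (by norm_num) hfin.1).add
    (key 1 (-1) (by norm_num) (by norm_num) hfin.2)
  rwa [add_zero] at this

/-! ### The limit of the truncated forms -/

lemma zNorm_boxed_le {a : ℝ} {U : ℝ → ℤ → ℂ} (R : ℕ) : zNorm a (boxed U R) ≤ zNorm a U :=
  zNorm_mono fun τ ξ => norm_boxed_le U R τ ξ

lemma MemZHat.zData_truncation {a T : ℝ} {U : ℝ → ℤ → ℂ} (h : MemZHat a U) (hT : 0 ≤ T) (R : ℕ) :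
    ZData a T (xFT (truncation U R)) (boxed U R) :=
  zData_of_rep hT (Finset.Icc (-(R : ℤ)) R) (h.integrable_boxed R)
    (fun _ hξ _ => if_neg hξ) (xFT_truncation U R)
    (ne_top_of_le_ne_top h.2.ne (zNorm_boxed_le R))

lemma MemZHat.zData_truncation_sub {a T : ℝ} {U : ℝ → ℤ → ℂ} (h : MemZHat a U) (hT : 0 ≤ T)
    (R R' : ℕ) :
    ZData a T (xFT fun t x => truncation U R t x - truncation U R' t x)
      (fun τ ξ => boxed U R τ ξ - boxed U R' τ ξ) := by
  refine zData_of_rep hT (Finset.Icc (-(R : ℤ)) R ∪ Finset.Icc (-(R' : ℤ)) R')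
    (fun ξ => (h.integrable_boxed R ξ).sub (h.integrable_boxed R' ξ)) (fun ξ hξ τ => ?_)
    (fun t ξ => ?_) ?_
  · rw [Finset.mem_union, not_or] at hξ
    rw [boxed, boxed, if_neg hξ.1, if_neg hξ.2, sub_zero]
  · rw [xFT_sub (continuous_truncation U R t) (continuous_truncation U R' t), xFT_truncation,
      xFT_truncation, ← mul_sub, ← integral_sub]
    · simp_rw [mul_sub]
    · exact (h.integrable_boxed R ξ).bdd_mul (c := 1) (Continuous.aestronglyMeasurable (by fun_prop))
        (ae_of_all _ fun τ => (norm_exp_I_mul t τ).le)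
    · exact (h.integrable_boxed R' ξ).bdd_mul (c := 1) (Continuous.aestronglyMeasurable (by fun_prop))
        (ae_of_all _ fun τ => (norm_exp_I_mul t τ).le)
  · refine ne_top_of_le_ne_top h.2.ne (zNorm_mono fun τ ξ => ?_)
    refine (norm_boxed_sub_le U (Nat.zero_le R) (Nat.zero_le R') τ ξ).trans ?_
    rcases boxed_eq_or U 0 τ ξ with h | h <;> simp [h]

lemma quadForm_sub {s T : ℝ} (hT : 0 ≤ T) {u₁ u₂ u₃ u w : ℝ → Torus → ℂ} (hu : ∀ t, Continuous (u t))
    (hw : ∀ t, Continuous (w t))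
    (su : ∀ᵐ t ∂(volume.restrict (Set.Icc 0 T)), Summable (quadTerm s u₁ u₂ u₃ u t))
    (sw : ∀ᵐ t ∂(volume.restrict (Set.Icc 0 T)), Summable (quadTerm s u₁ u₂ u₃ w t))
    (iu : IntervalIntegrable (quadSum s u₁ u₂ u₃ u) volume 0 T)
    (iw : IntervalIntegrable (quadSum s u₁ u₂ u₃ w) volume 0 T) :
    quadForm s T u₁ u₂ u₃ (fun t x => u t x - w t x)
      = quadForm s T u₁ u₂ u₃ u - quadForm s T u₁ u₂ u₃ w := by
  unfold quadForm
  rw [← intervalIntegral.integral_sub iu iw, intervalIntegral.integral_of_le hT,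
    intervalIntegral.integral_of_le hT]
  rw [← restrict_Ioc_eq_restrict_Icc] at su sw
  refine integral_congr_ae ?_
  filter_upwards [su, sw] with t h₁ h₂
  unfold quadSum
  rw [← h₁.tsum_sub h₂]
  refine tsum_congr fun ξ => ?_
  rw [quadTerm, quadTerm, quadTerm, xFT_bar fun t x => u t x - w t x, xFT_bar u, xFT_bar w, xFT_sub (hu t) (hw t), map_sub,
    mul_sub]

end DNLS

end

/-! ### The estimate and the limit for distributional fourth factors -/

theorem lemma5p5 (a s : ℝ) (ha : 1 / 4 < a) (has : a < s) (hs : s < min (1 / 2) (3 * a / 2)) :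
    ∃ C : ℝ, 0 < C ∧
      ∀ T : ℝ, 0 < T → T < 1 →
      ∀ u₁ u₂ u₃ : ℝ → DNLS.Torus → ℂ,
        DNLS.MemY a u₁ → DNLS.MemY a u₂ → DNLS.MemY a u₃ →
        (∀ u₄ : ℝ → DNLS.Torus → ℂ, DNLS.MemZL2 a u₄ →
          (∀ᵐ t ∂(volume.restrict (Set.Icc 0 T)),
            Summable (DNLS.quadTerm s u₁ u₂ u₃ u₄ t)) ∧
          IntervalIntegrable (DNLS.quadSum s u₁ u₂ u₃ u₄) volume 0 T ∧
          ‖DNLS.quadForm s T u₁ u₂ u₃ u₄‖ ≤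
            C * (DNLS.zNorm a (DNLS.stFT u₄)).toReal *
              ((DNLS.yNorm a (DNLS.stFT u₁)).toReal * (DNLS.yNorm a (DNLS.stFT u₂)).toReal *
                (DNLS.yNorm a (DNLS.stFT u₃)).toReal)) ∧
        (∀ U₄ : ℝ → ℤ → ℂ, DNLS.MemZHat a U₄ →
          ∃ L : ℂ,
            Tendsto (fun R : ℕ => DNLS.quadForm s T u₁ u₂ u₃ (DNLS.truncation U₄ R))
              atTop (𝓝 L) ∧
            ‖L‖ ≤
              C * (DNLS.zNorm a U₄).toReal *
                ((DNLS.yNorm a (DNLS.stFT u₁)).toReal * (DNLS.yNorm a (DNLS.stFT u₂)).toReal *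
                  (DNLS.yNorm a (DNLS.stFT u₃)).toReal)) := by
  have hs₁ : s < 1 / 2 := hs.trans_le (min_le_left _ _)
  have hs₂ : s < 3 * a / 2 := hs.trans_le (min_le_right _ _)
  -- The last two bounds are 1 + 2ε ≤ 4a and 2 + 4ε ≤ 6a + 2(1 - 2s), solved for ε; they leave room
  -- exactly because a > 1/4 and s < 3a/2.
  obtain ⟨ε, hε, hεle⟩ : ∃ ε : ℝ, 0 < ε ∧ ε ≤ min (1 / 2) (min ((4 * a - 1) / 2) ((6 * a - 4 * s) / 4)) :=
    ⟨_, lt_min (by norm_num) (lt_min (by linarith) (by linarith)), le_rfl⟩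
  rw [le_min_iff, le_min_iff] at hεle
  obtain ⟨e₁, e₂, e₃⟩ := hεle
  obtain ⟨K, hK, bound⟩ := DNLS.exists_quadForm_bound (a := a) (s := s) hε e₁ (by linarith) hs₁
    (by linarith) (by linarith) (by linarith) (by linarith)
  -- The summand 1 makes the constant strictly positive even if `K` is 0.
  refine ⟨K.toReal + 1, by positivity, ?_⟩
  intro T hT hT' u₁ u₂ u₃ h₁ h₂ h₃
  obtain ⟨F₁, d₁, n₁⟩ := h₁.exists_yData T
  obtain ⟨F₂, d₂, n₂⟩ := h₂.exists_yData T
  obtain ⟨F₃, d₃, n₃⟩ := h₃.exists_yData T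
  set Y : ℝ≥0∞ := DNLS.yNorm a F₁ * DNLS.yNorm a F₂ * DNLS.yNorm a F₃ with hY
  have hYtop : Y ≠ ∞ := ENNReal.mul_ne_top (ENNReal.mul_ne_top d₁.norm_ne_top d₂.norm_ne_top) d₃.norm_ne_top
  have toReal_bound : ∀ (z : ℂ) (Z : ℝ≥0∞), Z ≠ ∞ → ‖z‖ₑ ≤ K * (Z * Y) →
      ‖z‖ ≤ (K.toReal + 1) * Z.toReal *
        ((DNLS.yNorm a (DNLS.stFT u₁)).toReal * (DNLS.yNorm a (DNLS.stFT u₂)).toReal *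
          (DNLS.yNorm a (DNLS.stFT u₃)).toReal) := by
    intro z Z hZ hz
    have h := ENNReal.toReal_mono (ENNReal.mul_ne_top hK (ENNReal.mul_ne_top hZ hYtop)) hz
    rw [toReal_enorm, ENNReal.toReal_mul, ENNReal.toReal_mul, hY, ENNReal.toReal_mul,
      ENNReal.toReal_mul, n₁, n₂, n₃, ← mul_assoc] at h
    refine h.trans ?_
    gcongr
    linarith
  refine ⟨fun u₄ h₄ => ?_, fun U₄ h₄ => ?_⟩
  · obtain ⟨p₁, p₂, p₃⟩ := bound T hT.le hT'.le u₁ u₂ u₃ u₄ F₁ F₂ F₃ _ d₁ d₂ d₃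
      (h₄.zData hT.le hT'.le)
    exact ⟨p₁, p₂, toReal_bound _ _ h₄.2.ne p₃⟩
  · have b := fun R => bound T hT.le hT'.le u₁ u₂ u₃ _ F₁ F₂ F₃ _ d₁ d₂ d₃
      (h₄.zData_truncation hT.le R)
    set q : ℕ → ℂ := fun R => DNLS.quadForm s T u₁ u₂ u₃ (DNLS.truncation U₄ R) with hq
    have tails := h₄.tendsto_zNorm_sub_boxed
    have htail : ∀ N, DNLS.zNorm a (fun τ ξ => U₄ τ ξ - DNLS.boxed U₄ N τ ξ) ≠ ∞ := fun N =>
      ne_top_of_le_ne_top h₄.2.ne (DNLS.zNorm_mono fun τ ξ => by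
        rcases DNLS.boxed_eq_or U₄ N τ ξ with h | h <;> simp [h])
    have hcauchy : CauchySeq q := by
      -- The estimate is applied to the difference of two truncations; its Z norm is at most that of
      -- the tail beyond N, uniformly in R, R' ≥ N.
      refine cauchySeq_of_le_tendsto_0 (fun N => (K *
        (DNLS.zNorm a (fun τ ξ => U₄ τ ξ - DNLS.boxed U₄ N τ ξ) * Y)).toReal) ?_ ?_
      · intro R R' N hR hR'
        obtain ⟨-, -, p⟩ := bound T hT.le hT'.le u₁ u₂ u₃ _ F₁ F₂ F₃ _ d₁ d₂ d₃
          (h₄.zData_truncation_sub hT.le R R')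
        rw [DNLS.quadForm_sub hT.le (DNLS.continuous_truncation U₄ R)
          (DNLS.continuous_truncation U₄ R') (b R).1 (b R').1 (b R).2.1 (b R').2.1] at p
        rw [dist_eq_norm, ← toReal_enorm]
        refine ENNReal.toReal_mono (ENNReal.mul_ne_top hK (ENNReal.mul_ne_top (htail N) hYtop))
          (p.trans ?_)
        gcongr
        exact DNLS.zNorm_mono fun τ ξ => DNLS.norm_boxed_sub_le U₄ hR hR' τ ξ
      · have t₁ := ENNReal.Tendsto.const_mul (a := K) (ENNReal.Tendsto.mul_const (b := Y) tails
          (Or.inr hYtop)) (Or.inr hK)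
        rw [zero_mul, mul_zero] at t₁
        exact (ENNReal.tendsto_toReal ENNReal.zero_ne_top).comp t₁
    obtain ⟨L, hL⟩ := cauchySeq_tendsto_of_complete hcauchy
    refine ⟨L, hL, le_of_tendsto hL.norm (Eventually.of_forall fun R => ?_)⟩
    refine toReal_bound _ _ h₄.2.ne ((b R).2.2.trans ?_)
    gcongr
    exact DNLS.zNorm_boxed_le R
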